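/- A poset positional game is a triple $(X,\mathcal F,P)$, where $X$ is a finite set of vertices, $\mathcal F$ is a collection of subsets of $X$ (the winning sets) and $P$ is a partial order on $X$. Maker and Breaker alternately claim an unclaimed vertex all of whose smaller vertices have already been claimed, Maker moving first, until all vertices are claimed. Maker wins if she claims all the vertices of some winning set; otherwise Breaker wins. The problem MB Poset Positional Game takes $(X,\mathcal F,P)$ as input and asks which of the two players has a winning strategy. **Theorem.** MB Poset Positional Game can be solved in time $O(h^{2(w+1)})$ on instances where the poset consists of $w$ pairwise disjoint chains of height at most $h$ (elements of different chains being incomparable) and all winning sets have size at most $2$. Precisely: there are one word-RAM program and constants $C,h_0$ such that, for all $h\ge h_0$ and all $w$, on each such instance the program halts after at most $C\,h^{2(w+1)}$ unit-cost steps, all numbers occurring in the input and during the computation being at most $C\,h^{2(w+1)}$, and outputs the player who has a winning strategy. (The input lists the number of vertices, the number of winning sets, the matrix of the order relation, and the winning sets without repetition. In particular, for each fixed $w$, the running time is at most $C_w h^{2(w+1)}$ for all $h\ge 1$.) -/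

import Mathlib

/-! ### Maker-Breaker poset positional games -/

/-- The two players of the Maker-Breaker convention. -/
inductive Player where
  | maker
  | breaker
  deriving DecidableEq

namespace Player

/-- The opponent of a player. -/
def other : Player → Player
  | maker => breaker
  | breaker => maker

/-- The answer `1` stands for Maker, the answer `0` for Breaker. -/
def code : Player → ℕ
  | maker => 1
  | breaker => 0

end Player

/-- A poset positional game on a board `X` (finite, wherever it is used); the poset is the order
of `X`. -/
structure PosetGame (X : Type*) [PartialOrder X] where
  /-- the collection of winning sets -/
  winningSets : Set (Set X)

namespace PosetGame

variable {X : Type*} [PartialOrder X]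

/-- `x` may be claimed when the set of vertices claimed so far is `claimed`: it is unclaimed, and
all smaller vertices are claimed. -/
def Available (claimed : Set X) (x : X) : Prop :=
  x ∉ claimed ∧ ∀ y, y < x → y ∈ claimed

/-- Maker, who has claimed the set `M`, has filled up a winning set. -/
def Filled (G : PosetGame X) (M : Set X) : Prop :=
  ∃ S ∈ G.winningSets, S ⊆ M

/-- The sets claimed by the two players, updated after player `q` claims `x`. -/
def claim (pos : Player → Set X) (q : Player) (x : X) : Player → Set X :=
  Function.update pos q (insert x (pos q))

/-- `G.WinsFrom p q pos`: player `p` has a winning strategy in the game `G` from the position where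
each player `r` has claimed `pos r` and it is the turn of `q`. Its proofs are the strategy trees of
`p`. Maker wins a play if she fills up a winning set at some point; since claimed vertices stay
claimed, this can be read off when the whole board is claimed. Otherwise Breaker wins. -/
inductive WinsFrom (G : PosetGame X) (p : Player) : Player → (Player → Set X) → Prop
  | finished (q : Player) (pos : Player → Set X)
      (hall : ∀ x, x ∈ pos .maker ∪ pos .breaker)
      (hwin : p = .maker ↔ G.Filled (pos .maker)) : WinsFrom G p q pos
  | own (pos : Player → Set X) (x : X)
      (hx : Available (pos .maker ∪ pos .breaker) x)
      (hnext : WinsFrom G p p.other (claim pos p x)) : WinsFrom G p p pos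
  | opponent (pos : Player → Set X)
      (hex : ∃ x, x ∉ pos .maker ∪ pos .breaker)
      (hnext : ∀ x, Available (pos .maker ∪ pos .breaker) x →
        WinsFrom G p p (claim pos p.other x)) : WinsFrom G p p.other pos

/-- Player `p` has a winning strategy in `G` when Maker starts. -/
def HasWinningStrategy (G : PosetGame X) (p : Player) : Prop :=
  G.WinsFrom p .maker (fun _ => ∅)

open Classical in
/-- `G.Encodes inp`: the list of numbers `inp` is an encoding of the game `G`. For some numbering
`e` of the vertices by `0, …, n - 1`, and some enumeration `L` without repetition of the winning
sets, each given as a list of vertices without repetition, `inp` consists of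
* the number `n` of vertices and the number of winning sets,
* the `n × n` matrix of the order relation, row by row, with entry `1` at `(i, j)` if
  `e i ≤ e j` and `0` otherwise,
* for each winning set, its size followed by its elements. -/
def Encodes (G : PosetGame X) (inp : List ℕ) : Prop :=
  ∃ (n : ℕ) (e : Fin n ≃ X) (L : List (List (Fin n))),
    (∀ l ∈ L, l.Nodup) ∧
    (L.map fun l => {x : X | ∃ i ∈ l, e i = x}).Nodup ∧
    (∀ S : Set X, S ∈ G.winningSets ↔ ∃ l ∈ L, S = {x : X | ∃ i ∈ l, e i = x}) ∧
    inp = n :: L.length ::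
      ((List.finRange n).flatMap fun i =>
        (List.finRange n).map fun j => if e i ≤ e j then 1 else 0) ++
      L.flatMap fun l => l.length :: l.map fun i => (i : ℕ)

end PosetGame

/-- The poset `X` consists of `w` pairwise disjoint chains of height at most `h`: it is the union of
chains `K 0, …, K (w - 1)`, each with at most `h` elements, that are pairwise disjoint, and elements
of different chains are incomparable. -/
def ConsistsOfDisjointChains (X : Type*) [PartialOrder X] (w h : ℕ) : Prop :=
  ∃ K : Fin w → Set X,
    (∀ i, IsChain (· ≤ ·) (K i)) ∧
    (∀ i, (K i).encard ≤ h) ∧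
    (∀ i j, i ≠ j → Disjoint (K i) (K j)) ∧
    (∀ i j, i ≠ j → ∀ x ∈ K i, ∀ y ∈ K j, ¬ x ≤ y) ∧
    ∀ x, ∃ i, x ∈ K i

/-! ### Word RAM programs with unit cost -/

namespace RAM

/-- The arithmetic operations of the machine, on natural numbers: subtraction is truncated at `0`,
and `div` and `mod` are the quotient and the remainder. -/
inductive Op where
  | add
  | sub
  | mul
  | div
  | mod

/-- The value of an arithmetic operation. -/
def Op.eval : Op → ℕ → ℕ → ℕ
  | add, a, b => a + b
  | sub, a, b => a - b
  | mul, a, b => a * b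
  | div, a, b => a / b
  | mod, a, b => a % b

/-- Programs of a random access machine, in structured form. A program mentions finitely many
registers; the memory is accessed by indirect addressing only. -/
inductive Program where
  /-- do nothing -/
  | skip
  /-- `reg d := k` -/
  | const (d k : ℕ)
  /-- `reg d := reg a op reg b` -/
  | arith (op : Op) (d a b : ℕ)
  /-- `reg d := mem (reg a)` -/
  | load (d a : ℕ)
  /-- `mem (reg a) := reg b` -/
  | store (a b : ℕ)
  /-- first `P`, then `Q` -/
  | seq (P Q : Program)
  /-- `P` if `reg a ≠ 0`, and `Q` otherwise -/
  | ite (a : ℕ) (P Q : Program)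
  /-- repeat `P` as long as `reg a ≠ 0` -/
  | loop (a : ℕ) (P : Program)

/-- The contents of the registers and of the memory cells. -/
structure State where
  reg : ℕ → ℕ
  mem : ℕ → ℕ

/-- `Runs B P s t s'`: started in the state `s`, the program `P` halts in the state `s'` after `t`
steps, and no number greater than `B` is ever written, that is, words of `log₂ (B + 1)` bits
(rounded up) suffice. Each operation and each test of a register costs one step. -/
inductive Runs (B : ℕ) : Program → State → ℕ → State → Prop
  | skip (s : State) : Runs B .skip s 1 s
  | const (s : State) (d k : ℕ) (hB : k ≤ B) :
      Runs B (.const d k) s 1 { s with reg := Function.update s.reg d k }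
  | arith (s : State) (op : Op) (d a b : ℕ) (hB : op.eval (s.reg a) (s.reg b) ≤ B) :
      Runs B (.arith op d a b) s 1
        { s with reg := Function.update s.reg d (op.eval (s.reg a) (s.reg b)) }
  | load (s : State) (d a : ℕ) (hB : s.mem (s.reg a) ≤ B) :
      Runs B (.load d a) s 1 { s with reg := Function.update s.reg d (s.mem (s.reg a)) }
  | store (s : State) (a b : ℕ) (hB : s.reg b ≤ B) :
      Runs B (.store a b) s 1 { s with mem := Function.update s.mem (s.reg a) (s.reg b) }
  | seq {P Q : Program} {s s₁ s₂ : State} {t₁ t₂ : ℕ}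
      (hP : Runs B P s t₁ s₁) (hQ : Runs B Q s₁ t₂ s₂) : Runs B (.seq P Q) s (t₁ + t₂) s₂
  | ite_true {a : ℕ} {P Q : Program} {s s' : State} {t : ℕ}
      (ha : s.reg a ≠ 0) (hP : Runs B P s t s') : Runs B (.ite a P Q) s (1 + t) s'
  | ite_false {a : ℕ} {P Q : Program} {s s' : State} {t : ℕ}
      (ha : s.reg a = 0) (hQ : Runs B Q s t s') : Runs B (.ite a P Q) s (1 + t) s'
  | loop_done {a : ℕ} {P : Program} {s : State}
      (ha : s.reg a = 0) : Runs B (.loop a P) s 1 s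
  | loop_step {a : ℕ} {P : Program} {s s₁ s₂ : State} {t₁ t₂ : ℕ}
      (ha : s.reg a ≠ 0) (hP : Runs B P s t₁ s₁) (hloop : Runs B (.loop a P) s₁ t₂ s₂) :
      Runs B (.loop a P) s (1 + t₁ + t₂) s₂

/-- The initial state: all registers are `0`, and the memory holds the input from the cell `0` on,
followed by zeros. -/
def initial (inp : List ℕ) : State where
  reg := fun _ => 0
  mem := fun i => inp.getD i 0

/-- On the input `inp`, the program `P` halts after at most `T` steps with the answer `out` in the
register `0`, and all numbers in the input and during the computation are at most `B`. -/
def Program.Computes (P : Program) (B T : ℕ) (inp : List ℕ) (out : ℕ) : Prop :=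
  (∀ a ∈ inp, a ≤ B) ∧ ∃ t ≤ T, ∃ s : State, Runs B P (initial inp) t s ∧ s.reg 0 = out

end RAM

/-! ### The game on a disjoint union of chains -/

/-! On disjoint chains the unclaimed part of the board is given by the number `q j` of elements left
in each chain `j`. An element is a pair of a chain and a depth, the number of elements above it, so
the next element of chain `j` has depth `q j - 1`. Since winning sets have at most two elements,
what Maker's claims leave behind is a set `S` of threats, the elements whose claim wins for her.
This gives the abstract game `MW`, and `hasWinningStrategy_iff_mw` links it to the original one; an
empty winning set is treated separately.

At each turn of Maker the number of remaining elements has the same parity ε, that of the whole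
board. A remaining threat whose depth does not have parity ε wins for Maker. She keeps claiming
elements outside the part of the chain that starts with the predecessor of the threat; there is an
odd number of them, so Breaker is the first who has to enter that part, and he exposes the threat
(`MW.wait`, `MW.of_wrong`). All other threats have depth of parity ε. Of these only the first to
come up in each chain matters: at depth `i` it is stored as `m j = (i - ε) / 2 + 1`, and `cut ε (m
j) = i + 2` counts the elements from its predecessor on. If ε is 1, threats in two chains also win
for Maker (`MW.of_two`).

Call a chain frozen when `m j ≠ 0` and `q j` equals its cut. Breaker cannot start it without
exposing the threat. If Maker starts it, Breaker has to take the threat, and he can go on pairing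
moves inside the chain, so that Maker gets exactly the depths of parity other than ε. `NoBadEdge`
says that pairs through these elements do not help her; otherwise she wins by `MW.of_bad_edge`. For
ε equal to 0 a frozen chain is used up in pairs and can be ignored. For ε equal to 1 it has odd
length; Maker can take its last element, after which Breaker has to move elsewhere with the chain
gone. This is the last clause of `Step`; the clause before it treats moves of Maker in chains that
are not frozen.

Thus `q` and `m` suffice as the state of a dynamic program. If an entry is false, Maker wins by one
of the strategies above (`MW.of_not_table`). If it is true, Breaker survives by following the table
and pairing inside frozen chains (`MW.not_of_table`).

States are numbered in mixed radix with the digits of `q` above those of `m`, so that moves lead to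
smaller numbers and the table can be filled in increasing order. There are at most `((h / 2 + 1) *
(h + 1)) ^ w` states. Each has at most `w` moves and `w` replies, tested in O(n²) steps, where `n ≤
w * h`. For `h ≥ 7` the base is at most (3/4)h², and the factor (3/4)^w absorbs the polynomial in
`w`; this yields a constant independent of `w`. The rest is a small calculus of RAM expressions with
exact values and cost bounds (`Ev`, `Out`, `St`) by which the program is verified. -/

namespace ChainGame

variable {ι : Type*} [DecidableEq ι]

/-- Removes the lowest element of the chain `j`; `q j` is the number of elements that are left. -/
def dec (q : ι → ℕ) (j : ι) : ι → ℕ := Function.update q j (q j - 1)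

@[simp] theorem dec_self (q : ι → ℕ) (j : ι) : dec q j j = q j - 1 := by simp [dec]

theorem dec_of_ne (q : ι → ℕ) {i j : ι} (h : i ≠ j) : dec q j i = q i := by simp [dec, h]

theorem dec_le (q : ι → ℕ) (j i : ι) : dec q j i ≤ q i := by
  by_cases h : i = j
  · subst h; simp
  · rw [dec_of_ne q h]

theorem le_dec_add_one (q : ι → ℕ) (j i : ι) : q i ≤ dec q j i + 1 := by
  by_cases h : i = j
  · subst h; simp; omega
  · rw [dec_of_ne q h]; omega

theorem dec_apply (q : ι → ℕ) (j i : ι) : dec q j i = if i = j then q i - 1 else q i := by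
  by_cases h : i = j
  · subst h; simp
  · simp [dec_of_ne q h, h]

theorem sum_dec [Fintype ι] (q : ι → ℕ) {j : ι} (h : 0 < q j) :
    ∑ i, dec q j i + 1 = ∑ i, q i := by
  unfold dec
  rw [Finset.sum_update_of_mem (Finset.mem_univ j),
    ← Finset.add_sum_erase Finset.univ q (Finset.mem_univ j), Finset.sdiff_singleton_eq_erase]
  omega

/-- Maker, to move, wins the game on chains when `q j` elements are left in the chain `j` (those of
depth less than `q j`), and each element of `S` completes a winning set for her. The pairs that are
winning sets are given by `N`. -/
inductive MW (N : ι × ℕ → ι × ℕ → Prop) : (ι → ℕ) → Set (ι × ℕ) → Prop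
  | take {q : ι → ℕ} {S : Set (ι × ℕ)} (j : ι) (hj : 0 < q j) (hS : (j, q j - 1) ∈ S) : MW N q S
  | move {q : ι → ℕ} {S : Set (ι × ℕ)} (k : ι) (hk : 0 < q k) (hne : ∃ l, 0 < dec q k l)
      (hnext : ∀ l, 0 < dec q k l →
        MW N (dec (dec q k) l) (S ∪ {v | N (k, q k - 1) v})) : MW N q S

variable {N : ι × ℕ → ι × ℕ → Prop}

theorem MW.mono {q : ι → ℕ} {S S' : Set (ι × ℕ)} (h : MW N q S) (hS : S ⊆ S') : MW N q S' := by
  induction h generalizing S' with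
  | take j hj h => exact .take j hj (hS h)
  | move k hk hne _ ih =>
    exact .move k hk hne fun l hl => ih l hl (Set.union_subset_union_left _ hS)

theorem MW.take' {q : ι → ℕ} {S : Set (ι × ℕ)} {j : ι} {i : ℕ} (hq : q j = i + 1)
    (hS : (j, i) ∈ S) : MW N q S :=
  .take j (by omega) (by rwa [hq, Nat.add_sub_cancel])

/-! ### Waiting strategies of Maker. -/

variable [Fintype ι]

/-- If the number of elements above the cut `g` is odd, Maker can wait until Breaker has to pass the
cut. -/
theorem MW.wait {q : ι → ℕ} {S : Set (ι × ℕ)} (g : ι → ℕ) (hg : ∀ j, g j ≤ q j)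
    (hpar : (∑ j, q j + ∑ j, g j) % 2 = 1) (hne : ∃ j, 0 < g j)
    (H : ∀ (q' : ι → ℕ) (S' : Set (ι × ℕ)), S ⊆ S' → (∀ j, q' j ≤ q j) →
      (∑ j, q' j) % 2 = (∑ j, q j) % 2 → ∀ j, q' j + 1 = g j → (∀ i, i ≠ j → g i ≤ q' i) → MW N q' S') : MW N q S := by
  induction hs : ∑ j, q j using Nat.strong_induction_on generalizing q S with
  | _ s ih =>
  -- Parity excludes that no element of depth at least `g` is left, so Maker can claim one of them.
  obtain ⟨k, hk⟩ : ∃ k, g k < q k := by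
    by_contra! hcon
    have : ∑ j, q j = ∑ j, g j := Finset.sum_congr rfl fun j _ => le_antisymm (hcon j) (hg j)
    omega
  have hgk : ∀ j, g j ≤ dec q k j := by
    intro j
    by_cases h : j = k
    · subst h; simp; omega
    · rw [dec_of_ne q h]; exact hg j
  obtain ⟨j₀, hj₀⟩ := hne
  refine .move k (by omega) ⟨j₀, hj₀.trans_le (hgk j₀)⟩ fun l hl => ?_
  have h1 := sum_dec q (j := k) (by omega)
  have h2 := sum_dec (dec q k) hl
  have hle : ∀ j, dec (dec q k) l j ≤ q j := fun j => (dec_le _ _ _).trans (dec_le _ _ _)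
  -- Either Breaker also stays outside the cut, which restores the parity, or his move is the first
  -- one across it.
  rcases (hgk l).lt_or_eq with hlt | heq
  · refine ih (∑ j, dec (dec q k) l j) (by omega) ?_ (by omega) ?_ rfl
    · intro j
      by_cases h : j = l
      · subst h; simp; omega
      · rw [dec_of_ne _ h]; exact hgk j
    · intro q' S' hS' hq' hp j
      exact H q' S' (Set.subset_union_left.trans hS') (fun j => (hq' j).trans (hle j)) (by omega) j
  · refine H _ _ Set.subset_union_left hle (by omega) l (by simp; omega) fun i hi => ?_
    rw [dec_of_ne _ hi]; exact hgk i

/-- Maker wins if she has a threat of the wrong parity. -/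
theorem MW.of_wrong {q : ι → ℕ} {S : Set (ι × ℕ)} {j : ι} {i : ℕ} (hS : (j, i) ∈ S)
    (hi : i < q j) (hpar : (∑ j, q j + i) % 2 = 1) : MW N q S := by
  rcases (show i + 1 = q j ∨ i + 2 ≤ q j by omega) with h | h
  · exact .take' h.symm hS
  -- Beyond this cut lie the predecessor of the threat, the threat, and all that follows it;
  -- Breaker's first move across is the predecessor.
  · refine MW.wait (Function.update 0 j (i + 2)) ?_ ?_ ⟨j, by simp⟩ ?_
    · intro k
      by_cases hk : k = j
      · subst hk; simpa
      · simp [hk]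
    · rw [Finset.sum_update_of_mem (Finset.mem_univ j)]
      simp; omega
    · intro q' S' hS' _ _ k hk _
      by_cases hkj : k = j
      · subst hkj
        exact .take' (by simp at hk; omega) (hS' hS)
      · simp [hkj] at hk

theorem sum_two {j k : ι} (hjk : j ≠ k) (a b : ℕ) :
    ∑ i, Function.update (Function.update (0 : ι → ℕ) j a) k b i = a + b := by
  rw [Finset.sum_update_of_mem (Finset.mem_univ k),
    Finset.sum_update_of_mem (by simp [hjk])]
  simp; omega

omit [Fintype ι] in
theorem two_le {q : ι → ℕ} {j k : ι} (hjk : j ≠ k) {a b : ℕ} (ha : a ≤ q j) (hb : b ≤ q k) (i : ι) :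
    Function.update (Function.update (0 : ι → ℕ) j a) k b i ≤ q i := by
  by_cases h : i = k
  · subst h; simpa
  · by_cases h' : i = j
    · subst h'; simpa [h]
    · simp [h, h']

/-- The waiting strategy with a cut in two chains. -/
theorem MW.wait_two {q : ι → ℕ} {S : Set (ι × ℕ)} {j k : ι} (hjk : j ≠ k) {a b : ℕ} (ha : a ≤ q j)
    (hb : b ≤ q k) (ha0 : 0 < a) (hpar : (∑ i, q i + (a + b)) % 2 = 1)
    (Hj : ∀ (q' : ι → ℕ) (S' : Set (ι × ℕ)), S ⊆ S' → (∀ i, q' i ≤ q i) →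
      (∑ i, q' i) % 2 = (∑ i, q i) % 2 → q' j + 1 = a → b ≤ q' k →
      MW N q' S')
    (Hk : ∀ (q' : ι → ℕ) (S' : Set (ι × ℕ)), S ⊆ S' → (∀ i, q' i ≤ q i) →
      (∑ i, q' i) % 2 = (∑ i, q i) % 2 → q' k + 1 = b → a ≤ q' j →
      MW N q' S') : MW N q S := by
  refine MW.wait (Function.update (Function.update 0 j a) k b) (two_le hjk ha hb)
    (by rwa [sum_two hjk]) ⟨j, by simpa [hjk] using ha0⟩ ?_
  intro q' S' hS' hq' hp i hi hrest
  by_cases h : i = k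
  · subst h
    exact Hk q' S' hS' hq' hp (by simpa using hi) (by simpa [hjk] using hrest j hjk)
  · by_cases h' : i = j
    · subst h'
      exact Hj q' S' hS' hq' hp (by simpa [h] using hi) (by simpa using hrest k hjk.symm)
    · simp [h, h'] at hi

/-- If the number of remaining elements is odd, threats in two chains win for Maker. -/
theorem MW.of_two {q : ι → ℕ} {S : Set (ι × ℕ)} {j k : ι} {a b : ℕ} (hjk : j ≠ k)
    (ha : (j, a) ∈ S) (hb : (k, b) ∈ S) (haq : a < q j) (hbq : b < q k)
    (hpar : (∑ i, q i + (a + b)) % 2 = 1) : MW N q S := by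
  by_cases h1 : a + 1 = q j
  · exact .take' h1.symm ha
  by_cases h2 : b + 1 = q k
  · exact .take' h2.symm hb
  refine MW.wait_two hjk (a := a + 2) (b := b + 2) (by omega) (by omega) (by omega) (by omega) ?_ ?_
  · intro q' S' hS' _ _ h _
    exact .take' (by omega) (hS' ha)
  · intro q' S' hS' _ _ h _
    exact .take' (by omega) (hS' hb)

/-! ### Threats made by a claim, and pairs forced with the help of a frozen chain. -/

/-- Maker wins if by claiming an element she makes a threat of the wrong parity that Breaker cannot
answer. -/
theorem MW.claim {q : ι → ℕ} {S : Set (ι × ℕ)} {j l : ι} {a b : ℕ} (hq : q j = a + 1)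
    (hN : N (j, a) (l, b)) (hpar : (∑ i, q i + b) % 2 = 1) (hb : b < dec q j l)
    (H : b + 1 = dec q j l → ∀ S', S ⊆ S' → MW N (dec (dec q j) l) S') : MW N q S := by
  refine .move j (by omega) ⟨l, by omega⟩ fun i hi => ?_
  have h1 := sum_dec q (j := j) (by omega)
  have h2 := sum_dec (dec q j) hi
  have hmem : (l, b) ∈ S ∪ {v | N (j, q j - 1) v} := by
    right; simpa [hq] using hN
  -- Breaker can remove the new threat at once only if it is the next element of its chain; `H`
  -- covers this reply.
  by_cases hil : i = l ∧ b + 1 = dec q j l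
  · obtain ⟨rfl, hb'⟩ := hil
    exact H hb' _ Set.subset_union_left
  · refine .of_wrong hmem ?_ (by omega)
    by_cases h : l = i
    · subst h; simp at hil ⊢; omega
    · rwa [dec_of_ne _ h]

/-- A winning pair that Maker can force in a chain with a threat. -/
theorem MW.of_bad_edge {q : ι → ℕ} {S : Set (ι × ℕ)} {ε : ℕ} (hε : ε < 2)
    (hN : ∀ u v, N u v → N v u) (hirr : ∀ u, ¬ N u u) (hsum : (∑ i, q i) % 2 = ε) {j l : ι}
    {y a b : ℕ} (hy : (j, y) ∈ S) (hyq : q j = y + 2) (hyε : y % 2 = ε) (ha : a < q j)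
    (haε : a % 2 ≠ ε) (hb : b < q l) (hab : N (j, a) (l, b))
    (hbad : b % 2 ≠ ε ∨ (ε = 1 ∧ l ≠ j)) : MW N q S := by
  by_cases hlj : l = j
  · subst hlj
    replace hbad : b % 2 ≠ ε := by simpa using hbad
    -- The deeper element comes first. Waiting at its predecessor makes Breaker expose it. Both
    -- depths have the same parity, so after its claim the other element is not next in the chain
    -- and Breaker cannot remove the threat.
    have key : ∀ c d : ℕ, c < q l → d < c → c % 2 ≠ ε → d % 2 ≠ ε → N (l, c) (l, d) →
        MW N q S := by
      intro c d hc hd hcε hdε hcd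
      by_cases hcq : c + 1 = q l
      · exact .claim hcq.symm hcd (by omega) (by simp; omega) (by simp; omega)
      · refine MW.wait (Function.update 0 l (c + 2)) ?_ ?_ ⟨l, by simp⟩ ?_
        · intro k
          by_cases hk : k = l
          · subst hk; simp; omega
          · simp [hk]
        · rw [Finset.sum_update_of_mem (Finset.mem_univ l)]
          simp; omega
        · intro q' S' hS' _ hp k hk _
          by_cases hkl : k = l
          · subst hkl
            have hqk : q' k = c + 1 := by simp at hk; omega
            exact .claim hqk hcd (by omega) (by simp; omega) (by simp; omega)
          · simp [hkl] at hk
    have hne : a ≠ b := by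
      rintro rfl
      exact hirr _ hab
    rcases lt_or_gt_of_ne hne with h | h
    · exact key b a hb h (by omega) haε (hN _ _ hab)
    · exact key a b ha h haε (by omega) hab
  · have hjl : j ≠ l := Ne.symm hlj
    have hba := hN _ _ hab
    -- claiming `b` in the chain `l` while the threat `y` is in force
    have hclb : ∀ (q' : ι → ℕ) (S' : Set (ι × ℕ)), S ⊆ S' → (∑ i, q' i) % 2 = ε → q' l = b + 1 →
        q' j = y + 2 → MW N q' S' := by
      intro q' S' hS' hp hl hj
      refine .claim hl hba (by omega) (by rw [dec_of_ne _ hjl]; omega) ?_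
      intro h S'' hS''
      rw [dec_of_ne _ hjl] at h
      exact .take' (by simp [dec_of_ne _ hjl]; omega) (hS'' (hS' hy))
    by_cases hbq : b + 1 = q l
    · exact hclb q S subset_rfl hsum hbq.symm hyq
    by_cases hb2 : b % 2 = 1
    · refine MW.wait_two hjl (a := y + 2) (b := b + 2) (by omega) (by omega) (by omega) (by omega)
        ?_ ?_
      · intro q' S' hS' _ _ h _
        exact .take' (by omega) (hS' hy)
      · intro q' S' hS' hle hp h h'
        exact hclb q' S' hS' (by omega) (by omega) (by have := hle j; omega)
    · have hcla : ∀ (q' : ι → ℕ) (S' : Set (ι × ℕ)), (∑ i, q' i) % 2 = ε → q' j = a + 1 →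
          b + 2 ≤ q' l → MW N q' S' := by
        intro q' S' hp hj hl
        exact .claim hj hab (by omega) (by rw [dec_of_ne _ hlj]; omega)
          (by rw [dec_of_ne _ hlj]; omega)
      by_cases haq : a + 1 = q j
      · exact hcla q S hsum haq.symm (by omega)
      refine MW.wait_two hjl (a := a + 2) (b := b + 2) (by omega) (by omega) (by omega) (by omega)
        ?_ ?_
      · intro q' S' _ _ hp h h'
        exact hcla q' S' (by omega) (by omega) h'
      · intro q' S' _ _ hp h h'
        exact .claim (show q' l = b + 1 by omega) hba (by omega) (by rw [dec_of_ne _ hjl]; omega)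
          (by rw [dec_of_ne _ hjl]; omega)

/-! ### Adding an even number of elements to a finished chain. -/

omit [Fintype ι] in
theorem dec_update_of_ne (q : ι → ℕ) {j k : ι} (h : j ≠ k) (r : ℕ) :
    dec (Function.update q k r) j = Function.update (dec q j) k r := by
  unfold dec
  rw [Function.update_of_ne h, Function.update_comm h.symm]

-- Maker answers each move of Breaker in chain `k` by the next element of that chain, so its even
-- length only shrinks by two. The chain `l₀` guarantees that Breaker still has a reply, as
-- `MW.move` demands.
omit [Fintype ι] in
theorem MW.reply_even {q : ι → ℕ} {S : Set (ι × ℕ)} {k : ι} (hk : q k = 0) (hne : ∃ l, 0 < q l)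
    (h : ∀ l, 0 < q l → ∀ r, Even r → MW N (Function.update (dec q l) k r) S) {r : ℕ}
    (hr : Even r) (l : ι) (hl : 0 < Function.update q k r l) :
    MW N (dec (Function.update q k r) l) S := by
  obtain ⟨l₀, hl₀⟩ := hne
  have hlk₀ : l₀ ≠ k := by rintro rfl; omega
  induction r using Nat.strong_induction_on generalizing l with
  | _ r ihr =>
  by_cases hlk : l = k
  · subst hlk
    simp only [Function.update_self] at hl
    obtain ⟨r', rfl⟩ : ∃ r', r = r' + 2 := ⟨r - 2, by obtain ⟨c, rfl⟩ := hr; omega⟩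
    have hdec : dec (dec (Function.update q l (r' + 2)) l) l = Function.update q l r' := by
      simp [dec]
    refine .move l (by simp) ⟨l₀, ?_⟩ fun i hi => ?_
    · rw [hdec, Function.update_of_ne hlk₀]; exact hl₀
    · rw [hdec] at hi ⊢
      exact (ihr r' (by omega) (by simpa [Nat.even_add] using hr) i hi).mono Set.subset_union_left
  · rw [dec_update_of_ne _ hlk]
    rw [Function.update_of_ne hlk] at hl
    exact h l hl r hr

omit [Fintype ι] in
/-- An even number of elements on top of a chain can be added. -/
theorem MW.update_even {q : ι → ℕ} {S : Set (ι × ℕ)} (h : MW N q S) {k : ι} (hk : q k = 0) {r : ℕ}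
    (hr : Even r) : MW N (Function.update q k r) S := by
  induction h generalizing r with
  | @take q S j hj hS =>
    have hjk : j ≠ k := by rintro rfl; omega
    exact .take j (by rwa [Function.update_of_ne hjk]) (by rwa [Function.update_of_ne hjk])
  | @move q S j hj hne hnext ih =>
    have hjk : j ≠ k := by rintro rfl; omega
    have hqk : dec q j k = 0 := by rwa [dec_of_ne _ hjk.symm]
    have key := fun {r} => MW.reply_even (r := r) hqk hne (S := S ∪ {v | N (j, q j - 1) v}) (N := N)
        fun l hl r hr => by
      by_cases hlk : l = k
      · subst hlk; omega
      · exact ih l hl (by rwa [dec_of_ne _ (Ne.symm hlk)]) hr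
    obtain ⟨l₀, hl₀⟩ := hne
    have hlk₀ : l₀ ≠ k := by rintro rfl; omega
    refine .move j (by rwa [Function.update_of_ne hjk]) ⟨l₀, ?_⟩ ?_
    · rw [dec_update_of_ne _ hjk, Function.update_of_ne hlk₀]; exact hl₀
    · rw [dec_update_of_ne _ hjk, Function.update_of_ne hjk]
      exact key hr

/-! ### The recurrence for the positions that Breaker survives. -/

/-- The number of elements from the lowest known threat's predecessor on, in a chain where this
threat is described by `m`; there is none if `m = 0`. -/
def cut (ε m : ℕ) : ℕ := if m = 0 then 0 else 2 * m + ε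

theorem cut_mono (ε : ℕ) {m m' : ℕ} (h : m ≤ m') : cut ε m ≤ cut ε m' := by
  unfold cut; split_ifs <;> omega

theorem cut_of_ne {ε m : ℕ} (h : m ≠ 0) : cut ε m = 2 * m + ε := by simp [cut, h]

@[simp] theorem cut_zero (ε : ℕ) : cut ε 0 = 0 := rfl

/-- No threat is available, and if the number of elements is odd then there are threats in at most
one chain. -/
def Valid (ε : ℕ) (q m : ι → ℕ) : Prop :=
  (∀ j, cut ε (m j) ≤ q j) ∧ (ε = 1 → ∀ i j, m i ≠ 0 → m j ≠ 0 → i = j)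

/-- No element which Maker can force makes a threat of the wrong kind. -/
def NoBadEdge (N : ι × ℕ → ι × ℕ → Prop) (ε : ℕ) (q m : ι → ℕ) : Prop :=
  ∀ j a v, m j ≠ 0 → q j = cut ε (m j) → a < q j → a % 2 ≠ ε → N (j, a) v → v.2 < q v.1 →
    v.2 % 2 = ε ∧ (ε = 1 → v.1 = j)

/-- The threats in `row` have the right parity, and none is available. -/
def Harmless (ε : ℕ) (q : ι → ℕ) (row : Set (ι × ℕ)) : Prop :=
  ∀ v ∈ row, v.2 < q v.1 → v.2 % 2 = ε ∧ v.2 + 1 ≠ q v.1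

open Classical in
/-- The description of the lowest threats, after those in `row` are added. -/
noncomputable def raise (ε : ℕ) (q : ι → ℕ) (row : Set (ι × ℕ)) (m : ι → ℕ) (j : ι) : ℕ :=
  max (m j) ((Finset.range (q j)).sup fun i => if (j, i) ∈ row then (i - ε) / 2 + 1 else 0)

/-- Breaker survives at `q` if Maker gets the additional threats in `row`. -/
def Safe (t : (ι → ℕ) → (ι → ℕ) → Prop) (ε : ℕ) (q m : ι → ℕ) (row : Set (ι × ℕ)) : Prop :=
  Harmless ε q row ∧ t q (raise ε q row m)

/-- Breaker, to move, survives at `q` if Maker gets the additional threats in `row`. -/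
def Answer (t : (ι → ℕ) → (ι → ℕ) → Prop) (ε : ℕ) (q m : ι → ℕ) (row : Set (ι × ℕ)) : Prop :=
  (∀ j, q j = 0) ∨ ∃ l, 0 < q l ∧ Safe t ε (dec q l) m row

/-- The recurrence for the positions `q` that Breaker survives when the lowest threats are described
by `m` and Maker is to move. -/
def Step (N : ι × ℕ → ι × ℕ → Prop) (t : (ι → ℕ) → (ι → ℕ) → Prop) (ε : ℕ) (q m : ι → ℕ) : Prop :=
  Valid ε q m ∧ NoBadEdge N ε q m ∧
    (∀ k, 0 < q k → cut ε (m k) < q k → Answer t ε (dec q k) m {v | N (k, q k - 1) v}) ∧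
    (ε = 1 → ∀ k, 0 < q k → q k = cut ε (m k) →
      Answer t ε (Function.update q k 0) (Function.update m k 0) ∅)

section raise

omit [Fintype ι] [DecidableEq ι]

variable {ε : ℕ} {q m : ι → ℕ} {row : Set (ι × ℕ)}

theorem le_raise (j : ι) : m j ≤ raise ε q row m j := le_max_left _ _

theorem need_le_raise {j : ι} {i : ℕ} (h : (j, i) ∈ row) (hi : i < q j) :
    (i - ε) / 2 + 1 ≤ raise ε q row m j := by
  classical
  refine le_trans ?_ (le_max_right _ _)
  refine le_trans (le_of_eq ?_)
    (Finset.le_sup (f := fun i => if (j, i) ∈ row then (i - ε) / 2 + 1 else 0)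
      (Finset.mem_range.2 hi))
  simp [h]

/-- The supremum is attained, so an entry that really changes comes from an actual remaining threat
of `row`. -/
theorem raise_cases (ε : ℕ) (q : ι → ℕ) (row : Set (ι × ℕ)) (m : ι → ℕ) (j : ι) :
    raise ε q row m j = m j ∨
      ∃ i, (j, i) ∈ row ∧ i < q j ∧ raise ε q row m j = (i - ε) / 2 + 1 := by
  classical
  rcases Nat.eq_zero_or_pos (q j) with h0 | hpos
  · left; simp [raise, h0]
  · obtain ⟨i, hi, he⟩ := Finset.exists_mem_eq_sup (Finset.range (q j))
      ⟨0, Finset.mem_range.2 hpos⟩ (fun i => if (j, i) ∈ row then (i - ε) / 2 + 1 else 0)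
    rw [Finset.mem_range] at hi
    unfold raise
    rw [he]
    by_cases hr : (j, i) ∈ row
    · rcases le_total ((i - ε) / 2 + 1) (m j) with h | h
      · left; simp [hr, h]
      · right; exact ⟨i, hr, hi, by simp [hr, h]⟩
    · left; simp [hr]

theorem raise_empty : raise ε q ∅ m = m := by
  funext j
  rcases raise_cases ε q ∅ m j with h | ⟨i, h, -⟩
  · exact h
  · exact h.elim

end raise

/-! ### Correctness of the recurrence. -/

section table

variable {t : (ι → ℕ) → (ι → ℕ) → Prop} {ε : ℕ} {L : ι → ℕ}

/-- A row that is not harmless contains a threat that is available or of the wrong parity, and both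
win. Otherwise the raised entries still describe elements of `S`, and the failure is that of a table
entry, which is left to `ih`. -/
theorem MW.of_not_safe (hε : ε < 2) {q m : ι → ℕ} {S row : Set (ι × ℕ)} (hrow : row ⊆ S)
    (hsum : (∑ j, q j) % 2 = ε) (hq : ∀ j, q j ≤ L j) (hm : ∀ j, m j ≤ L j / 2)
    (hthreat : ∀ j, m j ≠ 0 → (j, cut ε (m j) - 2) ∈ S ∧ cut ε (m j) - 2 < q j)
    (ih : ∀ m, (∀ j, m j ≤ L j / 2) →
      (∀ j, m j ≠ 0 → (j, cut ε (m j) - 2) ∈ S ∧ cut ε (m j) - 2 < q j) → ¬ t q m → MW N q S)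
    (hsafe : ¬ Safe t ε q m row) : MW N q S := by
  by_cases hh : Harmless ε q row
  · refine ih (raise ε q row m) ?_ ?_ fun ht => hsafe ⟨hh, ht⟩
    · intro j
      rcases raise_cases ε q row m j with h | ⟨i, hi, hiq, h⟩
      · rw [h]; exact hm j
      · have := hh _ hi hiq
        have := hq j
        simp only at *
        omega
    · intro j hj
      rcases raise_cases ε q row m j with h | ⟨i, hi, hiq, h⟩
      · rw [h] at hj ⊢; exact hthreat j hj
      · have := hh _ hi hiq
        -- The depth `i` has parity ε, so halving in the definition of `raise` loses nothing.
        have hc : cut ε (raise ε q row m j) - 2 = i := by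
          rw [h, cut_of_ne (by omega)]
          simp only at this
          omega
        rw [hc]
        exact ⟨hrow hi, hiq⟩
  · unfold Harmless at hh
    push Not at hh
    obtain ⟨⟨j, i⟩, hi, hiq, h⟩ := hh
    simp only at hiq h
    by_cases hpar : i % 2 = ε
    · exact .take' (h hpar).symm (hrow hi)
    · exact .of_wrong (hrow hi) hiq (by omega)

/-- Each clause of `Step` that fails yields a winning strategy. The induction is on the number of
remaining elements. The entries of `m` only have to point at remaining threats of `S`; further
threats do no harm to Maker. -/
theorem MW.of_not_table (hε : ε < 2) (hN : ∀ u v, N u v → N v u) (hirr : ∀ u, ¬ N u u)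
    (hT : ∀ q m, (∀ j, q j ≤ L j) → (∀ j, m j ≤ L j / 2) → (t q m ↔ Step N t ε q m))
    {q m : ι → ℕ} {S : Set (ι × ℕ)} (hsum : (∑ j, q j) % 2 = ε) (hq : ∀ j, q j ≤ L j)
    (hm : ∀ j, m j ≤ L j / 2)
    (hthreat : ∀ j, m j ≠ 0 → (j, cut ε (m j) - 2) ∈ S ∧ cut ε (m j) - 2 < q j)
    (ht : ¬ t q m) : MW N q S := by
  induction hs : ∑ j, q j using Nat.strong_induction_on generalizing q m S with
  | _ s ih =>
  rw [hT q m hq hm] at ht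
  by_cases h1 : ∀ j, cut ε (m j) ≤ q j
  swap
  -- The threat at depth `cut - 2` remains although fewer than `cut` elements do, so it is the next
  -- element.
  · push Not at h1
    obtain ⟨j, hj⟩ := h1
    have hmj : m j ≠ 0 := by rintro h; simp [h] at hj
    obtain ⟨hS, hlt⟩ := hthreat j hmj
    have := cut_of_ne (ε := ε) hmj
    exact .take' (by omega) hS
  by_cases h2 : ε = 1 → ∀ i j, m i ≠ 0 → m j ≠ 0 → i = j
  swap
  · push Not at h2
    obtain ⟨he, i, j, hi, hj, hij⟩ := h2
    have := cut_of_ne (ε := ε) hi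
    have := cut_of_ne (ε := ε) hj
    exact .of_two hij (hthreat i hi).1 (hthreat j hj).1 (hthreat i hi).2 (hthreat j hj).2 (by omega)
  by_cases h3 : NoBadEdge N ε q m
  swap
  · unfold NoBadEdge at h3
    push Not at h3
    obtain ⟨j, a, ⟨l, b⟩, hmj, hqj, ha, haε, hab, hb, hbad⟩ := h3
    have hc := cut_of_ne (ε := ε) hmj
    refine .of_bad_edge hε hN hirr hsum (hthreat j hmj).1 (by omega) (by omega) ha haε hb hab ?_
    by_cases hbε : b % 2 = ε
    · exact Or.inr (hbad hbε)
    · exact Or.inl hbε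
  by_cases h4 : ∀ k, 0 < q k → cut ε (m k) < q k →
      Answer t ε (dec q k) m {v | N (k, q k - 1) v}
  swap
  · push Not at h4
    obtain ⟨k, hk, hck, hans⟩ := h4
    unfold Answer at hans
    push Not at hans
    obtain ⟨⟨l₀, hl₀⟩, hans⟩ := hans
    refine .move k hk ⟨l₀, by omega⟩ fun l hl => ?_
    have e1 := sum_dec q hk
    have e2 := sum_dec (dec q k) hl
    have hle : ∀ j, dec (dec q k) l j ≤ L j := fun j =>
      (dec_le _ _ _).trans ((dec_le _ _ _).trans (hq j))
    refine MW.of_not_safe hε (L := L) (m := m) Set.subset_union_right (by omega) hle hm ?_ ?_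
      (hans l hl)
    · intro j hj
      refine ⟨Or.inl (hthreat j hj).1, ?_⟩
      have := cut_of_ne (ε := ε) hj
      have h := h1 j
      have ha := le_dec_add_one (dec q k) l j
      have hb := le_dec_add_one q k j
      by_cases hjk : j = k
      · subst hjk; omega
      · rw [dec_of_ne _ hjk] at ha hb; omega
    · intro m' hm' hthreat' ht'
      exact ih _ (by omega) (by omega) hle hm' hthreat' ht' rfl
  by_cases h5 : ε = 1 → ∀ k, 0 < q k → q k = cut ε (m k) →
      Answer t ε (Function.update q k 0) (Function.update m k 0) ∅
  swap
  · push Not at h5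
    obtain ⟨he, k, hk, hck, hans⟩ := h5
    unfold Answer at hans
    push Not at hans
    obtain ⟨⟨l₀, hl₀⟩, hans⟩ := hans
    have hlk₀ : l₀ ≠ k := by rintro rfl; simp at hl₀
    rw [Function.update_of_ne hlk₀] at hl₀
    have hmk : m k ≠ 0 := by rintro h; simp [h] at hck; omega
    have hc := cut_of_ne (ε := ε) hmk
    have hsumk : ∑ j, Function.update q k 0 j + q k = ∑ j, q j := by
      rw [Finset.sum_update_of_mem (Finset.mem_univ k),
        ← Finset.add_sum_erase Finset.univ q (Finset.mem_univ k), Finset.sdiff_singleton_eq_erase]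
      omega
    -- Every reply loses for Breaker once chain `k` is gone. By validity with ε = 1 no other chain
    -- has a recorded threat, so nothing is lost by erasing the entry of `k`.
    have hb : ∀ S', S ⊆ S' → ∀ l, 0 < Function.update q k 0 l →
        MW N (dec (Function.update q k 0) l) S' := by
      intro S' hS' l hl
      have e2 := sum_dec (Function.update q k 0) hl
      have hlk : l ≠ k := by rintro rfl; simp at hl
      have hle : ∀ j, dec (Function.update q k 0) l j ≤ L j := fun j =>
        (dec_le _ _ _).trans (by
          by_cases h : j = k
          · subst h; simp
          · rw [Function.update_of_ne h]; exact hq j)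
      refine @ih (∑ j, dec (Function.update q k 0) l j) (by omega) _ (Function.update m k 0) S'
        (by omega) hle ?_ ?_ ?_ rfl
      · intro j
        by_cases h : j = k
        · subst h; simp
        · rw [Function.update_of_ne h]; exact hm j
      · intro j hj
        by_cases h : j = k
        · subst h; simp at hj
        · rw [Function.update_of_ne h] at hj
          exact absurd (h2 he j k hj hmk) h
      · intro ht
        refine hans l hl ⟨fun v hv => hv.elim, ?_⟩
        rwa [raise_empty]
    -- Maker exposes her threat. If Breaker takes it, she takes one more element of the chain; then
    -- `q k - 3` elements are left there, an even number, with Breaker to move, so the chain may be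
    -- treated as empty. If Breaker moves elsewhere, she takes the threat.
    refine .move k hk ⟨l₀, by rw [dec_of_ne _ hlk₀]; omega⟩ fun l hl => ?_
    by_cases hlk : l = k
    · subst hlk
      simp only [dec_self] at hl
      have hdec : dec (dec (dec q l) l) l = Function.update (Function.update q l 0) l (q l - 3) := by
        simp [dec, Nat.sub_sub]
      refine .move l (by simp; omega) ⟨l₀, ?_⟩ ?_
      · rw [hdec]; simp [Function.update_of_ne hlk₀]; omega
      · rw [hdec]
        refine MW.reply_even (by simp) ⟨l₀, by rw [Function.update_of_ne hlk₀]; omega⟩ ?_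
          (by rw [Nat.even_iff]; omega)
        intro i hi r hr
        have hil : i ≠ l := by rintro rfl; simp at hi
        exact (hb _ (Set.subset_union_left.trans Set.subset_union_left) i hi).update_even
          (by rw [dec_of_ne _ (Ne.symm hil)]; simp) hr
    · refine .take' (j := k) (i := cut ε (m k) - 2) ?_ (Or.inl (hthreat k hmk).1)
      rw [dec_of_ne _ (Ne.symm hlk), dec_self]; omega
  exact absurd ⟨⟨h1, h2⟩, h3, h4, h5⟩ ht

-- Breaker follows a table position `q` from which the true position `Q` differs only in frozen
-- chains, where some pairs of elements are already played; hence the parity condition on `Q j`. A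
-- threat within `q` is either accounted for by `m`, or is a partner of an element of the other
-- parity in a frozen chain. The induction runs along Maker's strategy.
omit [Fintype ι] in
theorem MW.not_of_table (hε : ε < 2)
    (hT : ∀ q m, t q m → Step N t ε q m) (hN : ∀ u v, N u v → N v u)
    {Q : ι → ℕ} {S : Set (ι × ℕ)} (hMW : MW N Q S) {q m : ι → ℕ} (ht : t q m)
    (hQ : ∀ j, Q j = q j ∨ (m j ≠ 0 ∧ q j = cut ε (m j) ∧ Q j ≤ q j ∧ Q j % 2 = ε))
    (hS : ∀ v ∈ S, v.2 < q v.1 → (v.2 % 2 = ε ∧ v.2 < cut ε (m v.1)) ∨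
      ∃ j a, m j ≠ 0 ∧ q j = cut ε (m j) ∧ a < q j ∧ a % 2 ≠ ε ∧ N (j, a) v) : False := by
  induction hMW generalizing q m with
  | @take Q S j hj hjS =>
    obtain ⟨hV, hE, hR, hB⟩ := hT q m ht
    have hv := hV.1 j
    have hqj : Q j ≤ q j := by rcases hQ j with h | h <;> omega
    have hbeyond : m j ≠ 0 → q j = cut ε (m j) → (Q j - 1) % 2 = ε → False := by
      intro h1 h2 h3
      have := cut_of_ne (ε := ε) h1
      rcases hQ j with h | h <;> omega
    rcases hS _ hjS (show Q j - 1 < q j by omega) with ⟨h1, h2⟩ | ⟨i, a, h1, h2, h3, h4, h5⟩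
    · simp only at h1 h2
      have hmj : m j ≠ 0 := by rintro h; simp [h] at h2
      refine hbeyond hmj ?_ h1
      rcases hQ j with h | h <;> omega
    · by_cases hb : m j ≠ 0 ∧ q j = cut ε (m j)
      · exact hbeyond hb.1 hb.2 (hE i a _ h1 h2 h3 h4 h5 (show Q j - 1 < q j by omega)).1
      -- In a chain `j` that is not frozen, the pair is read backwards: if Maker claimed the next
      -- element of `j` in the table position, she would get the threat `(i, a)` of the wrong
      -- parity, which the answer required by `Step` excludes.
      · have hQj : Q j = q j := by
          rcases hQ j with h | h
          · exact h
          · exact absurd ⟨h.1, h.2.1⟩ hb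
        have hc : cut ε (m j) < q j := by
          by_cases hm0 : m j = 0
          · rw [hm0, cut_zero]; omega
          · exact lt_of_le_of_ne hv fun h => hb ⟨hm0, h.symm⟩
        have hij : i ≠ j := by rintro rfl; omega
        rcases hR j (by omega) hc with h0 | ⟨l, hl, hh, ht'⟩
        · have := h0 i
          rw [dec_of_ne _ hij] at this
          omega
        · have hV' := (hT _ _ ht').1.1 i
          have hcm := cut_mono ε (le_raise (ε := ε) (q := dec (dec q j) l)
            (row := {v | N (j, q j - 1) v}) (m := m) i)
          have h6 := hh (i, a) (by rw [← hQj]; exact hN _ _ h5) ?_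
          · exact h4 h6.1
          · simp only [dec_apply, hij, if_false] at hV' ⊢
            split_ifs at hV' ⊢ <;> omega
  | @move Q S k hk hne hnext ih =>
    obtain ⟨hV, hE, hR, hB⟩ := hT q m ht
    have hle : ∀ j, Q j ≤ q j := fun j => by rcases hQ j with h | h <;> omega
    obtain ⟨l₀, hl₀⟩ := hne
    by_cases hb : m k ≠ 0 ∧ q k = cut ε (m k)
    · have hc := cut_of_ne (ε := ε) hb.1
      have hpar : Q k % 2 = ε := by rcases hQ k with h | h <;> omega
      have hQk := hle k
      -- With two elements left Breaker replies in the same frozen chain, and the table position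
      -- does not change.
      by_cases h2 : 2 ≤ Q k
      · refine ih k (by simp; omega) ht ?_ ?_
        · intro j
          by_cases hjk : j = k
          · subst hjk; right
            refine ⟨hb.1, hb.2, ?_, ?_⟩ <;> simp <;> omega
          · simpa [dec_apply, hjk] using hQ j
        · rintro v (hv | hv) hvq
          · exact hS v hv hvq
          · right
            exact ⟨k, Q k - 1, hb.1, hb.2, by omega, by omega, hv⟩
      -- Maker takes the last element of a frozen chain, which is possible only for odd parity; the
      -- last clause of `Step` supplies the reply.
      · have hε1 : ε = 1 := by omega
        have huniq : ∀ j, j ≠ k → m j = 0 := by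
          intro j hj
          by_contra h
          exact hj (hV.2 hε1 j k h hb.1)
        rcases hB hε1 k (by omega) hb.2 with h0 | ⟨l, hl, hh, ht'⟩
        · have h1 := h0 l₀
          have h3 := hle l₀
          by_cases hlk : l₀ = k
          · subst hlk; simp at hl₀; omega
          · simp [hlk] at h1
            simp [dec_apply, hlk] at hl₀
            omega
        · rw [raise_empty] at ht'
          have hlk : l ≠ k := by rintro rfl; simp at hl
          rw [Function.update_of_ne hlk] at hl
          have hQq : ∀ j, j ≠ k → Q j = q j := by
            intro j hj
            rcases hQ j with h | h
            · exact h
            · exact absurd (huniq j hj) h.1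
          refine ih l (by rw [dec_of_ne _ hlk, hQq l hlk]; exact hl) ht' ?_ ?_
          · intro j
            left
            by_cases hjk : j = k
            · subst hjk
              simp [dec_apply, Ne.symm hlk]; omega
            · simp [dec_apply, hjk, hQq j hjk]
          · intro v hv hvq
            -- No threat is left outside chain `k`: no other chain has a recorded threat, and for ε
            -- = 1 the pairs through elements of the frozen chain stay inside it by `NoBadEdge`.
            exfalso
            have hvk : v.1 ≠ k := by
              intro h; rw [h] at hvq; simp [dec_apply, Ne.symm hlk] at hvq
            have hvq' : v.2 < q v.1 := by
              refine hvq.trans_le ((dec_le _ _ _).trans ?_)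
              rw [Function.update_of_ne hvk]
            rcases hv with hv | hv
            · rcases hS v hv hvq' with ⟨-, h⟩ | ⟨i, a, h3, h4, h5, h6, h7⟩
              · rw [huniq _ hvk] at h; simp at h
              · have hik : i = k := by
                  by_contra h; exact h3 (huniq i h)
                subst hik
                exact hvk ((hE i a v h3 h4 h5 h6 h7 hvq').2 hε1)
            · exact hvk ((hE k (Q k - 1) v hb.1 hb.2 (by omega) (by omega) hv hvq').2 hε1)
    · have hQk : Q k = q k := by
        rcases hQ k with h | h
        · exact h
        · exact absurd ⟨h.1, h.2.1⟩ hb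
      have hc : cut ε (m k) < q k := by
        by_cases hm0 : m k = 0
        · rw [hm0, cut_zero]; omega
        · exact lt_of_le_of_ne (hV.1 k) fun h => hb ⟨hm0, h.symm⟩
      rcases hR k (by omega) hc with h0 | ⟨l, hl, hh, ht'⟩
      · have h1 := h0 l₀
        have h3 := hle l₀
        simp only [dec_apply] at h1 hl₀
        split_ifs at h1 hl₀ <;> omega
      · obtain ⟨hV', -⟩ := (hT _ _ ht').1
        have hraise : ∀ j, cut ε (m j) ≤ cut ε (raise ε (dec (dec q k) l) {v | N (k, q k - 1) v} m j) :=
          fun j => cut_mono ε (le_raise j)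
        -- Cuts only grow under `raise`, so the validity of the new entry forbids both a reply in a
        -- frozen chain and a change of its recorded threat.
        have hfrozen : ∀ j, m j ≠ 0 → q j = cut ε (m j) →
            j ≠ l ∧ j ≠ k ∧ raise ε (dec (dec q k) l) {v | N (k, q k - 1) v} m j = m j := by
          intro j hj hqj
          have h1 := hV' j
          have h2 := hraise j
          have hjk : j ≠ k := by rintro rfl; exact hb ⟨hj, hqj⟩
          have hcj := cut_of_ne (ε := ε) hj
          have h3 := cut_of_ne (ε := ε) (m := raise ε (dec (dec q k) l) {v | N (k, q k - 1) v} m j)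
            (by have := le_raise (ε := ε) (q := dec (dec q k) l) (row := {v | N (k, q k - 1) v})
                  (m := m) j
                omega)
          simp only [dec_apply, hjk, if_false] at h1
          split_ifs at h1 with hjl
          · omega
          · exact ⟨hjl, hjk, by omega⟩
        have hQl : Q l = q l := by
          rcases hQ l with h | h
          · exact h
          · exact absurd rfl (hfrozen l h.1 h.2.1).1
        refine ih l ?_ ht' ?_ ?_
        · simp only [dec_apply] at hl ⊢
          split_ifs at hl ⊢ <;> omega
        · intro j
          rcases hQ j with h | ⟨h1, h2, h3, h4⟩
          · left
            simp only [dec_apply, h]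
          · obtain ⟨e1, e2, e3⟩ := hfrozen j h1 h2
            right
            rw [e3]
            simp only [dec_apply, e1, e2, if_false]
            exact ⟨h1, h2, h3, h4⟩
        · intro v hv hvq
          have hvq' : v.2 < q v.1 := hvq.trans_le ((dec_le _ _ _).trans (dec_le _ _ _))
          rcases hv with hv | hv
          · rcases hS v hv hvq' with ⟨h1, h2⟩ | ⟨i, a, h1, h2, h3, h4, h5⟩
            · exact Or.inl ⟨h1, h2.trans_le (hraise _)⟩
            · obtain ⟨e1, e2, e3⟩ := hfrozen i h1 h2
              right
              refine ⟨i, a, by rwa [e3], ?_, ?_, h4, h5⟩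
              · rw [e3]; simp only [dec_apply, e1, e2, if_false]; exact h2
              · simp only [dec_apply, e1, e2, if_false]; exact h3
          · left
            have hv' : v ∈ {v | N (k, q k - 1) v} := by rw [← hQk]; exact hv
            have h1 := hh v hv' hvq
            have h2 := need_le_raise (ε := ε) (q := dec (dec q k) l) (m := m)
              (show (v.1, v.2) ∈ {v | N (k, q k - 1) v} from hv') hvq
            refine ⟨h1.1, ?_⟩
            rw [cut_of_ne (by omega)]
            omega

/-- The recurrence decides the game. -/
theorem mw_iff_not_safe (hε : ε < 2) (hN : ∀ u v, N u v → N v u) (hirr : ∀ u, ¬ N u u)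
    (hT : ∀ q m, (∀ j, q j ≤ L j) → (∀ j, m j ≤ L j / 2) → (t q m ↔ Step N t ε q m))
    (hb : ∀ q m, t q m → (∀ j, q j ≤ L j) ∧ (∀ j, m j ≤ L j / 2))
    (hsum : (∑ j, L j) % 2 = ε) (S : Set (ι × ℕ)) :
    MW N L S ↔ ¬ Safe t ε L 0 S := by
  constructor
  · rintro hMW ⟨hh, ht⟩
    refine MW.not_of_table hε (fun q m h => (hT q m (hb q m h).1 (hb q m h).2).1 h) hN hMW ht
      (fun j => Or.inl rfl) fun v hv hvq => Or.inl ⟨(hh v hv hvq).1, ?_⟩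
    have h2 := need_le_raise (ε := ε) (q := L) (m := 0) (show (v.1, v.2) ∈ S from hv) hvq
    have h1 := hh v hv hvq
    rw [cut_of_ne (by omega)]
    omega
  · refine MW.of_not_safe hε (L := L) subset_rfl hsum (fun _ => le_rfl) (by simp) (by simp) ?_
    intro m hm hthreat ht
    exact MW.of_not_table hε hN hirr hT hsum (fun _ => le_rfl) hm hthreat ht

end table

end ChainGame

/-! ### Poset positional games on disjoint chains -/

namespace PosetGame

open ChainGame

/-- Coordinates on a union of chains: `φ x` consists of the chain of `x` and of the number of
elements above `x`. The chain `j` has `L j` elements. -/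
structure IsChainCoord {X ι : Type*} [PartialOrder X] (φ : X → ι × ℕ) (L : ι → ℕ) : Prop where
  inj : Function.Injective φ
  lt_iff : ∀ x y, x < y ↔ (φ x).1 = (φ y).1 ∧ (φ y).2 < (φ x).2
  range : ∀ j i, i < L j ↔ ∃ x, φ x = (j, i)

variable {X ι : Type*} [PartialOrder X] (G : PosetGame X) (φ : X → ι × ℕ)

/-- The winning sets with two elements, in coordinates. -/
def pairs (u v : ι × ℕ) : Prop :=
  ∃ x y, φ x = u ∧ φ y = v ∧ x ≠ y ∧ {x, y} ∈ G.winningSets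

/-- The winning sets with one element, in coordinates. -/
def singles : Set (ι × ℕ) :=
  {v | ∃ x, φ x = v ∧ {x} ∈ G.winningSets}

/-! ### From strategies on vertices to the game in coordinates. -/

variable {G φ}

theorem exists_available [Finite X] {A : Set X} (h : ∃ x, x ∉ A) : ∃ x, Available A x := by
  obtain ⟨x, hx⟩ := (Set.toFinite {x | x ∉ A}).exists_minimal h
  refine ⟨x, hx.1, fun y hy => ?_⟩
  by_contra hyA
  exact hy.not_ge (hx.2 hyA hy.le)

omit [PartialOrder X] in
@[simp] theorem claim_self (pos : Player → Set X) (q : Player) (x : X) :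
    claim pos q x q = insert x (pos q) := by simp [claim]

omit [PartialOrder X] in
@[simp] theorem claim_maker_breaker (pos : Player → Set X) (x : X) :
    claim pos .maker x .breaker = pos .breaker := by simp [claim]

omit [PartialOrder X] in
@[simp] theorem claim_breaker_maker (pos : Player → Set X) (x : X) :
    claim pos .breaker x .maker = pos .maker := by simp [claim]

omit [PartialOrder X] in
theorem claimed_claim (pos : Player → Set X) (q : Player) (x : X) :
    claim pos q x .maker ∪ claim pos q x .breaker = insert x (pos .maker ∪ pos .breaker) := by
  cases q <;> simp [Set.insert_union, Set.union_insert]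

theorem Filled.mono {M M' : Set X} (h : G.Filled M) (hM : M ⊆ M') : G.Filled M' := by
  obtain ⟨S, hS, hSM⟩ := h
  exact ⟨S, hS, hSM.trans hM⟩

/-- A filled set stays filled, so any completion of the play will do; a minimal unclaimed vertex
keeps the play going. -/
theorem winsFrom_of_filled [Finite X] (q : Player) (pos : Player → Set X)
    (h : G.Filled (pos .maker)) : G.WinsFrom .maker q pos := by
  induction hs : (pos .maker ∪ pos .breaker)ᶜ.ncard using Nat.strong_induction_on
    generalizing q pos with
  | _ s ih =>
  by_cases hall : ∀ x, x ∈ pos .maker ∪ pos .breaker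
  · exact .finished q pos hall (by simp [h])
  push Not at hall
  have hnext : ∀ x, Available (pos .maker ∪ pos .breaker) x → ∀ r r',
      G.WinsFrom .maker r (claim pos r' x) := by
    intro x hx r r'
    refine ih _ ?_ r (claim pos r' x) (h.mono ?_) rfl
    · rw [← hs, claimed_claim]
      refine Set.ncard_lt_ncard ?_ (Set.toFinite _)
      refine ⟨Set.compl_subset_compl.2 (Set.subset_insert _ _), fun hsub => ?_⟩
      exact hsub hx.1 (Set.mem_insert _ _)
    · cases r' <;> simp
  cases q with
  | maker =>
    obtain ⟨x, hx⟩ := exists_available hall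
    exact .own pos x hx (hnext x hx _ _)
  | breaker => exact .opponent pos hall fun x hx => hnext x hx _ _

section

variable {L : ι → ℕ} [DecidableEq ι] [Fintype ι]

/-- The claimed vertices are those at depth at least `q j` in the chain `j`. -/
def Claimed (φ : X → ι × ℕ) (q : ι → ℕ) (A : Set X) : Prop :=
  ∀ x, x ∈ A ↔ q (φ x).1 ≤ (φ x).2

omit [DecidableEq ι] [Fintype ι] in
theorem available_iff (hφ : IsChainCoord φ L) {q : ι → ℕ} {A : Set X} (hq : ∀ j, q j ≤ L j)
    (hA : Claimed φ q A) (x : X) : Available A x ↔ (φ x).2 + 1 = q (φ x).1 := by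
  unfold Available
  rw [hA x]
  constructor
  · rintro ⟨h1, h2⟩
    by_contra hne
    obtain ⟨y, hy⟩ := (hφ.range (φ x).1 ((φ x).2 + 1)).1 (by have := hq (φ x).1; omega)
    have h3 := h2 y ((hφ.lt_iff _ _).2 ⟨by rw [hy], by rw [hy]; simp⟩)
    rw [hA y, hy] at h3
    simp only at h3
    omega
  · intro h
    refine ⟨by omega, fun y hy => ?_⟩
    rw [hA y]
    obtain ⟨h1, h2⟩ := (hφ.lt_iff _ _).1 hy
    rw [h1]; omega

omit [Fintype ι] in
theorem Claimed.insert (hφ : IsChainCoord φ L) {q : ι → ℕ} {A : Set X} (hA : Claimed φ q A) {x : X}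
    (hx : (φ x).2 + 1 = q (φ x).1) : Claimed φ (dec q (φ x).1) (insert x A) := by
  intro y
  rw [Set.mem_insert_iff, hA y]
  by_cases h : (φ y).1 = (φ x).1
  · rw [h, dec_self]
    constructor
    · rintro (rfl | h') <;> omega
    · intro h'
      by_cases h2 : (φ y).2 = (φ x).2
      · left; exact hφ.inj (Prod.ext h h2)
      · right; omega
  · rw [dec_of_ne _ h]
    constructor
    · rintro (rfl | h')
      · exact absurd rfl h
      · exact h'
    · exact Or.inr

omit [Fintype ι] [DecidableEq ι] in
theorem exists_next (hφ : IsChainCoord φ L) {q : ι → ℕ} (hq : ∀ j, q j ≤ L j) {j : ι}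
    (hj : 0 < q j) : ∃ x, φ x = (j, q j - 1) :=
  (hφ.range j (q j - 1)).1 (by have := hq j; omega)

-- For Maker it is enough that each remaining element of `S` really completes a winning set. A move
-- adds the partners of the claimed vertex, for which this is clear.
omit [Fintype ι] in
theorem winsFrom_maker_of_mw [Finite X] (hφ : IsChainCoord φ L) {q : ι → ℕ} {S : Set (ι × ℕ)}
    (h : MW (G.pairs φ) q S) (hq : ∀ j, q j ≤ L j) (pos : Player → Set X)
    (hpos : Claimed φ q (pos .maker ∪ pos .breaker))
    (hS : ∀ y, φ y ∈ S → (φ y).2 < q (φ y).1 → G.Filled (insert y (pos .maker))) :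
    G.WinsFrom .maker .maker pos := by
  induction h generalizing pos with
  | @take q S j hj hjS =>
    obtain ⟨x, hx⟩ := exists_next hφ hq hj
    have hx1 : (φ x).2 + 1 = q (φ x).1 := by rw [hx]; simp only; omega
    refine .own pos x ((available_iff hφ hq hpos x).2 hx1) (winsFrom_of_filled _ _ ?_)
    rw [claim_self]
    exact hS x (by rwa [hx]) (by omega)
  | @move q S k hk hne hnext ih =>
    obtain ⟨x, hx⟩ := exists_next hφ hq hk
    have hxk : (φ x).1 = k := by rw [hx]
    have hx1 : (φ x).2 + 1 = q (φ x).1 := by rw [hx]; simp only; omega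
    have hq' : ∀ j, dec q k j ≤ L j := fun j => (dec_le _ _ _).trans (hq j)
    have hpos' : Claimed φ (dec q k) (claim pos .maker x .maker ∪ claim pos .maker x .breaker) := by
      rw [claimed_claim, ← hxk]
      exact hpos.insert hφ hx1
    refine .own pos x ((available_iff hφ hq hpos x).2 hx1) (.opponent _ ?_ fun y hy => ?_)
    · obtain ⟨l, hl⟩ := hne
      obtain ⟨y, hy⟩ := exists_next hφ hq' hl
      refine ⟨y, fun h => ?_⟩
      rw [hpos' y, hy] at h
      simp only at h
      omega
    · have hy1 := (available_iff hφ hq' hpos' y).1 hy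
      refine ih (φ y).1 (by omega) (fun j => (dec_le _ _ _).trans (hq' j)) _ ?_ ?_
      · rw [claimed_claim]
        exact hpos'.insert hφ hy1
      · intro z hz hzq
        have hzq' : (φ z).2 < q (φ z).1 := hzq.trans_le ((dec_le _ _ _).trans (dec_le _ _ _))
        change G.Filled (insert z (claim (claim pos .maker x) .breaker y .maker))
        rw [claim_breaker_maker, claim_self]
        rcases hz with hz | hz
        · exact (hS z hz hzq').mono (Set.insert_subset_insert (Set.subset_insert _ _))
        · obtain ⟨x', z', hx', hz', -, hF⟩ := hz
          have e1 := hφ.inj (hx'.trans hx.symm)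
          have e2 := hφ.inj hz'
          subst e1 e2
          exact ⟨_, hF, by rintro a (rfl | rfl) <;> simp⟩

/-- Breaker needs the opposite inclusion: every remaining vertex that would complete a winning set
belongs to `S`. The set also stays unfilled when Maker moves, since her vertex is not in `S`. -/
theorem winsFrom_breaker_of_not_mw [Finite X] (hφ : IsChainCoord φ L)
    (hcard : ∀ S ∈ G.winningSets, S.encard ≤ 2) {q : ι → ℕ} {S : Set (ι × ℕ)}
    (h : ¬ MW (G.pairs φ) q S) (hq : ∀ j, q j ≤ L j) (pos : Player → Set X)
    (hpos : Claimed φ q (pos .maker ∪ pos .breaker)) (hfill : ¬ G.Filled (pos .maker))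
    (hS : ∀ y, (φ y).2 < q (φ y).1 → G.Filled (insert y (pos .maker)) → φ y ∈ S) :
    G.WinsFrom .breaker .maker pos := by
  induction hs : ∑ j, q j using Nat.strong_induction_on generalizing q S pos with
  | _ s ih =>
  by_cases hall : ∀ x, x ∈ pos .maker ∪ pos .breaker
  · exact .finished _ pos hall (by simp [hfill])
  push Not at hall
  refine .opponent pos hall fun x hx => ?_
  have hx1 := (available_iff hφ hq hpos x).1 hx
  set k := (φ x).1 with hk
  have hx2 : φ x = (k, q k - 1) := Prod.ext rfl (by simp only; omega)
  have hq' : ∀ j, dec q k j ≤ L j := fun j => (dec_le _ _ _).trans (hq j)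
  change G.WinsFrom .breaker .breaker (claim pos .maker x)
  have hpos' : Claimed φ (dec q k) (claim pos .maker x .maker ∪ claim pos .maker x .breaker) := by
    rw [claimed_claim]
    exact hpos.insert hφ hx1
  have hxS : φ x ∉ S := fun hxS => h (.take k (by omega) (by rwa [hx2] at hxS))
  have hfill' : ¬ G.Filled (claim pos .maker x .maker) := by
    rw [claim_self]
    exact fun hf => hxS (hS x (by rw [← hk]; omega) hf)
  by_cases hne : ∃ l, 0 < dec q k l
  · have hl : ∃ l, 0 < dec q k l ∧
        ¬ MW (G.pairs φ) (dec (dec q k) l) (S ∪ {v | G.pairs φ (k, q k - 1) v}) := by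
      by_contra! hcon
      exact h (.move k (by omega) hne hcon)
    obtain ⟨l, hl, hl'⟩ := hl
    obtain ⟨y, hy⟩ := exists_next hφ hq' hl
    have hyl : (φ y).1 = l := by rw [hy]
    have hy1 : (φ y).2 + 1 = dec q k (φ y).1 := by rw [hy]; simp only; omega
    have e1 := sum_dec q (j := k) (by omega)
    have e2 := sum_dec (dec q k) hl
    refine .own _ y ((available_iff hφ hq' hpos' y).2 hy1) ?_
    refine ih _ (by omega) hl' (fun j => (dec_le _ _ _).trans (hq' j)) _ ?_ ?_ ?_ rfl
    · rw [claimed_claim, ← hyl]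
      exact hpos'.insert hφ hy1
    · rwa [claim_breaker_maker]
    · intro z hz hf
      rw [claim_breaker_maker, claim_self] at hf
      have hz' : (φ z).2 < q (φ z).1 := hz.trans_le ((dec_le _ _ _).trans (dec_le _ _ _))
      have hzx : z ≠ x := by
        rintro rfl
        have := hz.trans_le (dec_le _ _ _)
        rw [← hk, dec_self] at this
        omega
      obtain ⟨T, hT, hTM⟩ := hf
      by_cases hzT : z ∈ T
      · by_cases hxT : x ∈ T
        · right
          refine ⟨x, z, hx2, rfl, hzx.symm, ?_⟩
          -- Here the bound on the size enters: a set that needs both the latest claim and `z` is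
          -- just this pair, hence recorded in `pairs`.
          have : ({x, z} : Set X) = T := by
            refine Set.Finite.eq_of_subset_of_encard_le (Set.toFinite _) ?_ ?_
            · rintro a (rfl | rfl) <;> assumption
            · rw [Set.encard_pair hzx.symm]; exact hcard T hT
          rwa [this]
        · left
          refine hS z hz' ⟨T, hT, fun a ha => ?_⟩
          rcases hTM ha with rfl | rfl | h
          · simp
          · exact absurd ha hxT
          · exact Set.mem_insert_of_mem _ h
      · refine absurd ⟨T, hT, fun a ha => ?_⟩ hfill'
        rw [claim_self]
        rcases hTM ha with rfl | h
        · exact absurd ha hzT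
        · exact h
  · refine .finished _ _ (fun y => ?_) (by simpa using hfill')
    rw [hpos' y]
    push Not at hne
    have := hne (φ y).1
    omega

/-- The game on a union of chains is decided by the game in coordinates. -/
theorem hasWinningStrategy_iff_mw [Finite X] (hφ : IsChainCoord φ L)
    (hcard : ∀ S ∈ G.winningSets, S.encard ≤ 2) :
    ((∅ ∈ G.winningSets ∨ MW (G.pairs φ) L (G.singles φ)) → G.HasWinningStrategy .maker) ∧
    (¬ (∅ ∈ G.winningSets ∨ MW (G.pairs φ) L (G.singles φ)) → G.HasWinningStrategy .breaker) := by
  have hpos : Claimed φ L ((∅ : Set X) ∪ ∅) := by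
    intro x
    have := (hφ.range (φ x).1 (φ x).2).2 ⟨x, rfl⟩
    simp; exact this
  constructor
  · rintro (h | h)
    · exact winsFrom_of_filled _ _ ⟨∅, h, subset_rfl⟩
    · refine winsFrom_maker_of_mw hφ h (fun _ => le_rfl) _ hpos ?_
      rintro y ⟨x, hx, hF⟩ -
      cases hφ.inj hx
      exact ⟨_, hF, by simp⟩
  · intro h
    push Not at h
    refine winsFrom_breaker_of_not_mw hφ hcard h.2 (fun _ => le_rfl) _ hpos ?_ ?_
    · rintro ⟨S, hS, hS'⟩
      rw [Set.subset_empty_iff.1 hS'] at hS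
      exact h.1 hS
    · rintro y - ⟨S, hS, hS'⟩
      refine ⟨y, rfl, ?_⟩
      have hS'' : S ⊆ {y} := by simpa using hS'
      rcases Set.subset_singleton_iff_eq.1 hS'' with rfl | rfl
      · exact absurd hS h.1
      · exact hS

end

end PosetGame

/-! ### Expressions for the word RAM -/

namespace RAM

/-- Code for the evaluation of an expression: `e d` is a program that leaves the value in the
register `d`, and changes neither the memory nor the registers before `d`. -/
abbrev Code := ℕ → Program

/-- A description of the registers with numbers less than `depth`. -/
structure World where
  reg : ℕ → ℕ
  depth : ℕ

instance : Preorder World where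
  le w w' := w.depth ≤ w'.depth ∧ ∀ r < w.depth, w'.reg r = w.reg r
  le_refl w := ⟨le_rfl, fun _ _ => rfl⟩
  le_trans _ _ _ h h' :=
    ⟨h.1.trans h'.1, fun r hr => (h'.2 r (hr.trans_le h.1)).trans (h.2 r hr)⟩

/-- The registers of the state `s` are as described by `w`. -/
def Agrees (w : World) (s : State) : Prop := ∀ r < w.depth, s.reg r = w.reg r

/-- The register `r` holds the value `x`. -/
def Var (B : ℕ) (w : World) (r x : ℕ) : Prop := r < w.depth ∧ w.reg r = x ∧ x ≤ B

theorem Var.ext {B : ℕ} {w w' : World} {r x : ℕ} (h : Var B w r x) (hw : w ≤ w') : Var B w' r x :=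
  ⟨h.1.trans_le hw.1, (hw.2 r h.1).trans h.2.1, h.2.2⟩

/-- `Ev B μ w e v c`: when the memory is `μ` and the registers are as in `w`, the expression `e` has
the value `v`, and is evaluated in at most `c` steps on numbers that are at most `B`. -/
def Ev (B : ℕ) (μ : ℕ → ℕ) (w : World) (e : Code) (v c : ℕ) : Prop :=
  v ≤ B ∧ ∀ s : State, s.mem = μ → ∀ d, w.depth ≤ d → Agrees w s →
    ∃ t ≤ c, ∃ s', Runs B (e d) s t s' ∧ s'.mem = μ ∧ (∀ r < d, s'.reg r = s.reg r) ∧ s'.reg d = v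

/-- The world in which some registers from `d` on are pushed. -/
def World.push (s : State) (d : ℕ) : World := ⟨s.reg, d⟩

theorem le_push {w : World} {s : State} {d d' : ℕ} (hd : w.depth ≤ d) (hw : Agrees w s)
    {s' : State} (hs' : ∀ r < d, s'.reg r = s.reg r) (hdd : d ≤ d') : w ≤ World.push s' d' :=
  ⟨hd.trans hdd, fun r hr => (hs' r (hr.trans_le hd)).trans (hw r hr)⟩

theorem agrees_push (s : State) (d : ℕ) : Agrees (World.push s d) s := fun _ _ => rfl

namespace Ev

variable {B : ℕ} {μ : ℕ → ℕ} {w w' : World} {e f : Code} {v v' c c' : ℕ}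

theorem conv (h : Ev B μ w e v c) (hv : v = v') (hc : c ≤ c') : Ev B μ w e v' c' := by
  subst hv
  refine ⟨h.1, fun s hs d hd ha => ?_⟩
  obtain ⟨t, ht, s', h'⟩ := h.2 s hs d hd ha
  exact ⟨t, ht.trans hc, s', h'⟩

theorem le (h : Ev B μ w e v c) (hc : c ≤ c') : Ev B μ w e v c' := h.conv rfl hc

end Ev

/-- The constant `k`. -/
def litE (k : ℕ) : Code := fun d => .const d k

/-- The value of the register `r`. -/
def varE (r : ℕ) : Code := fun d => .seq (.const d 0) (.arith .add d r d)

/-- An arithmetic operation. -/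
def opE (o : Op) (a b : Code) : Code := fun d =>
  .seq (a d) (.seq (b (d + 1)) (.arith o d d (d + 1)))

/-- The value of a memory cell. -/
def loadE (a : Code) : Code := fun d => .seq (a d) (.load d d)

/-- A case distinction. -/
def iteE (a p q : Code) : Code := fun d => .seq (a d) (.ite d (p d) (q d))

/-- The test `a = b`. -/
def eqE (a b : Code) : Code := fun d =>
  .seq (a d) (.seq (b (d + 1)) (.seq (.arith .sub (d + 2) d (d + 1))
    (.seq (.arith .sub (d + 1) (d + 1) d) (.seq (.arith .add d (d + 1) (d + 2))
      (.ite d (.const d 0) (.const d 1))))))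

/-- The test `a < b`. -/
def ltE (a b : Code) : Code := fun d =>
  .seq (a d) (.seq (b (d + 1)) (.seq (.arith .sub d (d + 1) d) (.ite d (.const d 1) (.const d 0))))

/-- The expression `f r`, where the register `r` holds the value of `e`. -/
def letE (e : Code) (f : ℕ → Code) : Code := fun d =>
  .seq (e d) (.seq (f d (d + 1)) (.seq (.const d 0) (.arith .add d (d + 1) d)))

/-- A loop with an accumulator, which is initially `init`, and is replaced by the value of
`body acc i` for `i = 0, …, N - 1`; the arguments of `body` are registers. -/
def foldE (N init : Code) (body : ℕ → ℕ → Code) : Code := fun d =>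
  .seq (init d) (.seq (.const (d + 1) 0) (.seq (N (d + 2)) (.seq (.arith .sub (d + 3) (d + 2) (d + 1))
    (.loop (d + 3) (.seq (body d (d + 1) (d + 3)) (.seq (.const d 0) (.seq (.arith .add d (d + 3) d)
      (.seq (.const (d + 3) 1) (.seq (.arith .add (d + 1) (d + 1) (d + 3))
        (.arith .sub (d + 3) (d + 2) (d + 1)))))))))))

/-- Indicator of a proposition. -/
noncomputable def ind (P : Prop) : ℕ := by
  classical
  exact if P then 1 else 0

theorem ind_true {P : Prop} (h : P) : ind P = 1 := by simp [ind, h]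

theorem ind_false {P : Prop} (h : ¬ P) : ind P = 0 := by simp [ind, h]

theorem ind_le_one (P : Prop) : ind P ≤ 1 := by
  unfold ind; split_ifs <;> omega

theorem ind_ne_zero {P : Prop} : ind P ≠ 0 ↔ P := by
  by_cases h : P <;> simp [ind, h]

theorem ind_congr {P Q : Prop} (h : P ↔ Q) : ind P = ind Q := by rw [propext h]

namespace Ev

variable {B : ℕ} {μ : ℕ → ℕ} {w w' : World} {e f a b p q : Code} {v v' c c' x y ca cb : ℕ}

theorem lit {k : ℕ} (hk : k ≤ B) : Ev B μ w (litE k) k 1 :=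
  ⟨hk, fun s hs d _ _ => ⟨1, le_rfl, _, .const s d k hk, hs,
    fun r hr => by simp [Function.update_of_ne hr.ne], by simp⟩⟩

theorem var {r : ℕ} (h : Var B w r x) : Ev B μ w (varE r) x 2 := by
  refine ⟨h.2.2, fun s hs d hd ha => ⟨2, le_rfl, _, .seq (.const s d 0 (Nat.zero_le _))
    (.arith _ .add d r d ?_), hs, fun r hr => ?_, ?_⟩⟩
  · have hne : r ≠ d := (h.1.trans_le hd).ne
    simp [Op.eval, Function.update_of_ne hne, ha r h.1, h.2.1, h.2.2]
  · simp [Function.update_of_ne hr.ne]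
  · have hne : r ≠ d := (h.1.trans_le hd).ne
    simp [Op.eval, Function.update_of_ne hne, ha r h.1, h.2.1]

theorem two (ha : Ev B μ w a x ca) (hb : Ev B μ w b y cb) {s : State} (hs : s.mem = μ) {d : ℕ}
    (hd : w.depth ≤ d) (hw : Agrees w s) : ∃ t ≤ ca + cb, ∃ t₁ t₂ s₁ s₂, t = t₁ + t₂ ∧
      Runs B (a d) s t₁ s₁ ∧ Runs B (b (d + 1)) s₁ t₂ s₂ ∧ s₂.mem = μ ∧
      (∀ r < d, s₂.reg r = s.reg r) ∧ s₂.reg d = x ∧ s₂.reg (d + 1) = y := by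
  obtain ⟨t₁, ht₁, s₁, hr₁, hm₁, hreg₁, hx⟩ := ha.2 s hs d hd hw
  obtain ⟨t₂, ht₂, s₂, hr₂, hm₂, hreg₂, hy⟩ := hb.2 s₁ hm₁ (d + 1) (by omega)
    (fun r hr => (hreg₁ r (by omega)).trans (hw r hr))
  exact ⟨t₁ + t₂, by omega, t₁, t₂, s₁, s₂, rfl, hr₁, hr₂, hm₂,
    fun r hr => (hreg₂ r (by omega)).trans (hreg₁ r hr), (hreg₂ d (by omega)).trans hx, hy⟩

theorem op {o : Op} (ha : Ev B μ w a x ca) (hb : Ev B μ w b y cb) (hB : o.eval x y ≤ B) :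
    Ev B μ w (opE o a b) (o.eval x y) (ca + cb + 1) := by
  refine ⟨hB, fun s hs d hd hw => ?_⟩
  obtain ⟨t, ht, t₁, t₂, s₁, s₂, rfl, h₁, h₂, hm, hreg, hx, hy⟩ := two ha hb hs hd hw
  refine ⟨t₁ + (t₂ + 1), by omega, _, .seq h₁ (.seq h₂ (.arith _ o d d (d + 1) ?_)), hm,
    fun r hr => ?_, ?_⟩
  · rwa [hx, hy]
  · simp only [Function.update_of_ne hr.ne]; exact hreg r hr
  · simp [hx, hy]

theorem load (ha : Ev B μ w a x ca) (hB : μ x ≤ B) : Ev B μ w (loadE a) (μ x) (ca + 1) := by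
  refine ⟨hB, fun s hs d hd hw => ?_⟩
  obtain ⟨t₁, ht₁, s₁, hr₁, hm₁, hreg₁, hx⟩ := ha.2 s hs d hd hw
  refine ⟨t₁ + 1, by omega, _, .seq hr₁ (.load _ d d ?_), hm₁, fun r hr => ?_, ?_⟩
  · rwa [hx, hm₁]
  · simp only [Function.update_of_ne hr.ne]; exact hreg₁ r hr
  · simp [hx, hm₁]

theorem ite_pos (ha : Ev B μ w a x ca) (hx : x ≠ 0) (hp : Ev B μ w p v c) :
    Ev B μ w (iteE a p q) v (ca + c + 1) := by
  refine ⟨hp.1, fun s hs d hd hw => ?_⟩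
  obtain ⟨t₁, ht₁, s₁, hr₁, hm₁, hreg₁, hx₁⟩ := ha.2 s hs d hd hw
  obtain ⟨t₂, ht₂, s₂, hr₂, hm₂, hreg₂, hx₂⟩ := hp.2 s₁ hm₁ d hd
    (fun r hr => (hreg₁ r (by omega)).trans (hw r hr))
  exact ⟨t₁ + (1 + t₂), by omega, s₂, .seq hr₁ (.ite_true (by rwa [hx₁]) hr₂), hm₂,
    fun r hr => (hreg₂ r hr).trans (hreg₁ r hr), hx₂⟩

theorem ite_neg (ha : Ev B μ w a x ca) (hx : x = 0) (hp : Ev B μ w q v c) :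
    Ev B μ w (iteE a p q) v (ca + c + 1) := by
  refine ⟨hp.1, fun s hs d hd hw => ?_⟩
  obtain ⟨t₁, ht₁, s₁, hr₁, hm₁, hreg₁, hx₁⟩ := ha.2 s hs d hd hw
  obtain ⟨t₂, ht₂, s₂, hr₂, hm₂, hreg₂, hx₂⟩ := hp.2 s₁ hm₁ d hd
    (fun r hr => (hreg₁ r (by omega)).trans (hw r hr))
  exact ⟨t₁ + (1 + t₂), by omega, s₂, .seq hr₁ (.ite_false (by rwa [hx₁]) hr₂), hm₂,
    fun r hr => (hreg₂ r hr).trans (hreg₁ r hr), hx₂⟩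

theorem eq (h1 : 1 ≤ B) (ha : Ev B μ w a x ca) (hb : Ev B μ w b y cb) :
    Ev B μ w (eqE a b) (ind (x = y)) (ca + cb + 5) := by
  refine ⟨(ind_le_one _).trans h1, fun s hs d hd hw => ?_⟩
  obtain ⟨t, ht, t₁, t₂, s₁, s₂, rfl, h₁, h₂, hm, hreg, hx, hy⟩ := two ha hb hs hd hw
  have hxB := ha.1
  have hyB := hb.1
  refine ⟨t₁ + (t₂ + (1 + (1 + (1 + (1 + 1))))), by omega,
    { reg := Function.update (Function.update (Function.update (Function.update s₂.reg (d + 2) (x - y))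
        (d + 1) (y - x)) d (y - x + (x - y))) d (ind (x = y)), mem := s₂.mem },
    .seq h₁ (.seq h₂ (.seq (s₁ := { reg := Function.update s₂.reg (d + 2) (x - y), mem := s₂.mem })
    ?_ (.seq (s₁ := { reg := Function.update (Function.update s₂.reg (d + 2) (x - y)) (d + 1) (y - x), mem := s₂.mem })
    ?_ (.seq (s₁ := { reg := Function.update (Function.update (Function.update s₂.reg (d + 2) (x - y)) (d + 1) (y - x)) d (y - x + (x - y)), mem := s₂.mem })
    ?_ ?_)))), hm, fun r hr => ?_, ?_⟩
  · have := Runs.arith (B := B) s₂ .sub (d + 2) d (d + 1) (by simp [Op.eval, hx, hy]; omega)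
    simpa [Op.eval, hx, hy] using this
  · have := Runs.arith (B := B) { reg := Function.update s₂.reg (d + 2) (x - y), mem := s₂.mem }
      .sub (d + 1) (d + 1) d (by simp [Op.eval, hx, hy]; omega)
    simpa [Op.eval, hx, hy] using this
  · have := Runs.arith (B := B) { reg := Function.update (Function.update s₂.reg (d + 2) (x - y)) (d + 1) (y - x), mem := s₂.mem }
      .add d (d + 1) (d + 2) (by simp [Op.eval]; omega)
    simpa [Op.eval] using this
  · by_cases hxy : x = y
    · refine .ite_false (by simp [hxy]) ?_
      rw [ind_true hxy]
      exact .const _ _ _ h1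
    · refine .ite_true (by simp; omega) ?_
      rw [ind_false hxy]
      exact .const _ _ _ (Nat.zero_le _)
  · have e1 : r ≠ d := hr.ne
    have e2 : r ≠ d + 1 := by omega
    have e3 : r ≠ d + 2 := by omega
    simp [e1, e2, e3]
    exact hreg r hr
  · simp

theorem lt (h1 : 1 ≤ B) (ha : Ev B μ w a x ca) (hb : Ev B μ w b y cb) :
    Ev B μ w (ltE a b) (ind (x < y)) (ca + cb + 3) := by
  refine ⟨(ind_le_one _).trans h1, fun s hs d hd hw => ?_⟩
  obtain ⟨t, ht, t₁, t₂, s₁, s₂, rfl, h₁, h₂, hm, hreg, hx, hy⟩ := two ha hb hs hd hw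
  have hyB := hb.1
  refine ⟨t₁ + (t₂ + (1 + (1 + 1))), by omega,
    { reg := Function.update (Function.update s₂.reg d (y - x)) d (ind (x < y)), mem := s₂.mem },
    .seq h₁ (.seq h₂ (.seq (s₁ := { reg := Function.update s₂.reg d (y - x), mem := s₂.mem }) ?_ ?_)),
    hm, fun r hr => ?_, ?_⟩
  · have := Runs.arith (B := B) s₂ .sub d (d + 1) d (by simp [Op.eval, hx, hy]; omega)
    simpa [Op.eval, hx, hy] using this
  · by_cases hxy : x < y
    · refine .ite_true (by simp; omega) ?_
      rw [ind_true hxy]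
      exact .const _ _ _ h1
    · refine .ite_false (by simp; omega) ?_
      rw [ind_false hxy]
      exact .const _ _ _ (Nat.zero_le _)
  · simp [hr.ne]
    exact hreg r hr
  · simp

theorem letE {g : ℕ → Code} (ha : Ev B μ w a x ca)
    (hg : ∀ w' ≥ w, ∀ r, Var B w' r x → Ev B μ w' (g r) v c) :
    Ev B μ w (letE a g) v (ca + c + 2) := by
  -- The bound on the value must not depend on a machine state, so it is read off in a fictitious
  -- extension of `w` by one register that holds `x`.
  have hv : v ≤ B := (hg ⟨fun r => if r < w.depth then w.reg r else x, w.depth + 1⟩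
    ⟨Nat.le_succ _, fun r hr => by simp [hr]⟩ w.depth ⟨by simp, by simp, ha.1⟩).1
  refine ⟨hv, fun s hs d hd hw => ?_⟩
  obtain ⟨t₁, ht₁, s₁, hr₁, hm₁, hreg₁, hx₁⟩ := ha.2 s hs d hd hw
  obtain ⟨t₂, ht₂, s₂, hr₂, hm₂, hreg₂, hx₂⟩ := (hg (World.push s₁ (d + 1))
    (le_push hd hw hreg₁ (by omega)) d ⟨by simp [World.push], hx₁, ha.1⟩).2 s₁ hm₁ (d + 1) le_rfl
    (agrees_push _ _)
  refine ⟨t₁ + (t₂ + (1 + 1)), by omega, _, .seq hr₁ (.seq hr₂ (.seq (.const _ d 0 (Nat.zero_le _))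
    (.arith _ .add d (d + 1) d ?_))), hm₂, fun r hr => ?_, ?_⟩
  · simpa [Op.eval, hx₂] using hv
  · simp only [Function.update_of_ne hr.ne]
    exact (hreg₂ r (by omega)).trans (hreg₁ r hr)
  · simp [Op.eval, hx₂]

/-- The loop of `foldE` from the index `k` on. -/
theorem fold_loop {body : ℕ → ℕ → Code} {n : ℕ} {acc cost : ℕ → ℕ} (h1 : 1 ≤ B) (hn : n ≤ B)
    (hbody : ∀ k < n, acc k ≤ B → ∀ w' ≥ w, ∀ r i, Var B w' r (acc k) → Var B w' i k →
      Ev B μ w' (body r i) (acc (k + 1)) (cost k)) {d : ℕ} (hd : w.depth ≤ d) (j : ℕ) :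
    ∀ k, k + j = n → acc k ≤ B → ∀ s : State, s.mem = μ → Agrees w s → s.reg d = acc k →
      s.reg (d + 1) = k → s.reg (d + 2) = n → s.reg (d + 3) = n - k →
      ∃ t ≤ 1 + ∑ i ∈ Finset.Ico k n, (cost i + 6), ∃ s', Runs B
        (.loop (d + 3) (.seq (body d (d + 1) (d + 3)) (.seq (.const d 0) (.seq (.arith .add d (d + 3) d)
          (.seq (.const (d + 3) 1) (.seq (.arith .add (d + 1) (d + 1) (d + 3))
            (.arith .sub (d + 3) (d + 2) (d + 1)))))))) s t s' ∧ s'.mem = μ ∧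
        (∀ r < d, s'.reg r = s.reg r) ∧ s'.reg d = acc n ∧ acc n ≤ B := by
  induction j with
  | zero =>
    intro k hk hacc s hs hw h0 h1' h2 h3
    obtain rfl : k = n := by omega
    exact ⟨1, by omega, s, .loop_done (by omega), hs, fun _ _ => rfl, h0, hacc⟩
  | succ j ih =>
    intro k hk hacc s hs hw h0 h1' h2 h3
    have hkn : k < n := by omega
    have hle : w ≤ World.push s (d + 3) := le_push hd hw (fun _ _ => rfl) (by omega)
    have hev := hbody k hkn hacc (World.push s (d + 3)) hle d (d + 1)
      ⟨by simp [World.push], h0, hacc⟩ ⟨by simp [World.push], h1', by omega⟩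
    obtain ⟨t₁, ht₁, s₁, hr₁, hm₁, hreg₁, hx₁⟩ := hev.2 s hs (d + 3) le_rfl (agrees_push _ _)
    have hd1 : s₁.reg (d + 1) = k := (hreg₁ _ (by omega)).trans h1'
    have hd2 : s₁.reg (d + 2) = n := (hreg₁ _ (by omega)).trans h2
    have hrest : Runs B (.seq (.const d 0) (.seq (.arith .add d (d + 3) d)
          (.seq (.const (d + 3) 1) (.seq (.arith .add (d + 1) (d + 1) (d + 3))
            (.arith .sub (d + 3) (d + 2) (d + 1)))))) s₁ (1 + (1 + (1 + (1 + 1))))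
        { reg := Function.update (Function.update (Function.update s₁.reg d (acc (k + 1))) (d + 1) (k + 1))
            (d + 3) (n - (k + 1)), mem := s₁.mem } := by
      refine .seq (.const _ d 0 (Nat.zero_le _)) (.seq (.arith _ .add d (d + 3) d ?_)
        (.seq (.const _ (d + 3) 1 h1) (.seq (.arith _ .add (d + 1) (d + 1) (d + 3) ?_) ?_)))
      · simpa [Op.eval, hx₁] using hev.1
      · simp [Op.eval, hd1]; omega
      · have := Runs.arith (B := B) { reg := Function.update (Function.update (Function.update (Function.update
            (Function.update s₁.reg d 0) d (acc (k + 1))) (d + 3) 1) (d + 1) (k + 1)) (d + 3) 1, mem := s₁.mem }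
            .sub (d + 3) (d + 2) (d + 1) (by simp [Op.eval, hd2]; omega)
        convert this using 2
        · simp [Op.eval, hx₁, hd1]
        · simp [Op.eval, hd2]
          funext r
          simp only [Function.update_apply]
          split_ifs <;> rfl
    obtain ⟨t₂, ht₂, s₂, hr₂, hm₂, hreg₂, hx₂⟩ := ih (k + 1) (by omega) hev.1
      { reg := Function.update (Function.update (Function.update s₁.reg d (acc (k + 1))) (d + 1) (k + 1))
            (d + 3) (n - (k + 1)), mem := s₁.mem } hm₁ (by
        intro r hr
        have e1 : r ≠ d := by omega
        have e2 : r ≠ d + 1 := by omega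
        have e3 : r ≠ d + 3 := by omega
        simp only [Function.update_of_ne e1, Function.update_of_ne e2, Function.update_of_ne e3]
        exact (hreg₁ r (by omega)).trans (hw r hr)) (by simp) (by simp) (by simp [hd2]) (by simp)
    refine ⟨1 + (t₁ + (1 + (1 + (1 + (1 + 1))))) + t₂, ?_, s₂, .loop_step (by omega) (.seq hr₁ hrest) hr₂,
      hm₂, fun r hr => ?_, hx₂⟩
    · rw [Finset.sum_eq_sum_Ico_succ_bot hkn]; omega
    · have e1 : r ≠ d := by omega
      have e2 : r ≠ d + 1 := by omega
      have e3 : r ≠ d + 3 := by omega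
      rw [hreg₂ r hr]
      simp only [Function.update_of_ne e1, Function.update_of_ne e2, Function.update_of_ne e3]
      exact hreg₁ r (by omega)

/-- The cost may depend on the index. This matters because expensive branches are taken for few
indices only. -/
theorem fold {N init : Code} {body : ℕ → ℕ → Code} {n cN ci : ℕ} {acc cost : ℕ → ℕ} (h1 : 1 ≤ B)
    (hN : Ev B μ w N n cN) (hi : Ev B μ w init (acc 0) ci)
    (hbody : ∀ k < n, acc k ≤ B → ∀ w' ≥ w, ∀ r i, Var B w' r (acc k) → Var B w' i k →
      Ev B μ w' (body r i) (acc (k + 1)) (cost k)) :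
    Ev B μ w (foldE N init body) (acc n) (ci + cN + 3 + ∑ k ∈ Finset.range n, (cost k + 6)) := by
  have key : ∀ s : State, s.mem = μ → ∀ d, w.depth ≤ d → Agrees w s →
      ∃ t ≤ ci + cN + 3 + ∑ k ∈ Finset.range n, (cost k + 6), ∃ s',
        Runs B (foldE N init body d) s t s' ∧ s'.mem = μ ∧ (∀ r < d, s'.reg r = s.reg r) ∧
        s'.reg d = acc n ∧ acc n ≤ B := by
    intro s hs d hd hw
    obtain ⟨t₁, ht₁, s₁, hr₁, hm₁, hreg₁, hx₁⟩ := hi.2 s hs d hd hw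
    obtain ⟨t₂, ht₂, s₂, hr₂, hm₂, hreg₂, hx₂⟩ := hN.2
      { s₁ with reg := Function.update s₁.reg (d + 1) 0 } hm₁ (d + 2) (by omega) (by
        intro r hr
        have e2 : r ≠ d + 1 := by omega
        simp only [Function.update_of_ne e2]
        exact (hreg₁ r (by omega)).trans (hw r hr))
    have hlt : ∀ r < d, s₂.reg r = s.reg r := by
      intro r hr
      have e2 : r ≠ d + 1 := by omega
      rw [hreg₂ r (by omega)]
      simp only [Function.update_of_ne e2]
      exact hreg₁ r hr
    have hd0 : s₂.reg d = acc 0 := by rw [hreg₂ d (by omega)]; simpa using hx₁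
    have hd1 : s₂.reg (d + 1) = 0 := by rw [hreg₂ (d + 1) (by omega)]; simp
    obtain ⟨t₃, ht₃, s₃, hr₃, hm₃, hreg₃, hx₃⟩ := fold_loop h1 hN.1 hbody hd n 0 (by omega) hi.1
      { s₂ with reg := Function.update s₂.reg (d + 3) n } hm₂ (by
        intro r hr
        have e2 : r ≠ d + 3 := by omega
        simp only [Function.update_of_ne e2]
        exact (hlt r (by omega)).trans (hw r hr)) (by simpa using hd0) (by simpa using hd1)
        (by simpa using hx₂) (by simp)
    refine ⟨t₁ + (1 + (t₂ + (1 + t₃))), ?_, s₃, .seq hr₁ (.seq (.const _ _ _ (Nat.zero_le _))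
      (.seq hr₂ (.seq ?_ hr₃))), hm₃, fun r hr => ?_, hx₃⟩
    · rw [Finset.range_eq_Ico]; omega
    · have := Runs.arith (B := B) s₂ .sub (d + 3) (d + 2) (d + 1)
        (by simp [Op.eval, hx₂, hd1]; exact hN.1)
      simpa [Op.eval, hx₂, hd1] using this
    · have e2 : r ≠ d + 3 := by omega
      rw [hreg₃ r hr]
      simp only [Function.update_of_ne e2]
      exact hlt r hr
  refine ⟨?_, fun s hs d hd hw => ?_⟩
  · obtain ⟨-, -, -, -, -, -, -, h⟩ := key ⟨w.reg, μ⟩ rfl w.depth le_rfl fun _ _ => rfl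
    exact h
  · obtain ⟨t, ht, s', h⟩ := key s hs d hd hw
    exact ⟨t, ht, s', h.1, h.2.1, h.2.2.1, h.2.2.2.1⟩

end Ev

end RAM

/-! ### Connectives, bounded quantifiers, and programs that write to the memory. -/

namespace RAM

/-- The conjunction; the second expression is evaluated only if the first one is nonzero. -/
def andE (a b : Code) : Code := iteE a b (litE 0)

/-- The disjunction; the second expression is evaluated only if the first one is zero. -/
def orE (a b : Code) : Code := iteE a (litE 1) b

/-- The implication; the second expression is evaluated only if the first one is nonzero. -/
def impE (a b : Code) : Code := iteE a b (litE 1)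

/-- The negation. -/
def notE (a : Code) : Code := iteE a (litE 0) (litE 1)

/-- The sum of `f i` for `i < N`. -/
def sumE (N : Code) (f : ℕ → Code) : Code :=
  foldE N (litE 0) fun acc i => opE .add (varE acc) (f i)

/-- `f i` for all `i < N`. -/
def allE (N : Code) (f : ℕ → Code) : Code :=
  foldE N (litE 1) fun acc i => andE (varE acc) (f i)

/-- `f i` for some `i < N`. -/
def anyE (N : Code) (f : ℕ → Code) : Code :=
  foldE N (litE 0) fun acc i => orE (varE acc) (f i)

namespace Ev

variable {B : ℕ} {μ : ℕ → ℕ} {w w' : World} {a b N : Code} {P Q : Prop} {ca cb n cN : ℕ}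

/-- Evaluation is lazy, and the second cost is charged only if the first test succeeds. The
indicator makes this countable when costs are summed over a loop; it also lets `hb` assume `P`. -/
theorem and (ha : Ev B μ w a (ind P) ca) (hb : P → Ev B μ w b (ind Q) cb) :
    Ev B μ w (andE a b) (ind (P ∧ Q)) (ca + ind P * cb + 2) := by
  by_cases hP : P
  · rw [ind_true hP, ind_congr (show P ∧ Q ↔ Q by tauto)]
    exact (ite_pos ha (by simp [ind, hP]) (hb hP)).le (by omega)
  · rw [ind_false hP, ind_false (show ¬ (P ∧ Q) by tauto)]
    exact (ite_neg ha (ind_false hP) (lit (Nat.zero_le _))).le (by omega)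

theorem imp (h1 : 1 ≤ B) (ha : Ev B μ w a (ind P) ca) (hb : P → Ev B μ w b (ind Q) cb) :
    Ev B μ w (impE a b) (ind (P → Q)) (ca + ind P * cb + 2) := by
  by_cases hP : P
  · rw [ind_true hP, ind_congr (show (P → Q) ↔ Q by tauto)]
    exact (ite_pos ha (by simp [ind, hP]) (hb hP)).le (by omega)
  · rw [ind_false hP, ind_true (show (P → Q) by tauto)]
    exact (ite_neg ha (ind_false hP) (lit h1)).le (by omega)

theorem or (h1 : 1 ≤ B) (ha : Ev B μ w a (ind P) ca) (hb : ¬ P → Ev B μ w b (ind Q) cb) :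
    Ev B μ w (orE a b) (ind (P ∨ Q)) (ca + cb + 2) := by
  by_cases hP : P
  · rw [ind_true (show P ∨ Q by tauto)]
    exact (ite_pos ha (by simp [ind, hP]) (lit h1)).le (by omega)
  · rw [ind_congr (show P ∨ Q ↔ Q by tauto)]
    exact (ite_neg ha (ind_false hP) (hb hP)).le (by omega)

theorem not (h1 : 1 ≤ B) (ha : Ev B μ w a (ind P) ca) :
    Ev B μ w (notE a) (ind ¬ P) (ca + 2) := by
  by_cases hP : P
  · rw [ind_false (show ¬ ¬ P by tauto)]
    exact (ite_pos ha (by simp [ind, hP]) (lit (Nat.zero_le _))).le (by omega)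
  · rw [ind_true hP]
    exact (ite_neg ha (ind_false hP) (lit h1)).le (by omega)

theorem sum {f : ℕ → Code} {g cost : ℕ → ℕ} (h1 : 1 ≤ B) (hN : Ev B μ w N n cN)
    (hB : ∑ k ∈ Finset.range n, g k ≤ B)
    (hf : ∀ k < n, ∀ w' ≥ w, ∀ i, Var B w' i k → Ev B μ w' (f i) (g k) (cost k)) :
    Ev B μ w (sumE N f) (∑ k ∈ Finset.range n, g k)
      (cN + 4 + ∑ k ∈ Finset.range n, (cost k + 9)) := by
  refine (fold (acc := fun k => ∑ i ∈ Finset.range k, g i) (cost := fun k => cost k + 3) h1 hN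
    (lit (Nat.zero_le _)) ?_).le (by simp only [add_assoc, Nat.reduceAdd]; omega)
  intro k hk hacc w' hw r i hr hi
  refine (op (.var hr) (hf k hk w' hw i hi) ?_).conv ?_ (by omega)
  · refine le_trans (le_of_eq ?_) ((Finset.sum_le_sum_of_subset
      (Finset.range_mono (show k + 1 ≤ n from hk))).trans hB)
    rw [Finset.sum_range_succ]; rfl
  · rw [Finset.sum_range_succ]; rfl

theorem all {f : ℕ → Code} {p : ℕ → Prop} {cost : ℕ → ℕ} (h1 : 1 ≤ B) (hN : Ev B μ w N n cN)
    (hf : ∀ k < n, ∀ w' ≥ w, ∀ i, Var B w' i k → Ev B μ w' (f i) (ind (p k)) (cost k)) :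
    Ev B μ w (allE N f) (ind (∀ k < n, p k)) (cN + 4 + ∑ k ∈ Finset.range n, (cost k + 10)) := by
  refine (fold (acc := fun k => ind (∀ i < k, p i)) (cost := fun k => cost k + 4) h1 hN
    ((lit h1).conv (ind_true (by simp)).symm le_rfl) ?_).le (by simp only [add_assoc, Nat.reduceAdd]; omega)
  intro k hk hacc w' hw r i hr hi
  refine (and (.var hr) fun _ => hf k hk w' hw i hi).conv (ind_congr ?_) ?_
  · rw [Nat.forall_lt_succ_right]
  · have := Nat.mul_le_mul_right (cost k) (ind_le_one (∀ i < k, p i))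
    omega

theorem any {f : ℕ → Code} {p : ℕ → Prop} {cost : ℕ → ℕ} (h1 : 1 ≤ B) (hN : Ev B μ w N n cN)
    (hf : ∀ k < n, ∀ w' ≥ w, ∀ i, Var B w' i k → Ev B μ w' (f i) (ind (p k)) (cost k)) :
    Ev B μ w (anyE N f) (ind (∃ k < n, p k)) (cN + 4 + ∑ k ∈ Finset.range n, (cost k + 10)) := by
  refine (fold (acc := fun k => ind (∃ i < k, p i)) (cost := fun k => cost k + 4) h1 hN
    ((lit (Nat.zero_le _)).conv (ind_false (by simp)).symm le_rfl) ?_).le (by simp only [add_assoc, Nat.reduceAdd]; omega)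
  intro k hk hacc w' hw r i hr hi
  refine (or h1 (.var hr) fun _ => hf k hk w' hw i hi).conv (ind_congr ?_) (by omega)
  rw [Nat.exists_lt_succ_right]

end Ev

/-- `Out B μ w e v c`: the expression `e` has the value `v`, and is evaluated in at most `c` steps;
the memory may be changed. -/
def Out (B : ℕ) (μ : ℕ → ℕ) (w : World) (e : Code) (v c : ℕ) : Prop :=
  ∀ s : State, s.mem = μ → ∀ d, w.depth ≤ d → Agrees w s →
    ∃ t ≤ c, ∃ s', Runs B (e d) s t s' ∧ s'.reg d = v

/-- `St B μ w P μ' c`: the program `P d` changes the memory from `μ` to `μ'` in at most `c` steps,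
without changing the registers before `d`. -/
def St (B : ℕ) (μ : ℕ → ℕ) (w : World) (P : Code) (μ' : ℕ → ℕ) (c : ℕ) : Prop :=
  ∀ s : State, s.mem = μ → ∀ d, w.depth ≤ d → Agrees w s →
    ∃ t ≤ c, ∃ s', Runs B (P d) s t s' ∧ s'.mem = μ' ∧ ∀ r < d, s'.reg r = s.reg r

/-- First `P`, then `e`. -/
def thenE (P e : Code) : Code := fun d => .seq (P d) (e d)

/-- For `i = 0, …, N - 1`, stores the value of `val i` at the address `addr i`; the arguments are
registers. -/
def tabE (N : Code) (addr val : ℕ → Code) : Code := fun d =>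
  .seq (.const d 0) (.seq (N (d + 1)) (.seq (.arith .sub (d + 2) (d + 1) d)
    (.loop (d + 2) (.seq (addr d (d + 2)) (.seq (val d (d + 3)) (.seq (.store (d + 2) (d + 3))
      (.seq (.const (d + 2) 1) (.seq (.arith .add d d (d + 2))
        (.arith .sub (d + 2) (d + 1) d)))))))))

variable {B : ℕ} {μ μ' : ℕ → ℕ} {w : World}

theorem Ev.out {e : Code} {v c : ℕ} (h : Ev B μ w e v c) : Out B μ w e v c := by
  intro s hs d hd hw
  obtain ⟨t, ht, s', h⟩ := h.2 s hs d hd hw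
  exact ⟨t, ht, s', h.1, h.2.2.2⟩

theorem Out.le {e : Code} {v c c' : ℕ} (h : Out B μ w e v c) (hc : c ≤ c') : Out B μ w e v c' := by
  intro s hs d hd hw
  obtain ⟨t, ht, h⟩ := h s hs d hd hw
  exact ⟨t, ht.trans hc, h⟩

theorem St.le {P : Code} {c c' : ℕ} (h : St B μ w P μ' c) (hc : c ≤ c') : St B μ w P μ' c' := by
  intro s hs d hd hw
  obtain ⟨t, ht, h⟩ := h s hs d hd hw
  exact ⟨t, ht.trans hc, h⟩

theorem Out.then {P e : Code} {v c c' : ℕ} (hP : St B μ w P μ' c) (he : Out B μ' w e v c') :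
    Out B μ w (thenE P e) v (c + c') := by
  intro s hs d hd hw
  obtain ⟨t₁, ht₁, s₁, hr₁, hm₁, hreg₁⟩ := hP s hs d hd hw
  obtain ⟨t₂, ht₂, s₂, hr₂, hx⟩ := he s₁ hm₁ d hd fun r hr => (hreg₁ r (by omega)).trans (hw r hr)
  exact ⟨t₁ + t₂, by omega, s₂, .seq hr₁ hr₂, hx⟩

theorem Out.letE {a : Code} {g : ℕ → Code} {x v ca c : ℕ} (hv : v ≤ B) (ha : Ev B μ w a x ca)
    (hg : ∀ w' ≥ w, ∀ r, Var B w' r x → Out B μ w' (g r) v c) :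
    Out B μ w (letE a g) v (ca + c + 2) := by
  intro s hs d hd hw
  obtain ⟨t₁, ht₁, s₁, hr₁, hm₁, hreg₁, hx₁⟩ := ha.2 s hs d hd hw
  obtain ⟨t₂, ht₂, s₂, hr₂, hx₂⟩ := (hg (World.push s₁ (d + 1))
    (le_push hd hw hreg₁ (by omega)) d ⟨by simp [World.push], hx₁, ha.1⟩) s₁ hm₁ (d + 1) le_rfl
    (agrees_push _ _)
  refine ⟨t₁ + (t₂ + (1 + 1)), by omega, _, .seq hr₁ (.seq hr₂ (.seq (.const _ d 0 (Nat.zero_le _))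
    (.arith _ .add d (d + 1) d ?_))), ?_⟩
  · simpa [Op.eval, hx₂] using hv
  · simp [Op.eval, hx₂]

/-- `M k` is the memory after `k` stores. Addresses and values are evaluated there, so an entry may
be computed from the previous ones. -/
theorem St.tab {N : Code} {addr val : ℕ → Code} {n cN : ℕ} {M : ℕ → ℕ → ℕ} {ad va ca cv : ℕ → ℕ}
    (h1 : 1 ≤ B) (hN : Ev B (M 0) w N n cN)
    (haddr : ∀ k < n, ∀ w' ≥ w, ∀ i, Var B w' i k → Ev B (M k) w' (addr i) (ad k) (ca k))
    (hval : ∀ k < n, ∀ w' ≥ w, ∀ i, Var B w' i k → Ev B (M k) w' (val i) (va k) (cv k))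
    (hM : ∀ k < n, M (k + 1) = Function.update (M k) (ad k) (va k)) :
    St B (M 0) w (tabE N addr val) (M n)
      (cN + 3 + ∑ k ∈ Finset.range n, (ca k + cv k + 5)) := by
  have loop : ∀ d, w.depth ≤ d → ∀ j k, k + j = n → ∀ s : State, s.mem = M k → Agrees w s →
      s.reg d = k → s.reg (d + 1) = n → s.reg (d + 2) = n - k →
      ∃ t ≤ 1 + ∑ i ∈ Finset.Ico k n, (ca i + cv i + 5), ∃ s', Runs B
        (.loop (d + 2) (.seq (addr d (d + 2)) (.seq (val d (d + 3)) (.seq (.store (d + 2) (d + 3))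
          (.seq (.const (d + 2) 1) (.seq (.arith .add d d (d + 2))
            (.arith .sub (d + 2) (d + 1) d))))))) s t s' ∧ s'.mem = M n ∧
        ∀ r < d, s'.reg r = s.reg r := by
    intro d hd j
    induction j with
    | zero =>
      intro k hk s hs hw h0 h1' h2
      obtain rfl : k = n := by omega
      exact ⟨1, by omega, s, .loop_done (by omega), hs, fun _ _ => rfl⟩
    | succ j ih =>
      intro k hk s hs hw h0 h1' h2
      have hkn : k < n := by omega
      have hnB := hN.1
      have hle : w ≤ World.push s (d + 2) := le_push hd hw (fun _ _ => rfl) (by omega)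
      have hvar : Var B (World.push s (d + 2)) d k := ⟨by simp [World.push], h0, by omega⟩
      obtain ⟨t₁, ht₁, s₁, hr₁, hm₁, hreg₁, hx₁⟩ :=
        (haddr k hkn _ hle d hvar).2 s hs (d + 2) le_rfl (agrees_push _ _)
      have hev := hval k hkn _ hle d hvar
      obtain ⟨t₂, ht₂, s₂, hr₂, hm₂, hreg₂, hx₂⟩ := hev.2 s₁ hm₁ (d + 3) (by simp [World.push])
        (fun r hr => hreg₁ r hr)
      have e0 : s₂.reg d = k := by rw [hreg₂ _ (by omega), hreg₁ _ (by omega), h0]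
      have e1 : s₂.reg (d + 1) = n := by rw [hreg₂ _ (by omega), hreg₁ _ (by omega), h1']
      have e2 : s₂.reg (d + 2) = ad k := by rw [hreg₂ _ (by omega), hx₁]
      have hrest : Runs B (.seq (.store (d + 2) (d + 3)) (.seq (.const (d + 2) 1)
          (.seq (.arith .add d d (d + 2)) (.arith .sub (d + 2) (d + 1) d)))) s₂ (1 + (1 + (1 + 1)))
          { reg := Function.update (Function.update (Function.update s₂.reg (d + 2) 1) d (k + 1))
              (d + 2) (n - (k + 1)), mem := M (k + 1) } := by
        refine .seq (.store _ _ _ ?_) (.seq (.const _ _ 1 h1) (.seq (.arith _ .add d d (d + 2) ?_) ?_))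
        · rw [hx₂]; exact hev.1
        · simp [Op.eval, e0]; omega
        · have := Runs.arith (B := B) { reg := Function.update (Function.update s₂.reg (d + 2) 1) d (k + 1), mem := M (k + 1) } .sub (d + 2) (d + 1) d (by simp [Op.eval, e1]; omega)
          convert this using 2
          · simp [Op.eval, e0]
          · simp only [e2, hx₂, hm₂, hM k hkn]
          · simp [Op.eval, e1]
      obtain ⟨t₃, ht₃, s₃, hr₃, hm₃, hreg₃⟩ := ih (k + 1) (by omega)
        { reg := Function.update (Function.update (Function.update s₂.reg (d + 2) 1) d (k + 1))
              (d + 2) (n - (k + 1)), mem := M (k + 1) } rfl (by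
          intro r hr
          have e1 : r ≠ d := by omega
          have e3 : r ≠ d + 2 := by omega
          simp only [Function.update_of_ne e1, Function.update_of_ne e3]
          rw [hreg₂ r (by omega), hreg₁ r (by omega)]
          exact hw r hr) (by simp) (by simp [e1]) (by simp)
      refine ⟨1 + (t₁ + (t₂ + (1 + (1 + (1 + 1))))) + t₃, ?_, s₃,
        .loop_step (by omega) (.seq hr₁ (.seq hr₂ hrest)) hr₃, hm₃, fun r hr => ?_⟩
      · rw [Finset.sum_eq_sum_Ico_succ_bot hkn]; omega
      · have e1 : r ≠ d := by omega
        have e3 : r ≠ d + 2 := by omega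
        rw [hreg₃ r hr]
        simp only [Function.update_of_ne e1, Function.update_of_ne e3]
        rw [hreg₂ r (by omega), hreg₁ r (by omega)]
  intro s hs d hd hw
  obtain ⟨t₂, ht₂, s₂, hr₂, hm₂, hreg₂, hx₂⟩ := hN.2
    { s with reg := Function.update s.reg d 0 } hs (d + 1) (by omega) (by
      intro r hr
      have e2 : r ≠ d := by omega
      simp only [Function.update_of_ne e2]
      exact hw r hr)
  have hlt : ∀ r < d, s₂.reg r = s.reg r := by
    intro r hr
    rw [hreg₂ r (by omega)]
    simp only [Function.update_of_ne hr.ne]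
  have hd0 : s₂.reg d = 0 := by rw [hreg₂ d (by omega)]; simp
  obtain ⟨t₃, ht₃, s₃, hr₃, hm₃, hreg₃⟩ := loop d hd n 0 (by omega)
    { s₂ with reg := Function.update s₂.reg (d + 2) n } hm₂ (by
      intro r hr
      have e2 : r ≠ d + 2 := by omega
      simp only [Function.update_of_ne e2]
      exact (hlt r (by omega)).trans (hw r hr)) (by simpa using hd0) (by simpa using hx₂) (by simp)
  refine ⟨1 + (t₂ + (1 + t₃)), ?_, s₃, .seq (.const _ _ _ (Nat.zero_le _))
    (.seq hr₂ (.seq ?_ hr₃)), hm₃, fun r hr => ?_⟩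
  · rw [Finset.range_eq_Ico]; omega
  · have := Runs.arith (B := B) s₂ .sub (d + 2) (d + 1) d (by simp [Op.eval, hx₂, hd0]; exact hN.1)
    simpa [Op.eval, hx₂, hd0] using this
  · have e2 : r ≠ d + 2 := by omega
    rw [hreg₃ r hr]
    simp only [Function.update_of_ne e2]
    exact hlt r hr

end RAM

/-! ### Mixed radix representation -/

/-- The weights of the digits in the mixed radix representation with radices `r`. -/
def weight (r : ℕ → ℕ) (i : ℕ) : ℕ := ∏ k ∈ Finset.range i, r k

theorem weight_succ (r : ℕ → ℕ) (i : ℕ) : weight r (i + 1) = weight r i * r i :=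
  Finset.prod_range_succ _ _

theorem weight_dvd (r : ℕ → ℕ) {i j : ℕ} (h : i ≤ j) : weight r i ∣ weight r j :=
  Finset.prod_dvd_prod_of_subset _ _ _ (Finset.range_mono h)

theorem weight_pos {r : ℕ → ℕ} (hr : ∀ k, 0 < r k) (i : ℕ) : 0 < weight r i :=
  Finset.prod_pos fun k _ => hr k

theorem weight_mono {r : ℕ → ℕ} (hr : ∀ k, 0 < r k) {i j : ℕ} (h : i ≤ j) :
    weight r i ≤ weight r j :=
  Nat.le_of_dvd (weight_pos hr j) (weight_dvd r h)

theorem sum_digits_lt {r f : ℕ → ℕ} (N : ℕ) (hf : ∀ k < N, f k < r k) :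
    ∑ k ∈ Finset.range N, f k * weight r k < weight r N := by
  induction N with
  | zero => simp [weight]
  | succ N ih =>
    rw [Finset.sum_range_succ, weight_succ]
    have h1 := ih fun k hk => hf k (by omega)
    have h2 := Nat.mul_le_mul_right (weight r N) (show f N + 1 ≤ r N from hf N (by omega))
    rw [mul_comm (weight r N)]
    nlinarith

/-- The lower digits contribute less than the weight of `i`, and the higher ones a multiple of the
next weight. -/
theorem digit_sum_digits {r f : ℕ → ℕ} (hr : ∀ k, 0 < r k) {N i : ℕ} (hi : i < N)
    (hf : ∀ k < N, f k < r k) :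
    (∑ k ∈ Finset.range N, f k * weight r k) / weight r i % r i = f i := by
  obtain ⟨c, hc⟩ : ∃ c, ∑ k ∈ Finset.range N, f k * weight r k =
      ∑ k ∈ Finset.range i, f k * weight r k + weight r i * (f i + r i * c) := by
    clear hf
    induction N with
    | zero => omega
    | succ N ih =>
      rw [Finset.sum_range_succ]
      rcases (show i = N ∨ i < N by omega) with rfl | h
      · exact ⟨0, by ring⟩
      · obtain ⟨c, hc⟩ := ih h
        obtain ⟨d, hd⟩ := weight_dvd r (show i + 1 ≤ N from h)
        refine ⟨c + f N * d, ?_⟩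
        rw [hc, hd, weight_succ]
        ring
  have hlow := sum_digits_lt i fun k hk => hf k (by omega)
  rw [hc, Nat.add_mul_div_left _ _ (weight_pos hr i), Nat.div_eq_of_lt hlow, zero_add,
    Nat.add_mul_mod_self_left, Nat.mod_eq_of_lt (hf i hi)]

theorem sum_digits (r : ℕ → ℕ) (s N : ℕ) :
    ∑ k ∈ Finset.range N, s / weight r k % r k * weight r k = s % weight r N := by
  induction N with
  | zero => simp [weight, Nat.mod_one]
  | succ N ih => rw [Finset.sum_range_succ, ih, weight_succ, Nat.mod_mul, mul_comm (weight r N)]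

/-! ### The numbering of positions and the table. -/

namespace ChainGame

variable {n : ℕ}

/-- The extension of a family of numbers by zeros. -/
def extend (f : Fin n → ℕ) (k : ℕ) : ℕ := if h : k < n then f ⟨k, h⟩ else 0

@[simp] theorem extend_val (f : Fin n → ℕ) (j : Fin n) : extend f j = f j := by simp [extend]

/-- The radices for the positions, in the game with chains of lengths `L`. -/
def radix (L : Fin n → ℕ) (k : ℕ) : ℕ :=
  if k < n then extend L k / 2 + 1 else extend L (k - n) + 1

theorem radix_pos (L : Fin n → ℕ) (k : ℕ) : 0 < radix L k := by
  unfold radix; split_ifs <;> omega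

/-- The digits of the position `q, m`. -/
def digits (q m : Fin n → ℕ) (k : ℕ) : ℕ := if k < n then extend m k else extend q (k - n)

/-- The number of the position `q, m`. -/
def code (L q m : Fin n → ℕ) : ℕ := ∑ k ∈ Finset.range (n + n), digits q m k * weight (radix L) k

/-- The number of positions. -/
def codes (L : Fin n → ℕ) : ℕ := weight (radix L) (n + n)

/-- The numbers of remaining elements in the position with number `s`. -/
def qdigit (L : Fin n → ℕ) (s : ℕ) (j : Fin n) : ℕ :=
  s / weight (radix L) (n + j) % (L j + 1)

/-- The description of the threats in the position with number `s`. -/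
def mdigit (L : Fin n → ℕ) (s : ℕ) (j : Fin n) : ℕ :=
  s / weight (radix L) j % (L j / 2 + 1)

/-- The positions with a number. -/
def Bdd (L q m : Fin n → ℕ) : Prop := (∀ j, q j ≤ L j) ∧ ∀ j, m j ≤ L j / 2

theorem bdd_digit (L : Fin n → ℕ) (s : ℕ) : Bdd L (qdigit L s) (mdigit L s) :=
  ⟨fun _ => Nat.lt_succ_iff.1 (Nat.mod_lt _ (by omega)),
    fun _ => Nat.lt_succ_iff.1 (Nat.mod_lt _ (by omega))⟩

theorem code_eq_sum (L q m : Fin n → ℕ) : code L q m =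
    ∑ j : Fin n, (m j * weight (radix L) j + q j * weight (radix L) (n + j)) := by
  unfold code
  rw [Finset.sum_range_add, Finset.sum_add_distrib, ← Fin.sum_univ_eq_sum_range (fun k => digits q m k * weight (radix L) k),
    ← Fin.sum_univ_eq_sum_range (fun k => digits q m (n + k) * weight (radix L) (n + k))]
  simp [digits]

variable {L q m : Fin n → ℕ}

theorem Bdd.digits_lt (h : Bdd L q m) : ∀ k < n + n, digits q m k < radix L k := by
  intro k hk
  unfold digits radix
  by_cases hkn : k < n
  · have := h.2 ⟨k, hkn⟩
    simp [hkn, extend]; omega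
  · have := h.1 ⟨k - n, by omega⟩
    simp [hkn, extend, show k - n < n by omega]; omega

theorem Bdd.code_lt (h : Bdd L q m) : code L q m < codes L := sum_digits_lt _ h.digits_lt

theorem Bdd.qdigit_code (h : Bdd L q m) : qdigit L (code L q m) = q := by
  funext j
  have := digit_sum_digits (radix_pos L) (show n + j < n + n by omega) h.digits_lt
  have e : radix L (n + j) = L j + 1 := by simp [radix]
  rw [e] at this
  simpa [qdigit, code, digits] using this

theorem Bdd.mdigit_code (h : Bdd L q m) : mdigit L (code L q m) = m := by
  funext j
  have := digit_sum_digits (radix_pos L) (show (j : ℕ) < n + n by omega) h.digits_lt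
  have e : radix L j = L j / 2 + 1 := by simp [radix]
  rw [e] at this
  simpa [mdigit, code, digits] using this

theorem code_digit {s : ℕ} (hs : s < codes L) : code L (qdigit L s) (mdigit L s) = s := by
  refine Eq.trans (Finset.sum_congr rfl fun k hk => ?_) ((sum_digits (radix L) s (n + n)).trans
    (Nat.mod_eq_of_lt hs))
  rw [Finset.mem_range] at hk
  congr 1
  by_cases hkn : k < n
  · simp [digits, extend, mdigit, radix, hkn]
  · simp [digits, extend, qdigit, radix, hkn, show k - n < n by omega, show n + (k - n) = k by omega]

/-- All digits of `m` together weigh less than one unit of the weight `weight (radix L) n`, which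
divides the weights of all digits of `q`. So threats added by a move cannot outweigh the removal of
an element. -/
theorem code_lt_code {q' m' : Fin n → ℕ} (hm : ∀ j, m j ≤ L j / 2) (hle : ∀ j, q j ≤ q' j)
    (hlt : ∃ j, q j < q' j) : code L q m < code L q' m' := by
  rw [code_eq_sum, code_eq_sum, Finset.sum_add_distrib, Finset.sum_add_distrib]
  have h1 : ∑ j : Fin n, m j * weight (radix L) j < weight (radix L) n := by
    have := sum_digits_lt (r := radix L) (f := extend m) n (fun k hk => by
      have := hm ⟨k, hk⟩
      simp [radix, extend, hk]; omega)
    rw [← Fin.sum_univ_eq_sum_range (fun k => extend m k * weight (radix L) k)] at this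
    simpa using this
  choose g hg using fun j : Fin n => weight_dvd (radix L) (show n ≤ n + j by omega)
  have hgpos : ∀ j, 0 < g j := by
    intro j
    by_contra h
    have := weight_pos (radix_pos L) (n + j)
    rw [hg j, show g j = 0 by omega] at this
    simp at this
  have h2 : ∀ f : Fin n → ℕ, ∑ j : Fin n, f j * weight (radix L) (n + j) =
      weight (radix L) n * ∑ j, f j * g j := by
    intro f
    rw [Finset.mul_sum]
    refine Finset.sum_congr rfl fun j _ => ?_
    rw [hg j]; ring
  have h3 : ∑ j, q j * g j + 1 ≤ ∑ j, q' j * g j := by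
    obtain ⟨j, hj⟩ := hlt
    refine Finset.sum_lt_sum (fun i _ => Nat.mul_le_mul_right _ (hle i)) ⟨j, Finset.mem_univ j, ?_⟩
    exact Nat.mul_lt_mul_of_pos_right hj (hgpos j)
  rw [h2 q, h2 q']
  have h4 := Nat.mul_le_mul_left (weight (radix L) n) h3
  rw [mul_add, mul_one] at h4
  omega

/-- The positions that Breaker survives, by number. -/
def table (N : Fin n × ℕ → Fin n × ℕ → Prop) (ε : ℕ) (L : Fin n → ℕ) (s : ℕ) : Prop :=
  Step N (fun q m => ∃ _h : code L q m < s, Bdd L q m ∧ table N ε L (code L q m)) ε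
    (qdigit L s) (mdigit L s)
termination_by s
decreasing_by exact _h

/-- The positions that Breaker survives. -/
def Survives (N : Fin n × ℕ → Fin n × ℕ → Prop) (ε : ℕ) (L q m : Fin n → ℕ) : Prop :=
  Bdd L q m ∧ table N ε L (code L q m)

/-- The positions that Breaker survives, among those with numbers less than `s`. -/
def SurvivesBelow (N : Fin n × ℕ → Fin n × ℕ → Prop) (ε : ℕ) (L : Fin n → ℕ) (s : ℕ)
    (q m : Fin n → ℕ) : Prop :=
  code L q m < s ∧ Survives N ε L q m

variable {N : Fin n × ℕ → Fin n × ℕ → Prop} {ε : ℕ}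

theorem table_iff (s : ℕ) :
    table N ε L s ↔ Step N (SurvivesBelow N ε L s) ε (qdigit L s) (mdigit L s) := by
  rw [table]
  unfold SurvivesBelow Survives
  simp only [exists_prop]

theorem dec_code_lt {m' : Fin n → ℕ} {q' : Fin n → ℕ} (hle : ∀ j, q' j ≤ q j) {l : Fin n}
    (hl : 0 < q' l) (hb : Bdd L (dec q' l) m') : code L (dec q' l) m' < code L q m :=
  code_lt_code hb.2 (fun j => (dec_le _ _ _).trans (hle j))
    ⟨l, by have := hle l; simp; omega⟩

/-- An answer removes an element and hence leads to a smaller number; restricting the table to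
earlier entries loses nothing. -/
theorem answer_below_iff {q' m₁ : Fin n → ℕ} (hle : ∀ j, q' j ≤ q j) (row : Set (Fin n × ℕ)) :
    Answer (SurvivesBelow N ε L (code L q m)) ε q' m₁ row ↔
      Answer (Survives N ε L) ε q' m₁ row := by
  unfold Answer Safe SurvivesBelow
  refine or_congr Iff.rfl (exists_congr fun l => and_congr_right fun hl => and_congr_right fun _ => ?_)
  exact ⟨fun h => h.2, fun h => ⟨dec_code_lt hle hl h.1, h⟩⟩

theorem survives_iff (hb : Bdd L q m) :
    Survives N ε L q m ↔ Step N (Survives N ε L) ε q m := by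
  unfold Survives
  rw [table_iff, hb.qdigit_code, hb.mdigit_code]
  simp only [hb, true_and]
  unfold Step
  refine and_congr_right fun _ => and_congr_right fun _ => and_congr ?_ ?_
  · exact forall_congr' fun k => forall_congr' fun _ => forall_congr' fun _ =>
      answer_below_iff (dec_le q k) _
  · refine forall_congr' fun _ => forall_congr' fun k => forall_congr' fun _ =>
      forall_congr' fun _ => answer_below_iff (fun j => ?_) _
    by_cases h : j = k
    · subst h; simp
    · simp [h]

end ChainGame

/-! ### Arrays in memory and the expressions for the recurrence. -/

namespace RAM

/-- The cell `i` of the array `a` holds the value `v`; the arrays are interleaved, from `base` on. -/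
def Cell (B : ℕ) (μ : ℕ → ℕ) (base a i v : ℕ) : Prop :=
  base + 8 * i + a ≤ B ∧ μ (base + 8 * i + a) = v ∧ v ≤ B

/-- The address of a cell of the array `a`, where the register `b` holds the base. -/
def addrE (b a : ℕ) (i : Code) : Code :=
  opE .add (opE .add (varE b) (opE .mul (litE 8) i)) (litE a)

/-- A cell of the array `a`, where the register `b` holds the base. -/
def arrE (b a : ℕ) (i : Code) : Code := loadE (addrE b a i)

namespace Ev

variable {B : ℕ} {μ : ℕ → ℕ} {w w' : World} {a N x y : Code} {b base n cN u v ca cx cy : ℕ}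

theorem add (hx : Ev B μ w x u cx) (hy : Ev B μ w y v cy) (h : u + v ≤ B) :
    Ev B μ w (opE .add x y) (u + v) (cx + cy + 1) := op hx hy h

theorem mul (hx : Ev B μ w x u cx) (hy : Ev B μ w y v cy) (h : u * v ≤ B) :
    Ev B μ w (opE .mul x y) (u * v) (cx + cy + 1) := op hx hy h

theorem sub (hx : Ev B μ w x u cx) (hy : Ev B μ w y v cy) :
    Ev B μ w (opE .sub x y) (u - v) (cx + cy + 1) := op hx hy ((Nat.sub_le _ _).trans hx.1)

theorem div (hx : Ev B μ w x u cx) (hy : Ev B μ w y v cy) :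
    Ev B μ w (opE .div x y) (u / v) (cx + cy + 1) := op hx hy ((Nat.div_le_self _ _).trans hx.1)

theorem mod (hx : Ev B μ w x u cx) (hy : Ev B μ w y v cy) :
    Ev B μ w (opE .mod x y) (u % v) (cx + cy + 1) := op hx hy ((Nat.mod_le _ _).trans hx.1)

theorem addr {i : Code} {k : ℕ} (hb : Var B w b base) (hi : Ev B μ w i k ca) {r : ℕ}
    (hB : base + 8 * k + r ≤ B) (h8 : 8 ≤ B) :
    Ev B μ w (addrE b r i) (base + 8 * k + r) (ca + 7) :=
  (add (add (var hb) (mul (lit h8) hi (by omega)) (by omega)) (lit (by omega)) hB).le (by omega)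

theorem arr {i : Code} {k r : ℕ} (h8 : 8 ≤ B) (hb : Var B w b base) (hc : Cell B μ base r k v)
    (hi : Ev B μ w i k ca) : Ev B μ w (arrE b r i) v (ca + 8) := by
  refine (load (addr hb hi hc.1 h8) ?_).conv hc.2.1 (by omega)
  rw [hc.2.1]; exact hc.2.2

theorem allFin {n : ℕ} {f : ℕ → Code} {p : Fin n → Prop} {cost : Fin n → ℕ} (h1 : 1 ≤ B)
    (hN : Ev B μ w N n cN)
    (hf : ∀ k : Fin n, ∀ w' ≥ w, ∀ i, Var B w' i k → Ev B μ w' (f i) (ind (p k)) (cost k)) :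
    Ev B μ w (allE N f) (ind (∀ k, p k)) (cN + 4 + ∑ k, (cost k + 10)) := by
  refine (all (p := fun k => ∀ h : k < n, p ⟨k, h⟩)
    (cost := fun k => if h : k < n then cost ⟨k, h⟩ else 0) h1 hN ?_).conv (ind_congr ?_) ?_
  · intro k hk w' hw i hi
    exact (hf ⟨k, hk⟩ w' hw i hi).conv (ind_congr (by simp [hk])) (by simp [hk])
  · exact ⟨fun h k => h k k.2 k.2, fun h k hk _ => h ⟨k, hk⟩⟩
  · rw [← Fin.sum_univ_eq_sum_range (fun k => (if h : k < n then cost ⟨k, h⟩ else 0) + 10)]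
    simp

theorem anyFin {n : ℕ} {f : ℕ → Code} {p : Fin n → Prop} {cost : Fin n → ℕ} (h1 : 1 ≤ B)
    (hN : Ev B μ w N n cN)
    (hf : ∀ k : Fin n, ∀ w' ≥ w, ∀ i, Var B w' i k → Ev B μ w' (f i) (ind (p k)) (cost k)) :
    Ev B μ w (anyE N f) (ind (∃ k, p k)) (cN + 4 + ∑ k, (cost k + 10)) := by
  refine (any (p := fun k => ∃ h : k < n, p ⟨k, h⟩)
    (cost := fun k => if h : k < n then cost ⟨k, h⟩ else 0) h1 hN ?_).conv (ind_congr ?_) ?_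
  · intro k hk w' hw i hi
    exact (hf ⟨k, hk⟩ w' hw i hi).conv (ind_congr (by simp [hk])) (by simp [hk])
  · exact ⟨fun ⟨k, _, hk, h⟩ => ⟨⟨k, hk⟩, h⟩, fun ⟨k, h⟩ => ⟨k, k.2, k.2, h⟩⟩
  · rw [← Fin.sum_univ_eq_sum_range (fun k => (if h : k < n then cost ⟨k, h⟩ else 0) + 10)]
    simp

theorem sumFin {n : ℕ} {f : ℕ → Code} {g cost : Fin n → ℕ} (h1 : 1 ≤ B) (hN : Ev B μ w N n cN)
    (hB : ∑ k, g k ≤ B)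
    (hf : ∀ k : Fin n, ∀ w' ≥ w, ∀ i, Var B w' i k → Ev B μ w' (f i) (g k) (cost k)) :
    Ev B μ w (sumE N f) (∑ k, g k) (cN + 4 + ∑ k, (cost k + 9)) := by
  have e : ∀ g : Fin n → ℕ, ∑ k ∈ Finset.range n, (if h : k < n then g ⟨k, h⟩ else 0) = ∑ k, g k := by
    intro g
    rw [← Fin.sum_univ_eq_sum_range (fun k => if h : k < n then g ⟨k, h⟩ else 0)]
    simp
  refine (sum (g := fun k => if h : k < n then g ⟨k, h⟩ else 0)
    (cost := fun k => if h : k < n then cost ⟨k, h⟩ else 0) h1 hN ?_ ?_).conv (e g) ?_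
  · rw [e g]; exact hB
  · intro k hk w' hw i hi
    exact (hf ⟨k, hk⟩ w' hw i hi).conv (by simp [hk]) (by simp [hk])
  · rw [Finset.sum_add_distrib, Finset.sum_add_distrib, e cost]
    simp

theorem pos (h1 : 1 ≤ B) (hx : Ev B μ w x u cx) :
    Ev B μ w (ltE (litE 0) x) (ind (u ≠ 0)) (cx + 4) :=
  (lt h1 (lit (Nat.zero_le _)) hx).conv (ind_congr Nat.pos_iff_ne_zero) (by omega)

end Ev

open ChainGame

/-- The memory holds the data for the evaluation of the recurrence: the depths, the chains, and the
lengths of the chains of the elements, the pairs, and the weights; `b` and `nr` are registers. -/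
structure Data (B : ℕ) (μ : ℕ → ℕ) (base : ℕ) {n : ℕ} (D : Fin n → ℕ) (R : Fin n → Fin n)
    (L : Fin n → ℕ) (Ad : ℕ → Fin n → Prop) : Prop where
  h8 : 8 ≤ B
  hn : 2 * n + 2 ≤ B
  hnn : (n + 1) * (n + 1) ≤ B
  dep : ∀ i : Fin n, Cell B μ base 1 i (D i)
  root : ∀ i : Fin n, Cell B μ base 2 i (R i)
  len : ∀ i : Fin n, Cell B μ base 3 i (L i)
  adj : ∀ x ≤ n, ∀ z : Fin n, Cell B μ base 4 (x * n + z) (ind (Ad x z))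
  wt : ∀ i ≤ n + n, Cell B μ base 5 i (weight (radix L) i)
  depth_lt : ∀ i, D i < n
  len_le : ∀ i, L i ≤ n
  lt_iff : ∀ j i, i < L j ↔ ∃ z, (R z, D z) = (j, i)
  inj : ∀ z z', R z = R z' → D z = D z' → z = z'

/-- The parity of the number of vertices. -/
def epsE (nr : ℕ) : Code := opE .mod (varE nr) (litE 2)

/-- The number of the lowest elements of a chain up to the lowest threat's predecessor. -/
def cutE (nr : ℕ) (m : Code) : Code :=
  letE m fun r => iteE (varE r) (opE .add (opE .mul (litE 2) (varE r)) (epsE nr)) (litE 0)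

/-- Depth is of the right parity. -/
def parE (b nr z : ℕ) : Code := eqE (opE .mod (arrE b 1 (varE z)) (litE 2)) (epsE nr)

/-- A digit of the position in the register `s`. -/
def mdigE (b s r : ℕ) : Code :=
  opE .mod (opE .div (varE s) (arrE b 5 (varE r)))
    (opE .add (opE .div (arrE b 3 (varE r)) (litE 2)) (litE 1))

/-- A digit of the position in the register `s`. -/
def qdigE (b nr s r : ℕ) : Code :=
  opE .mod (opE .div (varE s) (arrE b 5 (opE .add (varE nr) (varE r))))
    (opE .add (arrE b 3 (varE r)) (litE 1))

/-- An entry of the matrix of pairs. -/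
def adjE (b nr x z : ℕ) : Code := arrE b 4 (opE .add (opE .mul (varE x) (varE nr)) (varE z))

/-- Removes an element from the chain `l`. -/
def decE (q : ℕ → Code) (l : ℕ) (r : ℕ) : Code := opE .sub (q r) (eqE (varE r) (varE l))

/-- Replaces the entry for the chain `k` by zero. -/
def zeroE (q : ℕ → Code) (k : ℕ) (r : ℕ) : Code := iteE (eqE (varE r) (varE k)) (litE 0) (q r)

/-- The test of `Valid`. -/
def validE (nr : ℕ) (q m : ℕ → Code) : Code :=
  andE (allE (varE nr) fun j => notE (ltE (q j) (cutE nr (m j))))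
    (impE (eqE (epsE nr) (litE 1)) (allE (varE nr) fun i => allE (varE nr) fun j =>
      impE (ltE (litE 0) (m i)) (impE (ltE (litE 0) (m j)) (eqE (varE i) (varE j)))))

/-- The test of `NoBadEdge`. -/
def noBadE (b nr : ℕ) (q m : ℕ → Code) : Code :=
  allE (varE nr) fun u => letE (arrE b 2 (varE u)) fun j =>
    impE (andE (ltE (litE 0) (m j)) (andE (eqE (q j) (cutE nr (m j)))
      (andE (ltE (arrE b 1 (varE u)) (q j)) (notE (parE b nr u)))))
    (allE (varE nr) fun v => impE (adjE b nr u v) (letE (arrE b 2 (varE v)) fun l =>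
      impE (ltE (arrE b 1 (varE v)) (q l)) (andE (parE b nr v)
        (impE (eqE (epsE nr) (litE 1)) (eqE (varE l) (varE j))))))

/-- The test of `Harmless`. -/
def harmlessE (b nr : ℕ) (q row : ℕ → Code) : Code :=
  allE (varE nr) fun z => impE (row z) (letE (arrE b 2 (varE z)) fun l =>
    impE (ltE (arrE b 1 (varE z)) (q l)) (andE (parE b nr z)
      (notE (eqE (opE .add (arrE b 1 (varE z)) (litE 1)) (q l)))))

/-- The value of `raise`. -/
def raiseE (b nr : ℕ) (q row m : ℕ → Code) (j : ℕ) : Code :=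
  foldE (varE nr) (m j) fun acc z =>
    iteE (andE (row z) (andE (eqE (arrE b 2 (varE z)) (varE j)) (ltE (arrE b 1 (varE z)) (q j))))
      (letE (opE .add (opE .div (opE .sub (arrE b 1 (varE z)) (epsE nr)) (litE 2)) (litE 1)) fun t =>
        iteE (ltE (varE acc) (varE t)) (varE t) (varE acc))
      (varE acc)

/-- The value of `code`. -/
def codeE (b nr : ℕ) (q m : ℕ → Code) : Code :=
  sumE (varE nr) fun j => opE .add (opE .mul (m j) (arrE b 5 (varE j)))
    (opE .mul (q j) (arrE b 5 (opE .add (varE nr) (varE j))))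

/-- The test of `Safe`. -/
def safeE (b nr : ℕ) (q m row : ℕ → Code) : Code :=
  andE (harmlessE b nr q row) (arrE b 6 (codeE b nr q (raiseE b nr q row m)))

/-- The test of `Answer`. -/
def answerE (b nr : ℕ) (q m row : ℕ → Code) : Code :=
  orE (allE (varE nr) fun j => eqE (q j) (litE 0))
    (anyE (varE nr) fun l => andE (ltE (litE 0) (q l)) (safeE b nr (decE q l) m row))

/-- The test of `Step`. -/
def stepE (b nr : ℕ) (q m : ℕ → Code) : Code :=
  andE (validE nr q m) (andE (noBadE b nr q m)
    (allE (varE nr) fun x => letE (arrE b 2 (varE x)) fun k =>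
      impE (eqE (opE .add (arrE b 1 (varE x)) (litE 1)) (q k))
        (iteE (ltE (cutE nr (m k)) (q k)) (answerE b nr (decE q k) m (adjE b nr x))
          (impE (eqE (epsE nr) (litE 1))
            (answerE b nr (zeroE q k) (zeroE m k) fun _ => litE 0)))))

section

variable {B : ℕ} {μ : ℕ → ℕ} {base n : ℕ} {D : Fin n → ℕ} {R : Fin n → Fin n} {L : Fin n → ℕ}
  {Ad : ℕ → Fin n → Prop} {w w' : World} {b nr : ℕ}

/-- The values of `q` on registers that hold chains. -/
def FEv (B : ℕ) (μ : ℕ → ℕ) (w : World) {n : ℕ} (q : ℕ → Code) (f : Fin n → ℕ) (c : ℕ) : Prop :=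
  ∀ w' ≥ w, ∀ r (j : Fin n), Var B w' r j → Ev B μ w' (q r) (f j) c

/-- The values of `row` on registers that hold elements. -/
def REv (B : ℕ) (μ : ℕ → ℕ) (w : World) {n : ℕ} (D : Fin n → ℕ) (R : Fin n → Fin n) (row : ℕ → Code)
    (S : Set (Fin n × ℕ)) (c : ℕ) : Prop :=
  ∀ w' ≥ w, ∀ r (z : Fin n), Var B w' r z → Ev B μ w' (row r) (ind ((R z, D z) ∈ S)) c

theorem FEv.ext {q : ℕ → Code} {f : Fin n → ℕ} {c : ℕ} (h : FEv B μ w q f c) (hw : w ≤ w') :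
    FEv B μ w' q f c := fun w'' hw' => h w'' (hw.trans hw')

theorem REv.ext {row : ℕ → Code} {S : Set (Fin n × ℕ)} {c : ℕ} (h : REv B μ w D R row S c)
    (hw : w ≤ w') : REv B μ w' D R row S c := fun w'' hw' => h w'' (hw.trans hw')

theorem FEv.le {q : ℕ → Code} {f : Fin n → ℕ} {c c' : ℕ} (h : FEv B μ w q f c) (hc : c ≤ c') :
    FEv B μ w q f c' := fun w' hw r j hr => (h w' hw r j hr).le hc

theorem FEv.dec (h1 : 1 ≤ B) {q : ℕ → Code} {f : Fin n → ℕ} {c l : ℕ} {k : Fin n}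
    (hq : FEv B μ w q f c) (hl : Var B w l k) :
    FEv B μ w (decE q l) (dec f k) (c + 10) := by
  intro w' hw r j hr
  refine (Ev.sub (hq w' hw r j hr) (Ev.eq h1 (.var hr) (.var (hl.ext hw)))).conv ?_ (by omega)
  by_cases h : j = k
  · subst h; simp [ind]
  · rw [dec_of_ne _ h, ind_false (fun e => h (Fin.ext e))]; rfl

theorem FEv.zero (h1 : 1 ≤ B) {q : ℕ → Code} {f : Fin n → ℕ} {c l : ℕ} {k : Fin n}
    (hq : FEv B μ w q f c) (hl : Var B w l k) :
    FEv B μ w (zeroE q l) (Function.update f k 0) (c + 12) := by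
  intro w' hw r j hr
  have he := Ev.eq (μ := μ) h1 (.var hr) (.var (hl.ext hw))
  by_cases h : j = k
  · subst h
    exact (Ev.ite_pos he (by simp [ind]) (.lit (Nat.zero_le _))).conv (by simp) (by omega)
  · exact (Ev.ite_neg he (ind_false fun e => h (Fin.ext e)) (hq w' hw r j hr)).conv (by simp [h])
      (by omega)

/-- The registers `b` and `nr` hold the base of the arrays and the number of vertices. -/
structure Regs (B : ℕ) (w : World) (b nr base n : ℕ) : Prop where
  b : Var B w b base
  n : Var B w nr n

theorem Regs.ext (h : Regs B w b nr base n) (hw : w ≤ w') : Regs B w' b nr base n :=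
  ⟨h.b.ext hw, h.n.ext hw⟩

namespace Data

variable (hd : Data B μ base D R L Ad)

include hd

theorem one_le : 1 ≤ B := le_trans (by norm_num) hd.h8

theorem depE (hr : Regs B w b nr base n) {z : ℕ} {i : Fin n} (hz : Var B w z i) :
    Ev B μ w (arrE b 1 (varE z)) (D i) 10 := (Ev.arr hd.h8 hr.b (hd.dep i) (.var hz)).le (by omega)

theorem rootE (hr : Regs B w b nr base n) {z : ℕ} {i : Fin n} (hz : Var B w z i) :
    Ev B μ w (arrE b 2 (varE z)) (R i) 10 := (Ev.arr hd.h8 hr.b (hd.root i) (.var hz)).le (by omega)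

theorem lenE (hr : Regs B w b nr base n) {z : ℕ} {i : Fin n} (hz : Var B w z i) :
    Ev B μ w (arrE b 3 (varE z)) (L i) 10 := (Ev.arr hd.h8 hr.b (hd.len i) (.var hz)).le (by omega)

theorem wtE (hr : Regs B w b nr base n) {z : ℕ} {i : Fin n} (hz : Var B w z i) :
    Ev B μ w (arrE b 5 (varE z)) (weight (radix L) i) 10 :=
  (Ev.arr hd.h8 hr.b (hd.wt i (by omega)) (.var hz)).le (by omega)

theorem wtE' (hr : Regs B w b nr base n) {z : ℕ} {i : Fin n} (hz : Var B w z i) :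
    Ev B μ w (arrE b 5 (opE .add (varE nr) (varE z))) (weight (radix L) (n + i)) 13 := by
  have := hd.hn
  have := i.2
  exact (Ev.arr hd.h8 hr.b (hd.wt (n + i) (by omega)) (.add (.var hr.n) (.var hz) (by omega))).le
    (by omega)

theorem eps (hr : Regs B w b nr base n) : Ev B μ w (epsE nr) (n % 2) 4 :=
  (Ev.mod (.var hr.n) (.lit (by have := hd.h8; omega))).le (by omega)

theorem epsOne (hr : Regs B w b nr base n) :
    Ev B μ w (eqE (epsE nr) (litE 1)) (ind (n % 2 = 1)) 10 :=
  (Ev.eq hd.one_le (hd.eps hr) (.lit hd.one_le)).le (by omega)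

theorem cut (hr : Regs B w b nr base n) {m : Code} {x c : ℕ} (hm : Ev B μ w m x c)
    (hx : x ≤ n / 2) : Ev B μ w (cutE nr m) (cut (n % 2) x) (c + 20) := by
  have h8 := hd.h8
  have hn := hd.hn
  have hmod := Nat.mod_lt n (show 0 < 2 by norm_num)
  refine (Ev.letE (v := ChainGame.cut (n % 2) x) (c := 14) hm fun w' hw r hr' => ?_).le (by omega)
  by_cases h0 : x = 0
  · exact (Ev.ite_neg (.var hr') h0 (.lit (Nat.zero_le _))).conv (by simp [h0]) (by omega)
  · refine (Ev.ite_pos (.var hr') h0 (.add (.mul (.lit (by omega)) (.var hr') (by omega))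
      (hd.eps (hr.ext hw)) (by omega))).conv (cut_of_ne h0).symm (by omega)

theorem par (hr : Regs B w b nr base n) {z : ℕ} {i : Fin n} (hz : Var B w z i) :
    Ev B μ w (parE b nr z) (ind (D i % 2 = n % 2)) 25 := by
  have h8 := hd.h8
  exact (Ev.eq hd.one_le (.mod (hd.depE hr hz) (.lit (by omega))) (hd.eps hr)).le (by omega)

theorem mdig (hr : Regs B w b nr base n) {s x : ℕ} (hs : Var B w s x) :
    FEv B μ w (mdigE b s) (mdigit L x) 30 := by
  intro w' hw r j hj
  have h8 := hd.h8
  have hn := hd.hn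
  have hl := hd.len_le j
  have hr := hr.ext hw
  exact (Ev.mod (.div (.var (hs.ext hw)) (hd.wtE hr hj))
    (.add (.div (hd.lenE hr hj) (.lit (by omega))) (.lit (by omega)) (by omega))).le (by omega)

theorem qdig (hr : Regs B w b nr base n) {s x : ℕ} (hs : Var B w s x) :
    FEv B μ w (qdigE b nr s) (qdigit L x) 30 := by
  intro w' hw r j hj
  have h8 := hd.h8
  have hn := hd.hn
  have hl := hd.len_le j
  have hr := hr.ext hw
  exact (Ev.mod (.div (.var (hs.ext hw)) (hd.wtE' hr hj))
    (.add (hd.lenE hr hj) (.lit (by omega)) (by omega))).le (by omega)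

theorem adjacent (hr : Regs B w b nr base n) {x i z : ℕ} {j : Fin n} (hi : i ≤ n) (hx : Var B w x i)
    (hz : Var B w z j) : Ev B μ w (adjE b nr x z) (ind (Ad i j)) 16 := by
  have hnn := hd.hnn
  have hj := j.2
  have h1 : i * n ≤ n * n := Nat.mul_le_mul_right n hi
  have h2 : (n + 1) * (n + 1) = n * n + 2 * n + 1 := by ring
  exact (Ev.arr hd.h8 hr.b (hd.adj i hi j)
    (.add (.mul (.var hx) (.var hr.n) (by omega)) (.var hz) (by omega))).le (by omega)

end Data

end

end RAM

/-! ### Values and costs of the conditions in the recurrence. -/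

namespace RAM

open ChainGame

namespace Ev

variable {B : ℕ} {μ : ℕ → ℕ} {w : World} {a b : Code} {P Q : Prop} {ca cb : ℕ}

theorem and' (ha : Ev B μ w a (ind P) ca) (hb : P → Ev B μ w b (ind Q) cb) :
    Ev B μ w (andE a b) (ind (P ∧ Q)) (ca + cb + 2) :=
  (and ha hb).le (by have := Nat.mul_le_mul_right cb (ind_le_one P); omega)

theorem imp' (h1 : 1 ≤ B) (ha : Ev B μ w a (ind P) ca) (hb : P → Ev B μ w b (ind Q) cb) :
    Ev B μ w (impE a b) (ind (P → Q)) (ca + cb + 2) :=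
  (imp h1 ha hb).le (by have := Nat.mul_le_mul_right cb (ind_le_one P); omega)

end Ev

/-- This turns the indicator costs of lazy connectives into the number of indices at which the
branch is taken. -/
theorem sum_ind_mul_le {n r : ℕ} {p : Fin n → Prop} [DecidablePred p]
    (h : (Finset.univ.filter p).card ≤ r) (c : ℕ) : ∑ k, ind (p k) * c ≤ r * c := by
  rw [← Finset.sum_mul]
  refine Nat.mul_le_mul_right c (le_trans (le_of_eq ?_) h)
  rw [Finset.card_filter]
  refine Finset.sum_congr rfl fun k _ => ?_
  by_cases hk : p k <;> simp [ind, hk]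

namespace Data

variable {B : ℕ} {μ : ℕ → ℕ} {base n : ℕ} {D : Fin n → ℕ} {R : Fin n → Fin n} {L : Fin n → ℕ}
  {Ad : ℕ → Fin n → Prop} {w w' : World} {b nr : ℕ} {q m row : ℕ → Code} {f g : Fin n → ℕ}
  {S : Set (Fin n × ℕ)}

variable (hd : Data B μ base D R L Ad) (hr : Regs B w b nr base n)

include hd hr

theorem valid (hb : Bdd L f g) (hq : FEv B μ w q f 60) (hm : FEv B μ w m g 60) :
    Ev B μ w (validE nr q m) (ind (Valid (n % 2) f g)) (400 * (n + 1) * (n + 1)) := by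
  have h1 := hd.one_le
  refine (Ev.and' (Ev.allFin (cost := fun _ => 145) (p := fun j => ¬ f j < ChainGame.cut (n % 2) (g j))
      h1 (.var hr.n) fun j w' hw i hi =>
      (Ev.not h1 (Ev.lt h1 (hq w' hw i j hi) (hd.cut (hr.ext hw) (hm w' hw i j hi)
        ((hb.2 j).trans (Nat.div_le_div_right (hd.len_le j)))))).le (by omega))
    fun _ => Ev.imp' h1 (hd.epsOne hr) fun _ =>
    Ev.allFin (cost := fun _ => 6 + n * 157) (p := fun i => ∀ j : Fin n, g i ≠ 0 → g j ≠ 0 → (i : ℕ) = j)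
      h1 (.var hr.n) fun i w' hw ri hi =>
    (Ev.allFin (cost := fun _ => 147) (p := fun j => g i ≠ 0 → g j ≠ 0 → (i : ℕ) = j)
      h1 (.var (hr.ext hw).n) fun j w'' hw' rj hj =>
    (Ev.imp' h1 (Ev.pos h1 (hm w'' (hw.trans hw') ri i (hi.ext hw'))) fun _ =>
      Ev.imp' h1 (Ev.pos h1 (hm w'' (hw.trans hw') rj j hj)) fun _ =>
      (Ev.eq h1 (.var (hi.ext hw')) (.var hj))).le (by omega)).le
      (by simp)).conv (ind_congr ?_) ?_
  · unfold Valid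
    simp only [not_lt, Fin.ext_iff]
  · simp only [Finset.sum_const, Finset.card_univ, Fintype.card_fin, smul_eq_mul]
    ring_nf
    nlinarith

theorem noBad {N : Fin n × ℕ → Fin n × ℕ → Prop}
    (hN : ∀ x z : Fin n, Ad x z ↔ N (R x, D x) (R z, D z)) (hb : Bdd L f g)
    (hq : FEv B μ w q f 60) (hm : FEv B μ w m g 60) :
    Ev B μ w (noBadE b nr q m) (ind (NoBadEdge N (n % 2) f g)) (600 * (n + 1) * (n + 1)) := by
  have h1 := hd.one_le
  -- Quantifiers over remaining elements become loops over vertices, because each remaining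
  -- coordinate is that of a vertex.
  have hroot : ∀ j i, i < f j → ∃ z, R z = j ∧ D z = i := by
    intro j i hi
    obtain ⟨z, hz⟩ := (hd.lt_iff j i).1 (hi.trans_le (hb.1 j))
    exact ⟨z, congrArg Prod.fst hz, congrArg Prod.snd hz⟩
  refine (Ev.allFin (cost := fun _ => 400 + n * 200) h1 (.var hr.n) fun u w' hw ru hu =>
    (Ev.letE (c := 380 + n * 200) (hd.rootE (hr.ext hw) hu) fun w₁ hw₁ rj hj =>
    (Ev.imp' h1 (Ev.and' (Ev.pos h1 (hm w₁ (hw.trans hw₁) rj _ hj)) fun _ =>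
      Ev.and' (Ev.eq h1 (hq w₁ (hw.trans hw₁) rj _ hj) (hd.cut (hr.ext (hw.trans hw₁))
        (hm w₁ (hw.trans hw₁) rj _ hj) ((hb.2 _).trans (Nat.div_le_div_right (hd.len_le _))))) fun _ =>
      Ev.and' (Ev.lt h1 (hd.depE (hr.ext (hw.trans hw₁)) (hu.ext hw₁)) (hq w₁ (hw.trans hw₁) rj _ hj))
        fun _ => Ev.not h1 (hd.par (hr.ext (hw.trans hw₁)) (hu.ext hw₁))) fun _ =>
    (Ev.allFin (cost := fun _ => 180) h1 (.var (hr.ext (hw.trans hw₁)).n) fun v w₂ hw₂ rv hv =>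
    (Ev.imp' h1 (hd.adjacent (hr.ext (hw.trans (hw₁.trans hw₂))) u.2.le (hu.ext (hw₁.trans hw₂)) hv)
      fun _ => Ev.letE (hd.rootE (hr.ext (hw.trans (hw₁.trans hw₂))) hv) fun w₃ hw₃ rl hl =>
      Ev.imp' h1 (Ev.lt h1 (hd.depE (hr.ext (hw.trans (hw₁.trans (hw₂.trans hw₃)))) (hv.ext hw₃))
        (hq w₃ (hw.trans (hw₁.trans (hw₂.trans hw₃))) rl _ hl)) fun _ =>
      Ev.and' (hd.par (hr.ext (hw.trans (hw₁.trans (hw₂.trans hw₃)))) (hv.ext hw₃)) fun _ =>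
      Ev.imp' h1 (hd.epsOne (hr.ext (hw.trans (hw₁.trans (hw₂.trans hw₃))))) fun _ =>
      Ev.eq h1 (.var hl) (.var (hj.ext (hw₂.trans hw₃)))).le (by omega)).le
        (show _ ≤ 6 + n * 190 by simp)).le (by omega)).le (by omega)).conv (ind_congr ?_) ?_
  · unfold NoBadEdge
    constructor
    · rintro h j a v hj hqj ha hae hNv hv
      obtain ⟨u, rfl, rfl⟩ := hroot j a ha
      obtain ⟨z, hz1, hz2⟩ := hroot _ _ hv
      obtain rfl : v = (R z, D z) := by rw [hz1, hz2]
      have := h u ⟨hj, hqj, ha, hae⟩ z ((hN _ _).2 hNv) hv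
      exact ⟨this.1, fun he => Fin.ext (this.2 he)⟩
    · rintro h u ⟨hj, hqj, ha, hae⟩ v hv hlt
      have := h _ _ _ hj hqj ha hae ((hN _ _).1 hv) hlt
      exact ⟨this.1, fun he => congrArg Fin.val (this.2 he)⟩
  · simp only [Finset.sum_const, Finset.card_univ, Fintype.card_fin, smul_eq_mul]
    ring_nf
    nlinarith

theorem harmless (hb : ∀ j, f j ≤ L j) (hq : FEv B μ w q f 60) (hS : REv B μ w D R row S 60) :
    Ev B μ w (harmlessE b nr q row) (ind (Harmless (n % 2) f S)) (300 * (n + 1)) := by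
  have h1 := hd.one_le
  have hn := hd.hn
  refine (Ev.allFin (cost := fun _ => 280) h1 (.var hr.n) fun z w' hw rz hz =>
    (Ev.imp' h1 (hS w' hw rz z hz) fun _ =>
    Ev.letE (hd.rootE (hr.ext hw) hz) fun w₁ hw₁ rl hl =>
    have hw := hw.trans hw₁
    Ev.imp' h1 (Ev.lt h1 (hd.depE (hr.ext hw) (hz.ext hw₁)) (hq w₁ hw rl _ hl)) fun _ =>
    Ev.and' (hd.par (hr.ext hw) (hz.ext hw₁)) fun _ =>
    Ev.not h1 (Ev.eq h1 (Ev.add (hd.depE (hr.ext hw) (hz.ext hw₁)) (.lit h1)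
      (by have := hd.depth_lt z; omega)) (hq w₁ hw rl _ hl))).le (by omega)).conv (ind_congr ?_) ?_
  · unfold Harmless
    constructor
    · rintro h ⟨j, i⟩ hv hi
      obtain ⟨z, hz⟩ := (hd.lt_iff j i).1 (lt_of_lt_of_le hi (hb j))
      rw [← hz] at hv hi ⊢
      exact h z hv hi
    · exact fun h z hz hlt => h _ hz hlt
  · simp only [Finset.sum_const, Finset.card_univ, Fintype.card_fin, smul_eq_mul]
    ring_nf
    omega

open Classical in
theorem raise_ev (hb : ∀ j, f j ≤ L j) (hq : FEv B μ w q f 60) (hm : FEv B μ w m g 60)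
    (hS : REv B μ w D R row S 60) :
    FEv B μ w (raiseE b nr q row m) (raise (n % 2) f S g) (400 * (n + 1)) := by
  intro w' hw rj j hj
  have h1 := hd.one_le
  have h8 := hd.h8
  have hn := hd.hn
  -- The running maximum over the first `k` vertices; at `n` it is the supremum over depths that
  -- defines `raise`.
  set acc : ℕ → ℕ := fun k => Nat.rec (g j) (fun k a => if h : k < n then
    (if (R ⟨k, h⟩, D ⟨k, h⟩) ∈ S ∧ R ⟨k, h⟩ = j ∧ D ⟨k, h⟩ < f j then
      max a ((D ⟨k, h⟩ - n % 2) / 2 + 1) else a) else a) k with hacc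
  have hsucc : ∀ z : Fin n, acc (z + 1) = if (R z, D z) ∈ S ∧ R z = j ∧ D z < f j then
      max (acc z) ((D z - n % 2) / 2 + 1) else acc z := by
    intro z
    simp [hacc]
  have hval : acc n = raise (n % 2) f S g j := by
    have key : ∀ k ≤ n, g j ≤ acc k ∧ acc k ≤ raise (n % 2) f S g j ∧
        ∀ z : Fin n, (z : ℕ) < k → (R z, D z) ∈ S → R z = j → D z < f j →
          (D z - n % 2) / 2 + 1 ≤ acc k := by
      intro k
      induction k with
      | zero => exact fun _ => ⟨le_rfl, le_raise j, fun z hz => absurd hz (by omega)⟩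
      | succ k ih =>
        intro hk
        obtain ⟨i1, i2, i3⟩ := ih (by omega)
        have := hsucc ⟨k, hk⟩
        rw [this]
        have hmono : acc k ≤ acc (k + 1) := by
          rw [this]; split_ifs
          · exact le_max_left _ _
          · exact le_rfl
        rw [this] at hmono
        refine ⟨i1.trans hmono, ?_, fun z hz hzS hzj hzf => ?_⟩
        · split_ifs with hc
          · refine max_le i2 (need_le_raise ?_ hc.2.2)
            rw [← hc.2.1]; exact hc.1
          · exact i2
        · rcases (show (z : ℕ) < k ∨ (z : ℕ) = k by omega) with h | h
          · exact (i3 z h hzS hzj hzf).trans hmono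
          · obtain rfl : z = ⟨k, hk⟩ := Fin.ext h
            rw [if_pos ⟨hzS, hzj, hzf⟩]
            exact le_max_right _ _
    obtain ⟨k1, k2, k3⟩ := key n le_rfl
    refine le_antisymm k2 ?_
    rcases raise_cases (n % 2) f S g j with h | ⟨i, hi, hif, h⟩
    · rw [h]; exact k1
    · obtain ⟨z, hz⟩ := (hd.lt_iff j i).1 (hif.trans_le (hb j))
      have e1 : R z = j := congrArg Prod.fst hz
      have e2 : D z = i := congrArg Prod.snd hz
      rw [h, ← e2]
      exact k3 z z.2 (by rw [hz]; exact hi) e1 (e2 ▸ hif)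
  rw [← hval]
  refine (Ev.fold (acc := acc) (cost := fun _ => 300) h1 (.var (hr.ext hw).n)
    (show Ev B μ w' (m rj) (acc 0) 60 from hm w' hw rj j hj)
    fun k hk hak w₁ hw₁ ra rz ha hz => ?_).le (by simp; ring_nf; omega)
  have hw2 := hw.trans hw₁
  have hr1 := hr.ext hw2
  have hz' : Var B w₁ rz (⟨k, hk⟩ : Fin n) := hz
  have hD := hd.depth_lt ⟨k, hk⟩
  have hcond := Ev.and' (hS w₁ hw2 rz ⟨k, hk⟩ hz') fun _ =>
    Ev.and' (Ev.eq h1 (hd.rootE hr1 hz') (.var (hj.ext hw₁))) fun _ =>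
    Ev.lt h1 (hd.depE hr1 hz') (hq w₁ hw2 rj j (hj.ext hw₁))
  have e := hsucc ⟨k, hk⟩
  by_cases hc : (R ⟨k, hk⟩, D ⟨k, hk⟩) ∈ S ∧ R ⟨k, hk⟩ = j ∧ D ⟨k, hk⟩ < f j
  · rw [if_pos hc] at e
    rw [show acc (k + 1) = _ from e]
    refine (Ev.ite_pos hcond (ind_ne_zero.2 ⟨hc.1, congrArg Fin.val hc.2.1, hc.2.2⟩)
      (Ev.letE (c := 20) (Ev.add (Ev.div (Ev.sub (hd.depE hr1 hz') (hd.eps hr1)) (.lit (by omega)))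
        (.lit h1) (by omega)) fun w₂ hw₂ rt ht => ?_)).le (by omega)
    have hlt := Ev.lt h1 (.var (μ := μ) (ha.ext hw₂)) (.var ht)
    by_cases hlt' : acc k < (D ⟨k, hk⟩ - n % 2) / 2 + 1
    · exact (Ev.ite_pos hlt (ind_ne_zero.2 hlt') (.var ht)).conv (max_eq_right hlt'.le).symm
        (by omega)
    · exact (Ev.ite_neg hlt (ind_false hlt') (.var (ha.ext hw₂))).conv
        (max_eq_left (not_lt.1 hlt')).symm (by omega)
  · rw [if_neg hc] at e
    rw [show acc (k + 1) = _ from e]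
    refine (Ev.ite_neg hcond (ind_false fun h => hc ⟨h.1, Fin.ext h.2.1, h.2.2⟩) (.var ha)).le
      (by omega)

theorem code_ev {c c' : ℕ} (hb : Bdd L f g) (hq : FEv B μ w q f c) (hm : FEv B μ w m g c') :
    Ev B μ w (codeE b nr q m) (code L f g) (6 + n * (c + c' + 35)) := by
  have h1 := hd.one_le
  have hlt : code L f g ≤ B := hb.code_lt.le.trans (hd.wt (n + n) le_rfl).2.2
  rw [code_eq_sum] at hlt ⊢
  have hterm : ∀ j : Fin n, g j * weight (radix L) j + f j * weight (radix L) (n + j) ≤ B :=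
    fun j => (Finset.single_le_sum
      (f := fun j : Fin n => g j * weight (radix L) j + f j * weight (radix L) (n + j))
      (fun _ _ => Nat.zero_le _) (Finset.mem_univ j)).trans hlt
  refine (Ev.sumFin (cost := fun _ => c + c' + 26) h1 (.var hr.n) hlt fun j w' hw i hi => ?_).le
    (by simp)
  have := hterm j
  exact (Ev.add (Ev.mul (hm w' hw i j hi) (hd.wtE (hr.ext hw) hi) (by omega))
    (Ev.mul (hq w' hw i j hi) (hd.wtE' (hr.ext hw) hi) (by omega)) this).le (by omega)

end Data

theorem bdd_raise {n ε : ℕ} {L f g : Fin n → ℕ} {S : Set (Fin n × ℕ)} (hb : Bdd L f g)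
    (hS : Harmless ε f S) : Bdd L f (raise ε f S g) := by
  refine ⟨hb.1, fun j => ?_⟩
  rcases raise_cases ε f S g j with h | ⟨i, hi, hif, h⟩
  · rw [h]; exact hb.2 j
  · have h1 := (hS _ hi hif).2
    have h2 := hb.1 j
    simp only at h1 hif
    omega

end RAM

/-! ### The cost of one entry of the table. -/

namespace RAM

open ChainGame

namespace Data

variable {B : ℕ} {μ : ℕ → ℕ} {base n : ℕ} {D : Fin n → ℕ} {R : Fin n → Fin n} {L : Fin n → ℕ}
  {Ad : ℕ → Fin n → Prop} {w w' : World} {b nr r : ℕ} {q m row : ℕ → Code} {f g : Fin n → ℕ}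
  {S : Set (Fin n × ℕ)} {N : Fin n × ℕ → Fin n × ℕ → Prop} {s : ℕ}

theorem card_pos_le (hL : (Finset.univ.filter fun j => 0 < L j).card ≤ r) (hb : ∀ j, f j ≤ L j) :
    (Finset.univ.filter fun j => f j ≠ 0).card ≤ r :=
  (Finset.card_le_card fun j hj => by
    have := hb j
    simp only [Finset.mem_filter, Finset.mem_univ, true_and] at hj ⊢
    omega).trans hL

variable (hd : Data B μ base D R L Ad) (hr : Regs B w b nr base n)
  (ht : ∀ k < s, Cell B μ base 6 k (ind (table N (n % 2) L k)))

include hd hr ht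

/-- The table is consulted only after the row has passed the test; a harmless row keeps the raised
entries within bounds (`bdd_raise`), so that the position has a number. -/
theorem safe (hb : Bdd L f g) (hs : ∀ g', Bdd L f g' → code L f g' < s)
    (hq : FEv B μ w q f 60) (hm : FEv B μ w m g 60) (hS : REv B μ w D R row S 60) :
    Ev B μ w (safeE b nr q m row) (ind (Safe (SurvivesBelow N (n % 2) L s) (n % 2) f g S))
      (1000 * (n + 1) * (n + 1)) := by
  have hrs := hd.raise_ev hr hb.1 hq hm hS
  refine (Ev.and' (Q := SurvivesBelow N (n % 2) L s f (raise (n % 2) f S g))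
    (cb := 6 + n * (60 + 400 * (n + 1) + 35) + 8) (hd.harmless hr hb.1 hq hS) fun hh => ?_).le ?_
  · have hbr := bdd_raise hb hh
    refine (Ev.arr hd.h8 hr.b (ht _ (hs _ hbr)) (hd.code_ev hr hbr hq hrs)).conv (ind_congr ?_) le_rfl
    exact ⟨fun h => ⟨hs _ hbr, hbr, h⟩, fun h => h.2.2⟩
  · ring_nf
    nlinarith

/-- The loop runs over all vertices as possible chains, but at most `r` of them are nonempty and pay
for `safe`. -/
theorem answer (hL : (Finset.univ.filter fun j => 0 < L j).card ≤ r) (hb : Bdd L f g)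
    (hs : ∀ l, 0 < f l → ∀ g', Bdd L (dec f l) g' → code L (dec f l) g' < s)
    (hq : FEv B μ w q f 50) (hm : FEv B μ w m g 60) (hS : REv B μ w D R row S 60) :
    Ev B μ w (answerE b nr q m row) (ind (Answer (SurvivesBelow N (n % 2) L s) (n % 2) f g S))
      (160 * (n + 1) + r * (1000 * (n + 1) * (n + 1))) := by
  have h1 := hd.one_le
  refine (Ev.or h1 (Ev.allFin (p := fun j => f j = 0) (cost := fun _ => 56) h1 (.var hr.n)
    fun j w' hw i hi => (Ev.eq h1 (hq w' hw i j hi) (.lit (Nat.zero_le _))).le (by omega)) fun _ =>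
    Ev.anyFin (p := fun l => 0 < f l ∧ Safe (SurvivesBelow N (n % 2) L s) (n % 2) (dec f l) g S)
      (cost := fun l => 56 + ind (f l ≠ 0) * (1000 * (n + 1) * (n + 1))) h1 (.var hr.n)
      fun l w' hw i hi => ?_).le ?_
  · refine (Ev.and (Ev.pos h1 (hq w' hw i l hi)) fun hl => hd.safe (hr.ext hw) ht
      ⟨fun j => (dec_le _ _ _).trans (hb.1 j), hb.2⟩ (hs l (Nat.pos_of_ne_zero hl))
      ((hq.ext hw).dec h1 hi) (hm.ext hw) (hS.ext hw)).conv (ind_congr ?_) (by omega)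
    rw [Nat.pos_iff_ne_zero]
  · have := sum_ind_mul_le (card_pos_le hL hb.1) (1000 * (n + 1) * (n + 1))
    simp only [Finset.sum_add_distrib, Finset.sum_const, Finset.card_univ, Fintype.card_fin,
      smul_eq_mul]
    omega

theorem step (hL : (Finset.univ.filter fun j => 0 < L j).card ≤ r)
    (hN : ∀ x z : Fin n, Ad x z ↔ N (R x, D x) (R z, D z)) (hb : Bdd L f g)
    (hs : s = code L f g) (hq : FEv B μ w q f 30) (hm : FEv B μ w m g 30) :
    Ev B μ w (stepE b nr q m) (ind (Step N (SurvivesBelow N (n % 2) L s) (n % 2) f g))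
      (1200 * (n + 1) * (n + 1) + r * (160 * (n + 1) + r * (1000 * (n + 1) * (n + 1)) + 100)) := by
  have h1 := hd.one_le
  have hn := hd.hn
  have hroot : ∀ j i, i < f j → ∃ z, R z = j ∧ D z = i := by
    intro j i hi
    obtain ⟨z, hz⟩ := (hd.lt_iff j i).1 (hi.trans_le (hb.1 j))
    exact ⟨z, congrArg Prod.fst hz, congrArg Prod.snd hz⟩
  -- Maker's moves are found by a loop over vertices. The available ones are told apart by their
  -- chains, so at most `r` of them pay for `answer`.
  have hcard : (Finset.univ.filter fun x => D x + 1 = f (R x)).card ≤ r := by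
    refine le_trans ?_ (card_pos_le hL hb.1)
    refine Finset.card_le_card_of_injOn R (fun x hx => ?_) fun x hx y hy hxy => ?_
    · simp only [Finset.coe_filter, Finset.mem_univ, true_and, Set.mem_ofPred_eq] at hx ⊢
      omega
    · simp only [Finset.coe_filter, Finset.mem_univ, true_and, Set.mem_ofPred_eq] at hx hy
      refine hd.inj _ _ hxy ?_
      rw [← hxy] at hy
      omega
  set A := 160 * (n + 1) + r * (1000 * (n + 1) * (n + 1)) with hA
  have hQ := hd.valid hr hb (hq.le (by norm_num)) (hm.le (by norm_num))
  have hbad := hd.noBad hr hN hb (hq.le (by norm_num)) (hm.le (by norm_num))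
  set t := SurvivesBelow N (n % 2) L s with ht'
  refine (Ev.and' hQ fun hval => Ev.and' hbad fun _ => Ev.allFin
    (p := fun x => D x + 1 = f (R x) →
      if ChainGame.cut (n % 2) (g (R x)) < f (R x) then
        Answer t (n % 2) (dec f (R x)) g {v | N (R x, D x) v}
      else n % 2 = 1 → Answer t (n % 2) (Function.update f (R x) 0) (Function.update g (R x) 0) ∅)
    (cost := fun x => 80 + ind (D x + 1 = f (R x)) * (A + 100)) h1 (.var hr.n)
    fun x w₁ hw₁ rx hx => (Ev.letE (c := 60 + ind (D x + 1 = f (R x)) * (A + 100))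
      (hd.rootE (hr.ext hw₁) hx) fun w₂ hw₂ rk hk => ?_).le (by omega)).conv (ind_congr ?_) ?_
  · have hw := hw₁.trans hw₂
    have hr2 := hr.ext hw
    refine (Ev.imp (cb := A + 100) h1 (Ev.eq h1 (Ev.add (hd.depE hr2 (hx.ext hw₂)) (.lit h1)
      (by have := hd.depth_lt x; omega)) (hq w₂ hw rk _ hk)) fun hdx => ?_).le
      (show _ ≤ _ by omega)
    have hlt := Ev.lt h1 (hd.cut hr2 (hm w₂ hw rk _ hk)
      ((hb.2 _).trans (Nat.div_le_div_right (hd.len_le _)))) (hq w₂ hw rk _ hk)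
    by_cases hc : ChainGame.cut (n % 2) (g (R x)) < f (R x)
    · rw [if_pos hc]
      refine (Ev.ite_pos hlt (ind_ne_zero.2 hc) (hd.answer hr2 ht hL
        ⟨fun j => (dec_le _ _ _).trans (hb.1 j), hb.2⟩ (fun l hl g' hb' => ?_)
        (((hq.ext hw).dec h1 hk).le (by norm_num)) ((hm.ext hw).le (by norm_num))
        fun w₃ hw₃ rz z hz => ?_)).le (by omega)
      · rw [hs]
        exact dec_code_lt (fun j => dec_le _ _ _) hl hb'
      · exact ((hd.adjacent (hr2.ext hw₃) x.2.le (hx.ext (hw₂.trans hw₃)) hz).conv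
          (ind_congr (hN x z)) (by norm_num))
    · rw [if_neg hc]
      refine (Ev.ite_neg hlt (ind_false hc) (Ev.imp' h1 (hd.epsOne hr2) fun _ =>
        hd.answer hr2 ht hL ⟨fun j => ?_, fun j => ?_⟩ (fun l hl g' hb' => ?_)
        (((hq.ext hw).zero h1 hk).le (by norm_num)) (((hm.ext hw).zero h1 hk).le (by norm_num))
        fun w₃ hw₃ rz z hz => ?_)).le (by omega)
      · by_cases h : j = R x
        · subst h; simp
        · simpa [h] using hb.1 j
      · by_cases h : j = R x
        · subst h; simp
        · simpa [h] using hb.2 j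
      · rw [hs]
        refine dec_code_lt (fun j => ?_) hl hb'
        by_cases h : j = R x
        · subst h; simp
        · simp [h]
      · exact (Ev.lit (Nat.zero_le _)).conv (ind_false (by simp)).symm (by norm_num)
  · unfold Step
    refine and_congr_right fun hval => and_congr_right fun _ => ⟨fun h => ⟨fun k hk hc => ?_,
      fun he k hk hc => ?_⟩, fun h x hx => ?_⟩
    · obtain ⟨x, rfl, hx⟩ := hroot k (f k - 1) (by omega)
      have := h x (by omega)
      rwa [if_pos hc, hx] at this
    · obtain ⟨x, rfl, hx⟩ := hroot k (f k - 1) (by omega)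
      have := h x (by omega)
      rw [if_neg (by omega)] at this
      exact this he
    · have e : f (R x) - 1 = D x := by omega
      split_ifs with hc
      · have := h.1 (R x) (by omega) hc
        rwa [e] at this
      · exact fun he => h.2 he (R x) (by omega) (le_antisymm (not_lt.1 hc) (hval.1 _))
  · have := sum_ind_mul_le hcard (A + 100)
    simp only [Finset.sum_add_distrib, Finset.sum_const, Finset.card_univ, Fintype.card_fin,
      smul_eq_mul]
    have h2 : (n + 1) * (n + 1) = n * n + 2 * n + 1 := by ring
    rw [mul_assoc, mul_assoc, mul_assoc, h2]
    omega

/-- The entry of the table for the position `s`. -/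
theorem table_ev (hL : (Finset.univ.filter fun j => 0 < L j).card ≤ r)
    (hN : ∀ x z : Fin n, Ad x z ↔ N (R x, D x) (R z, D z))
    {x : ℕ} (hx : Var B w x s) (hs : s = code L (qdigit L s) (mdigit L s)) :
    Ev B μ w (stepE b nr (qdigE b nr x) (mdigE b x)) (ind (table N (n % 2) L s))
      (1200 * (n + 1) * (n + 1) + r * (160 * (n + 1) + r * (1000 * (n + 1) * (n + 1)) + 100)) :=
  (hd.step hr ht hL hN (bdd_digit L s) hs (hd.qdig hr hx) (hd.mdig hr hx)).conv
    (ind_congr (table_iff s).symm) le_rfl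

end Data

end RAM

/-! ### Filling the arrays from the input. -/

namespace RAM

open ChainGame

/-- The memory `μ` after `f i` has been stored in the cell `i` of the array `a`, for `i < k`. -/
def fillMem (base a : ℕ) (f μ : ℕ → ℕ) : ℕ → ℕ → ℕ
  | 0 => μ
  | k + 1 => Function.update (fillMem base a f μ k) (base + 8 * k + a) (f k)

theorem fillMem_of_ne {base a : ℕ} {f μ : ℕ → ℕ} {x : ℕ} :
    ∀ k, (∀ i < k, x ≠ base + 8 * i + a) → fillMem base a f μ k x = μ x
  | 0, _ => rfl
  | k + 1, h => by
    rw [fillMem, Function.update_of_ne (h k (by omega))]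
    exact fillMem_of_ne k fun i hi => h i (by omega)

theorem fillMem_cell {base a i : ℕ} (f μ : ℕ → ℕ) {k : ℕ} (hi : i < k) :
    fillMem base a f μ k (base + 8 * i + a) = f i := by
  induction k with
  | zero => omega
  | succ k ih =>
    rcases (show i = k ∨ i < k by omega) with rfl | h
    · simp [fillMem]
    · rw [fillMem, Function.update_of_ne (by omega), ih h]

theorem fillMem_input {base a x : ℕ} (f μ : ℕ → ℕ) (k : ℕ) (hx : x < base) :
    fillMem base a f μ k x = μ x := fillMem_of_ne k fun i _ => by omega

/-- Addresses of different arrays differ modulo 8, so the arrays never collide, whatever their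
lengths. -/
theorem Cell.fill {B base a a' i v : ℕ} {μ f : ℕ → ℕ} (h : Cell B μ base a i v) (k : ℕ)
    (ha : a < 8) (ha' : a' < 8) (hne : a ≠ a') : Cell B (fillMem base a' f μ k) base a i v :=
  ⟨h.1, (fillMem_of_ne k fun i _ => by omega).trans h.2.1, h.2.2⟩

/-- Stores the value of `val i` in the cell `i` of the array `a`, for `i < N`. -/
def fillE (b a : ℕ) (N : Code) (val : ℕ → Code) : Code := tabE N (fun i => addrE b a (varE i)) val

section

variable {B : ℕ} {μ : ℕ → ℕ} {w : World} {b base a n cN c : ℕ} {N : Code} {val : ℕ → Code}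

theorem St.fill {f : ℕ → ℕ} (h8 : 8 ≤ B) (ha : a < 8) (hb : Var B w b base) (hB : base + 8 * n ≤ B)
    (hN : Ev B μ w N n cN)
    (hval : ∀ k < n, ∀ w' ≥ w, ∀ i, Var B w' i k → Ev B (fillMem base a f μ k) w' (val i) (f k) c) :
    St B μ w (fillE b a N val) (fillMem base a f μ n) (cN + 3 + n * (c + 14)) := by
  refine (St.tab (M := fillMem base a f μ) (ca := fun _ => 9) (cv := fun _ => c) (by omega) hN
    (fun k hk w' hw i hi => ?_) hval fun k _ => rfl).le (by simp; ring_nf; omega)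
  exact (Ev.addr (hb.ext hw) (.var hi) (by omega) h8).le (by omega)

theorem St.fillFin {f : Fin n → ℕ} (h8 : 8 ≤ B) (ha : a < 8) (hb : Var B w b base)
    (hB : base + 8 * n ≤ B) (hN : Ev B μ w N n cN)
    (hval : ∀ k : Fin n, ∀ w' ≥ w, ∀ i, Var B w' i k →
      Ev B (fillMem base a (extend f) μ k) w' (val i) (f k) c) :
    St B μ w (fillE b a N val) (fillMem base a (extend f) μ n) (cN + 3 + n * (c + 14)) :=
  St.fill h8 ha hb hB hN fun k hk w' hw i hi => by
    simpa [extend, hk] using hval ⟨k, hk⟩ w' hw i hi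

theorem cell_fill {f : ℕ → ℕ} {i k : ℕ} (ha : a < 8) (hB : base + 8 * k ≤ B) (hi : i < k)
    (hf : f i ≤ B) : Cell B (fillMem base a f μ k) base a i (f i) :=
  ⟨by omega, fillMem_cell _ _ hi, hf⟩

theorem cell_fillFin {f : Fin n → ℕ} (ha : a < 8) (hB : base + 8 * n ≤ B) (i : Fin n)
    (hf : f i ≤ B) : Cell B (fillMem base a (extend f) μ n) base a i (f i) := by
  have := cell_fill (μ := μ) (f := extend f) ha hB i.2 (by simpa using hf)
  simpa using this

end

/-- The position of the winning set `t` in the input. -/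
def setPos (n : ℕ) (Ls : List (List ℕ)) (t : ℕ) : ℕ :=
  2 + n * n + ((Ls.take t).map fun l => l.length + 1).sum

theorem setPos_succ (n : ℕ) (Ls : List (List ℕ)) {t : ℕ} (ht : t < Ls.length) :
    setPos n Ls (t + 1) = setPos n Ls t + 1 + Ls[t].length := by
  unfold setPos
  rw [List.take_add_one, List.getElem?_eq_getElem ht, List.map_append, List.sum_append]
  simp only [Option.toList, List.map_cons, List.map_nil, List.sum_cons, List.sum_nil]
  omega

theorem setPos_le (n : ℕ) {Ls : List (List ℕ)} (h2 : ∀ l ∈ Ls, l.length ≤ 2) {t : ℕ}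
    (ht : t ≤ Ls.length) : setPos n Ls t ≤ 2 + n * n + 3 * t := by
  induction t with
  | zero => simp [setPos]
  | succ t ih =>
    rw [setPos_succ n Ls (by omega)]
    have := h2 _ (List.getElem_mem (show t < Ls.length by omega))
    have := ih (by omega)
    omega

/-- The first cells of the memory hold the input. -/
structure Input (B : ℕ) (μ : ℕ → ℕ) {n : ℕ} (le : Fin n → Fin n → Prop) (Ls : List (List ℕ)) :
    Prop where
  vertices : μ 0 = n
  sets : μ 1 = Ls.length
  matrix : ∀ i j : Fin n, μ (2 + i * n + j) = ind (le i j)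
  set : ∀ t (ht : t < Ls.length) s (hs : s < (Ls[t].length :: Ls[t]).length),
    μ (setPos n Ls t + s) = (Ls[t].length :: Ls[t])[s]
  bounded : ∀ x < 2 + n * n + 3 * Ls.length, μ x ≤ B
  size : ∀ l ∈ Ls, l.length ≤ 2

namespace Input

variable {B : ℕ} {μ μ' : ℕ → ℕ} {n : ℕ} {le : Fin n → Fin n → Prop} {Ls : List (List ℕ)}

theorem congr (h : Input B μ le Ls) (hμ : ∀ x < 2 + n * n + 3 * Ls.length, μ' x = μ x) :
    Input B μ' le Ls where
  vertices := (hμ 0 (by omega)).trans h.vertices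
  sets := (hμ 1 (by omega)).trans h.sets
  matrix i j := by
    have h1 := Nat.mul_le_mul_right n (show (i : ℕ) + 1 ≤ n from i.2)
    have h2 := j.2
    rw [Nat.succ_mul] at h1
    exact (hμ _ (by omega)).trans (h.matrix i j)
  set t ht s hs := by
    have h1 := setPos_le n h.size ht
    rw [setPos_succ n Ls ht] at h1
    simp only [List.length_cons] at hs
    exact (hμ _ (by omega)).trans (h.set t ht s hs)
  bounded x hx := (hμ x hx).trans_le (h.bounded x hx)
  size := h.size

theorem fill (h : Input B μ le Ls) (a : ℕ) (f : ℕ → ℕ) (k : ℕ) :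
    Input B (fillMem (2 + n * n + 3 * Ls.length) a f μ k) le Ls :=
  h.congr fun _ hx => fillMem_input _ _ _ hx

end Input

/-- The entry `i, j` of the order matrix. -/
def matE (nr i j : ℕ) : Code :=
  loadE (opE .add (opE .add (litE 2) (opE .mul (varE i) (varE nr))) (varE j))

/-- The end of the input. -/
def baseE (nr mr : ℕ) : Code :=
  opE .add (opE .add (litE 2) (opE .mul (varE nr) (varE nr))) (opE .mul (litE 3) (varE mr))

/-- The position of the winning set `i`. -/
def setPosE (b nr i : ℕ) : Code :=
  iteE (varE i) (letE (arrE b 0 (opE .sub (varE i) (litE 1))) fun p =>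
      opE .add (opE .add (varE p) (litE 1)) (loadE (varE p)))
    (opE .add (litE 2) (opE .mul (varE nr) (varE nr)))

/-- The number of elements above `i`. -/
def depthE (nr i : ℕ) : Code := opE .sub (sumE (varE nr) fun j => matE nr i j) (litE 1)

/-- The largest element of the chain of `i`. -/
def topE (b nr i : ℕ) : Code :=
  sumE (varE nr) fun j => iteE (andE (matE nr i j) (eqE (arrE b 1 (varE j)) (litE 0))) (varE j) (litE 0)

/-- The length of the chain with largest element `i`. -/
def lengthE (b nr i : ℕ) : Code :=
  iteE (arrE b 1 (varE i)) (litE 0) (sumE (varE nr) fun j => matE nr j i)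

/-- The test whether the winning set at the position `p` is `x, z`, or is `z`, and `x` is `n`. -/
def isSetE (nr p x z : ℕ) : Code :=
  orE (andE (eqE (loadE (varE p)) (litE 2))
    (orE (andE (eqE (loadE (opE .add (varE p) (litE 1))) (varE x))
        (eqE (loadE (opE .add (varE p) (litE 2))) (varE z)))
      (andE (eqE (loadE (opE .add (varE p) (litE 1))) (varE z))
        (eqE (loadE (opE .add (varE p) (litE 2))) (varE x)))))
  (andE (eqE (varE x) (varE nr)) (andE (eqE (loadE (varE p)) (litE 1))
    (eqE (loadE (opE .add (varE p) (litE 1))) (varE z))))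

/-- An entry of the matrix of pairs. -/
def pairE (b nr mr i : ℕ) : Code :=
  letE (opE .div (varE i) (varE nr)) fun x => letE (opE .mod (varE i) (varE nr)) fun z =>
    anyE (varE mr) fun t => letE (arrE b 0 (varE t)) fun p => isSetE nr p x z

/-- A weight. -/
def weightE (b nr i : ℕ) : Code :=
  iteE (varE i) (letE (opE .sub (varE i) (litE 1)) fun p => opE .mul (arrE b 5 (varE p))
    (iteE (ltE (varE p) (varE nr)) (opE .add (opE .div (arrE b 3 (varE p)) (litE 2)) (litE 1))
      (opE .add (arrE b 3 (opE .sub (varE p) (varE nr))) (litE 1)))) (litE 1)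

/-- The test whether the set `l` is `x, z`, or is `z`, and `x` is `n`. -/
def IsSet (n : ℕ) (l : List ℕ) (x z : ℕ) : Prop := (l = [x, z] ∨ l = [z, x]) ∨ (x = n ∧ l = [z])

/-- The pairs, and the sets with one element as pairs of `n` and the element. -/
def IsPair (n : ℕ) (Ls : List (List ℕ)) (x z : ℕ) : Prop := ∃ l ∈ Ls, IsSet n l x z

namespace Input

variable {B : ℕ} {μ μ' : ℕ → ℕ} {n : ℕ} {le : Fin n → Fin n → Prop} {Ls : List (List ℕ)} {w : World}
  {b nr mr base : ℕ} (h : Input B μ le Ls) (hB : 2 + n * n + 3 * Ls.length + 8 ≤ B)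

include h hB

theorem mat_ev {ri rj : ℕ} {i j : Fin n} (hr : Var B w nr n) (hi : Var B w ri i)
    (hj : Var B w rj j) : Ev B μ w (matE nr ri rj) (ind (le i j)) 11 := by
  have h1 := Nat.mul_le_mul_right n (show (i : ℕ) + 1 ≤ n from i.2)
  have h2 := j.2
  rw [Nat.succ_mul] at h1
  refine (Ev.load (Ev.add (Ev.add (.lit (by omega)) (Ev.mul (.var hi) (.var hr) (by omega)) (by omega))
    (.var hj) (by omega)) ?_).conv (h.matrix i j) (by omega)
  rw [h.matrix i j]
  exact (ind_le_one _).trans (by omega)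

omit h in
theorem base_ev (hr : Var B w nr n) (hm : Var B w mr Ls.length) :
    Ev B μ w (baseE nr mr) (2 + n * n + 3 * Ls.length) 20 :=
  (Ev.add (Ev.add (.lit (by omega)) (Ev.mul (.var hr) (.var hr) (by omega)) (by omega))
    (Ev.mul (.lit (by omega)) (.var hm) (by omega)) (by omega)).le (by omega)

theorem setPos_ev (hr : Regs B w b nr base n) {t rt : ℕ} (ht : t < Ls.length) (hi : Var B w rt t)
    (hc : t ≠ 0 → Cell B μ base 0 (t - 1) (setPos n Ls (t - 1))) :
    Ev B μ w (setPosE b nr rt) (setPos n Ls t) 40 := by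
  by_cases h0 : t = 0
  · exact (Ev.ite_neg (.var hi) h0 (Ev.add (.lit (by omega)) (Ev.mul (.var hr.n) (.var hr.n) (by omega))
      (by omega))).conv (by simp [h0, setPos]) (by omega)
  · have hp := setPos_le n h.size ht.le
    have hs := setPos_succ n Ls (t := t - 1) (by omega)
    rw [Nat.sub_add_cancel (Nat.pos_of_ne_zero h0)] at hs
    have hv : μ (setPos n Ls (t - 1)) = Ls[t - 1].length := h.set (t - 1) (by omega) 0 (by simp)
    refine (Ev.ite_pos (.var hi) h0 (Ev.letE (c := 10) (Ev.arr (by omega) hr.b (hc h0)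
      (Ev.sub (.var hi) (.lit (by omega)))) fun w' hw r hr' => ?_)).le (by omega)
    refine (Ev.add (Ev.add (.var hr') (.lit (by omega)) (by omega)) (Ev.load (.var hr') ?_) ?_).conv
      ?_ (by omega)
    · rw [hv]; omega
    · rw [hv]; omega
    · rw [hv]; omega

theorem depth_ev {D : Fin n → ℕ} (hD : ∀ z, D z + 1 = ∑ v, ind (le z v)) (hr : Var B w nr n) {i : Fin n}
    {ri : ℕ} (hi : Var B w ri i) : Ev B μ w (depthE nr ri) (D i) (20 + n * 20) := by
  have hDB : D i + 1 ≤ n := by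
    rw [hD i]
    refine (Finset.sum_le_sum fun v _ => ind_le_one _).trans (by simp)
  have hnn := Nat.le_mul_self n
  refine (Ev.sub (Ev.sumFin (cost := fun _ => 11) (by omega) (.var hr) (by rw [← hD i]; omega)
    fun k w' hw rk hk => h.mat_ev hB (hr.ext hw) (hi.ext hw) hk) (.lit (by omega))).conv ?_ ?_
  · rw [← hD i]; rfl
  · simp; omega

theorem top_ev {D : Fin n → ℕ} {R : Fin n → Fin n}
    (hR : ∀ z, (R z : ℕ) = ∑ v : Fin n, ind (le z v ∧ D v = 0) * v) (hr : Regs B w b nr base n)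
    (hc : ∀ i : Fin n, Cell B μ base 1 i (D i)) {i : Fin n} {ri : ℕ} (hi : Var B w ri i) :
    Ev B μ w (topE b nr ri) (R i) (10 + n * 50) := by
  have hnn := Nat.le_mul_self n
  have := (R i).2
  rw [hR i] at this ⊢
  refine (Ev.sumFin (cost := fun _ => 40) (by omega) (.var hr.n) (by omega)
    fun k w' hw rk hk => ?_).le (by simp; omega)
  have hcond := Ev.and' (h.mat_ev hB (hr.ext hw).n (hi.ext hw) hk) fun _ =>
    Ev.eq (by omega) (Ev.arr (by omega) (hr.ext hw).b (hc k) (.var hk)) (.lit (Nat.zero_le B))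
  by_cases hk' : le i k ∧ D k = 0
  · exact (Ev.ite_pos hcond (ind_ne_zero.2 hk') (.var hk)).conv (by rw [ind_true hk', one_mul])
      (by omega)
  · exact (Ev.ite_neg hcond (ind_false hk') (.lit (Nat.zero_le B))).conv
      (by rw [ind_false hk', zero_mul]) (by omega)

theorem length_ev {D L : Fin n → ℕ} (hL : ∀ j, L j = if D j ≠ 0 then 0 else ∑ u, ind (le u j))
    (hr : Regs B w b nr base n)
    (hc : ∀ i : Fin n, Cell B μ base 1 i (D i)) {i : Fin n} {ri : ℕ} (hi : Var B w ri i) :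
    Ev B μ w (lengthE b nr ri) (L i) (20 + n * 20) := by
  have hnn := Nat.le_mul_self n
  have hsum : ∑ u, ind (le u i) ≤ n :=
    (Finset.sum_le_sum fun v _ => ind_le_one _).trans (by simp)
  have hcell := Ev.arr (by omega) hr.b (hc i) (.var hi)
  by_cases h0 : D i = 0
  · refine (Ev.ite_neg hcell h0 (Ev.sumFin (cost := fun _ => 11) (by omega) (.var hr.n) (by omega)
      fun k w' hw rk hk => h.mat_ev hB (hr.ext hw).n hk (hi.ext hw))).conv ?_ ?_
    · rw [hL i, if_neg (by simpa using h0)]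
    · simp; omega
  · exact (Ev.ite_pos hcell h0 (.lit (Nat.zero_le B))).conv (by rw [hL i, if_pos h0]) (by omega)

theorem isSet_ev (hr : Var B w nr n) {t rp x z rx rz : ℕ} (ht : t < Ls.length)
    (hp : Var B w rp (setPos n Ls t)) (hx : Var B w rx x) (hz : Var B w rz z) :
    Ev B μ w (isSetE nr rp rx rz) (ind (IsSet n Ls[t] x z)) 110 := by
  have h1 : 1 ≤ B := by omega
  have hs := setPos_le n h.size ht
  rw [setPos_succ n Ls ht] at hs
  have h0 : μ (setPos n Ls t) = Ls[t].length := h.set t ht 0 (by simp)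
  have hbd := fun x hx => h.bounded x hx
  have e0 := Ev.load (Ev.var (μ := μ) hp) (hbd _ (by omega))
  rw [h0] at e0
  have e1 : (hl : 1 ≤ Ls[t].length) →
      Ev B μ w (loadE (opE .add (varE rp) (litE 1))) Ls[t][0] 5 := fun hl =>
    (Ev.load (Ev.add (Ev.var (μ := μ) hp) (.lit h1) (by omega)) (hbd _ (by omega))).conv
      (h.set t ht 1 (by simp; omega)) (by omega)
  have e2 : (hl : 2 ≤ Ls[t].length) →
      Ev B μ w (loadE (opE .add (varE rp) (litE 2))) Ls[t][1] 5 := fun hl =>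
    (Ev.load (Ev.add (Ev.var (μ := μ) hp) (.lit (by omega)) (by omega)) (hbd _ (by omega))).conv
      (h.set t ht 2 (by simp; omega)) (by omega)
  by_cases hl2 : Ls[t].length = 2
  · obtain ⟨a, c, hac⟩ := List.length_eq_two.1 hl2
    have e1 := e1 (by omega)
    have e2 := e2 (by omega)
    have ea : Ls[t][0] = a := by simp [hac]
    have ec : Ls[t][1] = c := by simp [hac]
    rw [ea] at e1
    rw [ec] at e2
    refine (Ev.or h1 (Ev.and' (Ev.eq h1 e0 (.lit (by omega))) fun _ =>
      Ev.or h1 (Ev.and' (Ev.eq h1 e1 (.var hx)) fun _ => Ev.eq h1 e2 (.var hz)) fun _ =>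
        Ev.and' (Ev.eq h1 e1 (.var hz)) fun _ => Ev.eq h1 e2 (.var hx)) fun _ =>
      Ev.and' (Ev.eq h1 (.var hx) (.var hr)) fun _ => Ev.and' (Ev.eq h1 e0 (.lit h1)) fun _ =>
        Ev.eq h1 e1 (.var hz)).conv (ind_congr ?_) (by omega)
    unfold IsSet
    simp [hac]
  -- For other lengths the first disjunct stops at the test of the length; stating its remainder as
  -- `False` with cost zero avoids any claim about cells beyond the set.
  · refine (Ev.or (P := Ls[t].length = 2 ∧ False) (ca := 20) (cb := 60)
      (Q := x = n ∧ Ls[t].length = 1 ∧ Ls[t] = [z]) h1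
      ((Ev.and' (cb := 0) (Ev.eq h1 e0 (.lit (by omega))) fun h => absurd h hl2).le (by omega)) fun _ =>
      (Ev.and' (Ev.eq h1 (.var hx) (.var hr)) fun _ => Ev.and' (Ev.eq h1 e0 (.lit h1)) fun hl =>
        (Ev.eq h1 (e1 (by omega)) (.var hz)).conv (ind_congr ?_) le_rfl).le (by omega)).conv
        (ind_congr ?_) (by omega)
    · obtain ⟨a, ha⟩ := List.length_eq_one_iff.1 hl
      simp [ha]
    · unfold IsSet
      constructor
      · rintro (h | h)
        · exact h.2.elim
        · exact .inr ⟨h.1, h.2.2⟩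
      · rintro ((h | h) | h)
        · simp [h] at hl2
        · simp [h] at hl2
        · exact .inr ⟨h.1, by simp [h.2], h.2⟩

theorem pair_ev (hr : Regs B w b nr base n) (hm : Var B w mr Ls.length)
    (hc : ∀ t < Ls.length, Cell B μ base 0 t (setPos n Ls t)) {k rk : ℕ} (hk : Var B w rk k) :
    Ev B μ w (pairE b nr mr rk) (ind (IsPair n Ls (k / n) (k % n))) (30 + Ls.length * 140) := by
  refine (Ev.letE (c := 20 + Ls.length * 140) (Ev.div (.var hk) (.var hr.n)) fun w₁ hw₁ rx hx =>
    (Ev.letE (c := 6 + Ls.length * 140) (Ev.mod (.var (hk.ext hw₁)) (.var (hr.ext hw₁).n))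
    fun w₂ hw₂ rz hz => (Ev.anyFin (n := Ls.length) (p := fun t => IsSet n Ls[t] (k / n) (k % n))
      (cost := fun _ => 130) (by omega) (.var (hm.ext (hw₁.trans hw₂))) fun t w₃ hw₃ rt ht =>
      (Ev.letE (c := 110) (Ev.arr (by omega) (hr.ext (hw₁.trans (hw₂.trans hw₃))).b (hc t t.2) (.var ht))
        fun w₄ hw₄ rp hp => h.isSet_ev hB (hr.ext (hw₁.trans (hw₂.trans (hw₃.trans hw₄)))).n t.2 hp
          (hx.ext (hw₂.trans (hw₃.trans hw₄))) (hz.ext (hw₃.trans hw₄))).le (by omega)).le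
      (show _ ≤ 6 + Ls.length * 140 by simp)).le (by omega)).conv (ind_congr ?_) (by omega)
  unfold IsPair
  simp only [List.mem_iff_getElem]
  constructor
  · rintro ⟨t, ht⟩
    exact ⟨_, ⟨t, t.2, rfl⟩, ht⟩
  · rintro ⟨_, ⟨t, ht, rfl⟩, h⟩
    exact ⟨⟨t, ht⟩, h⟩

omit h in
theorem weight_ev {L : Fin n → ℕ} (hL : ∀ j, L j ≤ n) (hw : codes L ≤ B) (hr : Regs B w b nr base n)
    (hc : ∀ i : Fin n, Cell B μ base 3 i (L i)) {k rk : ℕ} (hk : Var B w rk k) (hk2 : k ≤ n + n)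
    (hck : k ≠ 0 → Cell B μ base 5 (k - 1) (weight (radix L) (k - 1))) :
    Ev B μ w (weightE b nr rk) (weight (radix L) k) 60 := by
  have h8 : 8 ≤ B := by omega
  have h1 : 1 ≤ B := by omega
  have hnn := Nat.le_mul_self n
  obtain _ | i := k
  · exact (Ev.ite_neg (.var hk) rfl (.lit h1)).conv (by simp [weight]) (by omega)
  have hwB : weight (radix L) (i + 1) ≤ B := (weight_mono (radix_pos L) hk2).trans hw
  refine (Ev.ite_pos (.var hk) (by omega) (Ev.letE (c := 50)
    (Ev.sub (.var hk) (.lit h1)) fun w' hw' rp hp => ?_)).le (by omega)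
  rw [weight_succ] at hwB ⊢
  refine (Ev.mul (Ev.arr h8 (hr.ext hw').b (hck (by omega)) (.var hp)) (cy := 30) ?_ hwB).le (by omega)
  have hlt := Ev.lt (μ := μ) h1 (.var hp) (.var (hr.ext hw').n)
  by_cases hi : i < n
  · have := hL ⟨i, hi⟩
    have hlen := Ev.arr h8 (hr.ext hw').b (hc ⟨i, hi⟩) (.var hp)
    exact (Ev.ite_pos hlt (ind_ne_zero.2 hi) (Ev.add (Ev.div hlen (.lit (by omega))) (.lit h1)
      (by omega))).conv (by simp [radix, hi, extend]) (by omega)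
  · have := hL ⟨i - n, by omega⟩
    have hlen := Ev.arr h8 (hr.ext hw').b (hc ⟨i - n, by omega⟩)
      (Ev.sub (.var hp) (.var (hr.ext hw').n))
    exact (Ev.ite_neg hlt (ind_false hi) (Ev.add hlen (.lit h1)
      (by omega))).conv (by simp [radix, hi, extend, show i - n < n by omega]) (by omega)

end Input

end RAM

/-! ### The complete program. -/

namespace RAM

open ChainGame

/-- The answer, when the table is complete. -/
def winnerE (b nr mr : ℕ) : Code :=
  orE (anyE (varE mr) fun t => eqE (loadE (arrE b 0 (varE t))) (litE 0))
    (notE (safeE b nr (fun j => arrE b 3 (varE j)) (fun _ => litE 0) fun z => adjE b nr nr z))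

/-- The program, when the registers hold the numbers of vertices and of winning sets and the end of
the input. -/
def tablesE (b nr mr : ℕ) : Code :=
  thenE (fillE b 0 (varE mr) fun i => setPosE b nr i) <|
  thenE (fillE b 1 (varE nr) fun i => depthE nr i) <|
  thenE (fillE b 2 (varE nr) fun i => topE b nr i) <|
  thenE (fillE b 3 (varE nr) fun i => lengthE b nr i) <|
  thenE (fillE b 4 (opE .mul (opE .add (varE nr) (litE 1)) (varE nr)) fun i => pairE b nr mr i) <|
  thenE (fillE b 5 (opE .add (opE .add (varE nr) (varE nr)) (litE 1)) fun i => weightE b nr i) <|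
  thenE (fillE b 6 (arrE b 5 (opE .add (varE nr) (varE nr))) fun s =>
    stepE b nr (qdigE b nr s) (mdigE b s)) <|
  winnerE b nr mr

/-- The program for the poset positional game. -/
def solveE : Code :=
  letE (loadE (litE 0)) fun nr => letE (loadE (litE 1)) fun mr => letE (baseE nr mr) fun b =>
    tablesE b nr mr

/-- `D`, `R` and `L` are the depths, the chains and the lengths of the chains in a disjoint union of
chains; a chain is represented by its largest element. -/
structure Forest {n : ℕ} (le : Fin n → Fin n → Prop) (D : Fin n → ℕ) (R : Fin n → Fin n)
    (L : Fin n → ℕ) : Prop where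
  depth : ∀ z, D z + 1 = ∑ v, ind (le z v)
  top : ∀ z, (R z : ℕ) = ∑ v : Fin n, ind (le z v ∧ D v = 0) * v
  length : ∀ j, L j = if D j ≠ 0 then 0 else ∑ u, ind (le u j)
  lt_iff : ∀ j i, i < L j ↔ ∃ z, (R z, D z) = (j, i)
  inj : ∀ z z', R z = R z' → D z = D z' → z = z'

namespace Forest

variable {n : ℕ} {le : Fin n → Fin n → Prop} {D : Fin n → ℕ} {R : Fin n → Fin n} {L : Fin n → ℕ}

theorem depth_lt (hF : Forest le D R L) (z : Fin n) : D z < n := by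
  have : D z + 1 ≤ n := by
    rw [hF.depth z]
    exact (Finset.sum_le_sum fun v _ => ind_le_one _).trans (by simp)
  omega

theorem length_le (hF : Forest le D R L) (j : Fin n) : L j ≤ n := by
  rw [hF.length j]
  split_ifs
  · exact Nat.zero_le _
  · exact (Finset.sum_le_sum fun v _ => ind_le_one _).trans (by simp)

end Forest

theorem Data.fill {B : ℕ} {μ : ℕ → ℕ} {base n : ℕ} {D : Fin n → ℕ} {R : Fin n → Fin n}
    {L : Fin n → ℕ} {Ad : ℕ → Fin n → Prop} (hd : Data B μ base D R L Ad) (f : ℕ → ℕ) (k : ℕ) :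
    Data B (fillMem base 6 f μ k) base D R L Ad :=
  { hd with
    dep := fun i => (hd.dep i).fill k (by norm_num) (by norm_num) (by norm_num)
    root := fun i => (hd.root i).fill k (by norm_num) (by norm_num) (by norm_num)
    len := fun i => (hd.len i).fill k (by norm_num) (by norm_num) (by norm_num)
    adj := fun x hx z => (hd.adj x hx z).fill k (by norm_num) (by norm_num) (by norm_num)
    wt := fun i hi => (hd.wt i hi).fill k (by norm_num) (by norm_num) (by norm_num) }

section

variable {B n r : ℕ} {μ : ℕ → ℕ} {le : Fin n → Fin n → Prop} {Ls : List (List ℕ)} {D : Fin n → ℕ}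
  {R : Fin n → Fin n} {L : Fin n → ℕ} {N : Fin n × ℕ → Fin n × ℕ → Prop} {S : Set (Fin n × ℕ)}
  {w : World} {b nr mr base : ℕ}

/-- A bound for the time to compute an entry of the table. -/
def stepCost (n r : ℕ) : ℕ :=
  1200 * (n + 1) * (n + 1) + r * (160 * (n + 1) + r * (1000 * (n + 1) * (n + 1)) + 100)

theorem Data.answer_ev (hd : Data B μ base D R L fun x z => IsPair n Ls x z)
    (hr : Regs B w b nr base n) (hm : Var B w mr Ls.length) (h : Input B μ le Ls)
    (hc : ∀ t < Ls.length, Cell B μ base 0 t (setPos n Ls t))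
    (ht : ∀ k < codes L, Cell B μ base 6 k (ind (table N (n % 2) L k)))
    (hS : ∀ z : Fin n, IsPair n Ls n z ↔ (R z, D z) ∈ S) :
    Ev B μ w (winnerE b nr mr)
      (ind ([] ∈ Ls ∨ ¬ Safe (SurvivesBelow N (n % 2) L (codes L)) (n % 2) L 0 S))
      (20 + Ls.length * 40 + 1000 * (n + 1) * (n + 1)) := by
  have h1 := hd.one_le
  have hb : Bdd L L 0 := ⟨fun _ => le_rfl, fun _ => Nat.zero_le _⟩
  have hsets := Ev.anyFin (n := Ls.length) (p := fun t => Ls[t].length = 0) (cost := fun _ => 30) h1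
    (.var hm) fun t w' hw rt ht => by
      have := setPos_le n h.size t.2.le
      have h0 : μ (setPos n Ls t) = Ls[t].length := h.set t t.2 0 (by simp)
      have e := Ev.load (Ev.arr hd.h8 (hr.ext hw).b (hc t t.2) (.var ht))
        (h.bounded _ (by have := t.2; omega))
      rw [h0] at e
      exact (Ev.eq h1 e (.lit (Nat.zero_le B))).le (by omega)
  refine (Ev.or h1 hsets fun _ => Ev.not h1 (hd.safe hr ht hb (fun g' hg => hg.code_lt)
    (fun w' hw rj j hj => (hd.lenE (hr.ext hw) hj).le (by norm_num))
    (fun w' hw rj j hj => (Ev.lit (Nat.zero_le B)).le (by norm_num))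
    fun w' hw rz z hz => ((hd.adjacent (hr.ext hw) le_rfl (hr.ext hw).n hz).conv
      (ind_congr (hS z)) (by norm_num)))).conv (ind_congr (or_congr_left ?_)) ?_
  · simp only [List.length_eq_zero_iff, List.mem_iff_getElem]
    exact ⟨fun ⟨t, ht⟩ => ⟨t, t.2, ht⟩, fun ⟨t, ht, h⟩ => ⟨⟨t, ht⟩, h⟩⟩
  · simp; omega

/-- Each stage reads only the input, arrays filled before, and earlier entries of its own array. The
table comes last, in increasing order of numbers. Row `n` of the matrix of pairs holds the
singletons, which serve as initial threats. -/
theorem Input.tables_out (h : Input B μ le Ls) (hF : Forest le D R L)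
    (hB : 2 + n * n + 3 * Ls.length + 8 * (Ls.length + 2 * ((n + 1) * (n + 1)) + codes L) + 8 ≤ B)
    (hr : Regs B w b nr (2 + n * n + 3 * Ls.length) n) (hm : Var B w mr Ls.length)
    (hL : (Finset.univ.filter fun j => 0 < L j).card ≤ r)
    (hN : ∀ x z : Fin n, IsPair n Ls x z ↔ N (R x, D x) (R z, D z))
    (hS : ∀ z : Fin n, IsPair n Ls n z ↔ (R z, D z) ∈ S) :
    Out B μ w (tablesE b nr mr)
      (ind ([] ∈ Ls ∨ ¬ Safe (SurvivesBelow N (n % 2) L (codes L)) (n % 2) L 0 S))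
      (2000 * (n + 1) * (n + 1) * (Ls.length + 1) + codes L * (stepCost n r + 14)) := by
  have hnn : (n + 1) * (n + 1) = n * n + 2 * n + 1 := by ring
  set base := 2 + n * n + 3 * Ls.length with hbase
  have h8 : 8 ≤ B := by omega
  have hB' : 2 + n * n + 3 * Ls.length + 8 ≤ B := by omega
  have hBn : base + 8 * n ≤ B := by omega
  have hpos : ∀ t < Ls.length, setPos n Ls t ≤ B := fun t ht => by
    have := setPos_le n h.size ht.le
    omega
  set μ0 := fillMem base 0 (setPos n Ls) μ Ls.length with hμ0
  set μ1 := fillMem base 1 (extend D) μ0 n with hμ1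
  set μ2 := fillMem base 2 (extend fun i => (R i : ℕ)) μ1 n with hμ2
  set μ3 := fillMem base 3 (extend L) μ2 n with hμ3
  set μ4 := fillMem base 4 (fun k => ind (IsPair n Ls (k / n) (k % n))) μ3 ((n + 1) * n) with hμ4
  set μ5 := fillMem base 5 (weight (radix L)) μ4 (n + n + 1) with hμ5
  have i0 : Input B μ0 le Ls := h.fill _ _ _
  have i1 : Input B μ1 le Ls := i0.fill _ _ _
  have i2 : Input B μ2 le Ls := i1.fill _ _ _
  have i3 : Input B μ3 le Ls := i2.fill _ _ _
  have i4 : Input B μ4 le Ls := i3.fill _ _ _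
  have i5 : Input B μ5 le Ls := i4.fill _ _ _
  have i6 : Input B (fillMem base 6 (fun k => ind (table N (n % 2) L k)) μ5 (codes L)) le Ls :=
    i5.fill _ _ _
  have hwle : ∀ i ≤ n + n, weight (radix L) i ≤ B := fun i hi =>
    (weight_mono (radix_pos L) hi).trans (show codes L ≤ B by omega)
  have hlen := hF.length_le
  have hdl := hF.depth_lt
  have c0 : ∀ t < Ls.length, Cell B μ0 base 0 t (setPos n Ls t) := fun t ht =>
    cell_fill (by norm_num) (by omega) ht (hpos t ht)
  have c0' : ∀ t < Ls.length, Cell B μ3 base 0 t (setPos n Ls t) := fun t ht =>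
    (((c0 t ht).fill _ (by norm_num) (by norm_num) (by norm_num)).fill _
      (by norm_num) (by norm_num) (by norm_num)).fill _ (by norm_num) (by norm_num) (by norm_num)
  have c0'' : ∀ t < Ls.length, Cell B μ5 base 0 t (setPos n Ls t) := fun t ht =>
    ((c0' t ht).fill _ (by norm_num) (by norm_num) (by norm_num)).fill _
      (by norm_num) (by norm_num) (by norm_num)
  have c1 : ∀ i : Fin n, Cell B μ1 base 1 i (D i) := fun i =>
    cell_fillFin (by norm_num) hBn i (by have := hdl i; omega)
  have c1' : ∀ i : Fin n, Cell B μ2 base 1 i (D i) := fun i =>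
    (c1 i).fill _ (by norm_num) (by norm_num) (by norm_num)
  have c2 : ∀ i : Fin n, Cell B μ2 base 2 i (R i) := fun i =>
    cell_fillFin (f := fun i => (R i : ℕ)) (by norm_num) hBn i (by have := (R i).2; omega)
  have c3 : ∀ i : Fin n, Cell B μ3 base 3 i (L i) := fun i =>
    cell_fillFin (by norm_num) hBn i (by have := hlen i; omega)
  have c3' : ∀ i : Fin n, Cell B μ4 base 3 i (L i) := fun i =>
    (c3 i).fill _ (by norm_num) (by norm_num) (by norm_num)
  have hsize : (n + 1) * n = n * n + n := by ring
  have c4 : ∀ x ≤ n, ∀ z : Fin n, Cell B μ4 base 4 (x * n + z) (ind (IsPair n Ls x z)) := by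
    intro x hx z
    have hz := z.2
    have hxn := Nat.mul_le_mul_right n hx
    have := cell_fill (B := B) (base := base) (μ := μ3) (a := 4) (i := x * n + z) (k := (n + 1) * n)
      (f := fun k => ind (IsPair n Ls (k / n) (k % n))) (by norm_num) (by omega) (by omega)
      ((ind_le_one _).trans (by omega))
    rwa [mul_comm x n, Nat.mul_add_div (by omega), Nat.div_eq_of_lt hz, add_zero,
      Nat.mul_add_mod, Nat.mod_eq_of_lt hz, mul_comm n x] at this
  have c5 : ∀ i ≤ n + n, Cell B μ5 base 5 i (weight (radix L) i) := fun i hi =>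
    cell_fill (by norm_num) (by omega) (by omega) (hwle i hi)
  have hd : Data B μ5 base D R L fun x z => IsPair n Ls x z :=
    { h8 := h8
      hn := by omega
      hnn := by omega
      dep := fun i => (((c1' i).fill _ (by norm_num) (by norm_num) (by norm_num)).fill _
        (by norm_num) (by norm_num) (by norm_num)).fill _ (by norm_num) (by norm_num) (by norm_num)
      root := fun i => (((c2 i).fill _ (by norm_num) (by norm_num) (by norm_num)).fill _
        (by norm_num) (by norm_num) (by norm_num)).fill _ (by norm_num) (by norm_num) (by norm_num)
      len := fun i => (c3' i).fill _ (by norm_num) (by norm_num) (by norm_num)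
      adj := fun x hx z => (c4 x hx z).fill _ (by norm_num) (by norm_num) (by norm_num)
      wt := c5
      depth_lt := hdl
      len_le := hlen
      lt_iff := hF.lt_iff
      inj := hF.inj }
  have hcell : ∀ k, ∀ s < k, k ≤ codes L →
      Cell B (fillMem base 6 (fun k => ind (table N (n % 2) L k)) μ5 k) base 6 s
        (ind (table N (n % 2) L s)) := fun k s hs hk =>
    cell_fill (f := fun k => ind (table N (n % 2) L k)) (by norm_num) (by omega) hs
      ((ind_le_one _).trans (by omega))
  have f0 : St B μ w (fillE b 0 (varE mr) fun i => setPosE b nr i) μ0 _ :=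
    St.fill h8 (by norm_num) hr.b (by omega) (.var hm) fun k hk w' hw i hi =>
      (h.fill 0 (setPos n Ls) k).setPos_ev hB' (hr.ext hw) hk hi fun h0 =>
        cell_fill (by norm_num) (by omega) (by omega) (hpos _ (by omega))
  have f1 : St B μ0 w (fillE b 1 (varE nr) fun i => depthE nr i) μ1 _ :=
    St.fillFin h8 (by norm_num) hr.b hBn (.var hr.n) fun k w' hw i hi =>
      (i0.fill 1 (extend D) k).depth_ev hB' hF.depth (hr.ext hw).n hi
  have f2 : St B μ1 w (fillE b 2 (varE nr) fun i => topE b nr i) μ2 _ :=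
    St.fillFin h8 (by norm_num) hr.b hBn (.var hr.n) fun k w' hw i hi =>
      (i1.fill 2 (extend fun i => (R i : ℕ)) k).top_ev hB' hF.top (hr.ext hw)
        (fun i => (c1 i).fill _ (by norm_num) (by norm_num) (by norm_num)) hi
  have f3 : St B μ2 w (fillE b 3 (varE nr) fun i => lengthE b nr i) μ3 _ :=
    St.fillFin h8 (by norm_num) hr.b hBn (.var hr.n) fun k w' hw i hi =>
      (i2.fill 3 (extend L) k).length_ev hB' hF.length (hr.ext hw)
        (fun i => (c1' i).fill _ (by norm_num) (by norm_num) (by norm_num)) hi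
  have f4 : St B μ3 w (fillE b 4 (opE .mul (opE .add (varE nr) (litE 1)) (varE nr))
      fun i => pairE b nr mr i) μ4 _ :=
    St.fill h8 (by norm_num) hr.b (by omega)
      (.mul (.add (.var hr.n) (.lit (by omega)) (by omega)) (.var hr.n) (by omega))
      fun k hk w' hw i hi => (i3.fill 4 _ k).pair_ev hB' (hr.ext hw) (hm.ext hw)
        (fun t ht => (c0' t ht).fill _ (by norm_num) (by norm_num) (by norm_num)) hi
  have f5 : St B μ4 w (fillE b 5 (opE .add (opE .add (varE nr) (varE nr)) (litE 1))
      fun i => weightE b nr i) μ5 _ :=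
    St.fill h8 (by norm_num) hr.b (by omega)
      (.add (.add (.var hr.n) (.var hr.n) (by omega)) (.lit (by omega)) (by omega))
      fun k hk w' hw i hi => Input.weight_ev hB' hlen (by omega) (hr.ext hw)
        (fun i => (c3' i).fill _ (by norm_num) (by norm_num) (by norm_num)) hi (by omega)
        fun h0 => cell_fill (by norm_num) (by omega) (by omega) (hwle _ (by omega))
  have f6 : St B μ5 w (fillE b 6 (arrE b 5 (opE .add (varE nr) (varE nr))) fun s =>
      stepE b nr (qdigE b nr s) (mdigE b s))
      (fillMem base 6 (fun k => ind (table N (n % 2) L k)) μ5 (codes L)) _ :=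
    St.fill h8 (by norm_num) hr.b (by omega)
      (.arr h8 hr.b (c5 (n + n) le_rfl) (.add (.var hr.n) (.var hr.n) (by omega)))
      fun k hk w' hw i hi => (hd.fill _ k).table_ev (hr.ext hw)
        (fun s hs => hcell k s hs hk.le) hL hN hi (code_digit hk).symm
  refine (Out.then f0 (Out.then f1 (Out.then f2 (Out.then f3 (Out.then f4 (Out.then f5 (Out.then f6
    ((hd.fill _ _).answer_ev hr hm i6
      (fun t ht => (c0'' t ht).fill _ (by norm_num) (by norm_num) (by norm_num))
      (fun s hs => hcell _ s hs le_rfl) hS).out))))))).le ?_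
  rw [show 1200 * (n + 1) * (n + 1) + r * (160 * (n + 1) + r * (1000 * (n + 1) * (n + 1)) + 100) =
    stepCost n r from rfl]
  generalize codes L * (stepCost n r + 14) = T
  generalize Ls.length = m
  ring_nf
  nlinarith [Nat.zero_le (n * m), Nat.zero_le (n ^ 2 * m), Nat.zero_le (n ^ 2)]

theorem Input.solve_out (h : Input B μ le Ls) (hF : Forest le D R L)
    (hB : 2 + n * n + 3 * Ls.length + 8 * (Ls.length + 2 * ((n + 1) * (n + 1)) + codes L) + 8 ≤ B)
    (hL : (Finset.univ.filter fun j => 0 < L j).card ≤ r)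
    (hN : ∀ x z : Fin n, IsPair n Ls x z ↔ N (R x, D x) (R z, D z))
    (hS : ∀ z : Fin n, IsPair n Ls n z ↔ (R z, D z) ∈ S) :
    Out B μ w solveE
      (ind ([] ∈ Ls ∨ ¬ Safe (SurvivesBelow N (n % 2) L (codes L)) (n % 2) L 0 S))
      (2000 * (n + 1) * (n + 1) * (Ls.length + 1) + codes L * (stepCost n r + 14) + 40) := by
  have hv : ind ([] ∈ Ls ∨ ¬ Safe (SurvivesBelow N (n % 2) L (codes L)) (n % 2) L 0 S) ≤ B :=
    (ind_le_one _).trans (by omega)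
  have hnn : (n + 1) * (n + 1) = n * n + 2 * n + 1 := by ring
  have e0 : Ev B μ w (loadE (litE 0)) n 2 := (Ev.load (.lit (Nat.zero_le B))
    (by rw [h.vertices]; omega)).conv h.vertices le_rfl
  have e1 : ∀ w', Ev B μ w' (loadE (litE 1)) Ls.length 2 := fun w' => (Ev.load (.lit (by omega))
    (by rw [h.sets]; omega)).conv h.sets le_rfl
  refine (Out.letE hv e0 fun w₁ hw₁ nr hn => Out.letE hv (e1 w₁) fun w₂ hw₂ mr hm => Out.letE hv
    (Input.base_ev (by omega) (hn.ext hw₂) hm) fun w₃ hw₃ b hb =>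
    h.tables_out hF hB ⟨hb, hn.ext (hw₂.trans hw₃)⟩ (hm.ext hw₃) hL hN hS).le (by omega)

end

end RAM

/-! ### Disjoint chains -/

namespace PosetGame

open ChainGame RAM

section forest

variable {X : Type*} [PartialOrder X] {n w h : ℕ} (e : Fin n ≃ X)

theorem sum_ind {p : Fin n → Prop} [DecidablePred p] :
    ∑ v, ind (p v) = (Finset.univ.filter p).card := by
  rw [Finset.card_filter]
  exact Finset.sum_congr rfl fun v _ => by by_cases hv : p v <;> simp [ind, hv]

/-- The number of elements above a vertex. -/
noncomputable def depth (z : Fin n) : ℕ := {v | e z < e v}.ncard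

theorem depth_add_one (z : Fin n) : depth e z + 1 = ∑ v, ind (e z ≤ e v) := by
  classical
  rw [sum_ind, ← Set.ncard_coe_finset, depth,
    ← Set.ncard_insert_of_notMem (a := z) (by simp) (Set.toFinite _)]
  congr 1
  ext v
  simp only [Set.mem_insert_iff, Set.mem_ofPred_eq, Finset.coe_filter, Finset.mem_univ, true_and,
    le_iff_lt_or_eq, e.injective.eq_iff]
  tauto

theorem depth_lt_depth {y z : Fin n} (hyz : e y < e z) : depth e z < depth e y :=
  Set.ncard_lt_ncard ⟨fun _ hv => hyz.trans hv, fun h => lt_irrefl _ (h (show z ∈ _ from hyz))⟩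
    (Set.toFinite _)

theorem depth_eq_zero_iff {z : Fin n} : depth e z = 0 ↔ IsMax (e z) := by
  rw [depth, Set.ncard_eq_zero (Set.toFinite _), Set.eq_empty_iff_forall_notMem]
  constructor
  · intro h b hb
    obtain ⟨v, rfl⟩ := e.surjective b
    by_contra hle
    exact h v (lt_of_le_not_ge hb hle)
  · exact fun h v hv => h.not_lt hv

theorem exists_top (z : Fin n) : ∃ v, e z ≤ e v ∧ IsMax (e v) := by
  obtain ⟨v, hv⟩ := (Set.toFinite {v | e z ≤ e v}).exists_maximalFor e _ ⟨z, le_refl (e z)⟩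
  refine ⟨v, hv.1, fun b hb => ?_⟩
  obtain ⟨u, rfl⟩ := e.surjective b
  exact hv.2 (show e z ≤ e u from hv.1.trans hb) hb

/-- A maximal element above a vertex. -/
noncomputable def top (z : Fin n) : Fin n := (exists_top e z).choose

theorem le_top (z : Fin n) : e z ≤ e (top e z) := (exists_top e z).choose_spec.1

theorem isMax_top (z : Fin n) : IsMax (e (top e z)) := (exists_top e z).choose_spec.2

/-- The length of the chain with a given top, and zero for the other elements. -/
noncomputable def chainLength (j : Fin n) : ℕ :=
  if depth e j ≠ 0 then 0 else ∑ u, ind (e u ≤ e j)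

/-- The map `c` tells the chain of an element. -/
structure IsChainMap (c : X → Fin w) : Prop where
  eq_of_le : ∀ x y, x ≤ y → c x = c y
  total : ∀ x y, c x = c y → x ≤ y ∨ y ≤ x

variable {e} {c : X → Fin w} (hc : IsChainMap c)

include hc

/-- Two maximal elements above the same vertex lie in one chain, so they are comparable and
therefore equal. This makes the top a name for the chain. -/
theorem eq_top {z v : Fin n} (hzv : e z ≤ e v) (hv : IsMax (e v)) : v = top e z := by
  have h1 := hc.eq_of_le _ _ hzv
  have h2 := hc.eq_of_le _ _ (le_top e z)
  apply e.injective
  rcases hc.total _ _ (h1.symm.trans h2) with h | h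
  · exact h.antisymm (hv h)
  · exact (isMax_top e z h).antisymm h

theorem top_eq_iff {y z : Fin n} : top e y = top e z ↔ c (e y) = c (e z) := by
  constructor
  · intro h
    rw [hc.eq_of_le _ _ (le_top e y), h, ← hc.eq_of_le _ _ (le_top e z)]
  · intro h
    rcases hc.total _ _ h with h | h
    · exact (eq_top hc (h.trans (le_top e z)) (isMax_top e z)).symm
    · exact eq_top hc (h.trans (le_top e y)) (isMax_top e y)

theorem lt_iff_depth_lt {y z : Fin n} : e y < e z ↔ top e y = top e z ∧ depth e z < depth e y := by
  constructor
  · exact fun h => ⟨(top_eq_iff hc).2 (hc.eq_of_le _ _ h.le), depth_lt_depth e h⟩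
  · rintro ⟨ht, hd⟩
    rcases hc.total _ _ ((top_eq_iff hc).1 ht) with h | h
    · refine lt_of_le_of_ne h fun h => ?_
      rw [e.injective h] at hd
      exact lt_irrefl _ hd
    · rcases h.lt_or_eq with h | h
      · exact absurd (depth_lt_depth e h) hd.not_gt
      · rw [e.injective h] at hd
        exact absurd hd (lt_irrefl _)

theorem eq_of_top_of_depth {y z : Fin n} (ht : top e y = top e z) (hd : depth e y = depth e z) :
    y = z := by
  apply e.injective
  rcases hc.total _ _ ((top_eq_iff hc).1 ht) with h | h
  · exact h.eq_of_not_lt fun h => (depth_lt_depth e h).ne' hd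
  · exact (h.eq_of_not_lt fun h => (depth_lt_depth e h).ne hd).symm

theorem chainLength_eq (j : Fin n) :
    chainLength e j = (Finset.univ.filter fun u => top e u = j).card := by
  classical
  unfold chainLength
  split_ifs with h
  · rw [eq_comm, Finset.card_eq_zero, Finset.filter_eq_empty_iff]
    rintro u - rfl
    exact h ((depth_eq_zero_iff e).2 (isMax_top e u))
  · rw [sum_ind]
    congr 1
    ext u
    simp only [Finset.mem_filter, Finset.mem_univ, true_and]
    constructor
    · exact fun hu => (eq_top hc hu ((depth_eq_zero_iff e).1 (not_not.1 h))).symm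
    · rintro rfl
      exact le_top e u

/-- On one chain the depth is injective with values below the length; counting shows that every such
value occurs. -/
theorem lt_chainLength_iff (j : Fin n) (i : ℕ) :
    i < chainLength e j ↔ ∃ z, (top e z, depth e z) = (j, i) := by
  classical
  have hsub : (Finset.univ.filter fun u => top e u = j).image (depth e) ⊆
      Finset.range (chainLength e j) := by
    intro d hd
    simp only [Finset.mem_image, Finset.mem_filter, Finset.mem_univ, true_and] at hd
    obtain ⟨z, hz, rfl⟩ := hd
    rw [Finset.mem_range, chainLength_eq hc, depth, ← Set.ncard_coe_finset]
    refine Set.ncard_lt_ncard ⟨fun v hv => ?_, fun h => ?_⟩ (Set.toFinite _)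
    · simp only [Finset.coe_filter, Finset.mem_univ, true_and, Set.mem_ofPred_eq]
      rw [← hz]
      exact ((lt_iff_depth_lt hc).1 hv).1.symm
    · exact lt_irrefl _ (h (show z ∈ _ by simpa using hz))
  have heq := Finset.eq_of_subset_of_card_le hsub (by
    rw [Finset.card_range, Finset.card_image_of_injOn, chainLength_eq hc]
    intro y hy z hz hyz
    simp only [Finset.coe_filter, Finset.mem_univ, true_and, Set.mem_ofPred_eq] at hy hz
    exact eq_of_top_of_depth hc (hy.trans hz.symm) hyz)
  rw [← Finset.mem_range, ← heq]
  simp [Prod.ext_iff]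

theorem forest : Forest (fun i j => e i ≤ e j) (depth e) (top e) (chainLength e) where
  depth := depth_add_one e
  top z := by
    rw [Finset.sum_eq_single (top e z), ind_true ⟨le_top e z, (depth_eq_zero_iff e).2 (isMax_top e z)⟩,
      one_mul]
    · intro v _ hv
      rw [ind_false, zero_mul]
      exact fun h => hv (eq_top hc h.1 ((depth_eq_zero_iff e).1 h.2))
    · simp
  length j := rfl
  lt_iff := lt_chainLength_iff hc
  inj _ _ := eq_of_top_of_depth hc

theorem isChainCoord : IsChainCoord (fun x => (top e (e.symm x), depth e (e.symm x)))
    (chainLength e) where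
  inj x y hxy := by
    simp only [Prod.mk.injEq] at hxy
    exact e.symm.injective (eq_of_top_of_depth hc hxy.1 hxy.2)
  lt_iff x y := by
    have := lt_iff_depth_lt (e := e) hc (y := e.symm x) (z := e.symm y)
    simpa using this
  range j i := by
    rw [lt_chainLength_iff hc]
    exact ⟨fun ⟨z, hz⟩ => ⟨e z, by simpa using hz⟩, fun ⟨x, hx⟩ => ⟨e.symm x, hx⟩⟩

theorem sum_chainLength : ∑ j, chainLength e j = n := by
  have := Finset.card_eq_sum_card_fiberwise (f := top e) (s := Finset.univ) (t := Finset.univ)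
    (by simp)
  rw [Finset.card_univ, Fintype.card_fin] at this
  exact (Finset.sum_congr rfl fun j _ => chainLength_eq hc j).trans this.symm

theorem chainLength_le (hh : ∀ k, (Finset.univ.filter fun i => c (e i) = k).card ≤ h) (j : Fin n) :
    chainLength e j ≤ h := by
  rw [chainLength_eq hc]
  refine (Finset.card_le_card fun u hu => ?_).trans (hh (c (e j)))
  simp only [Finset.mem_filter, Finset.mem_univ, true_and] at hu ⊢
  rw [← hu]
  exact hc.eq_of_le _ _ (le_top e u)

/-- An index of positive length is its own top, and tops are determined by their chain. All other
vertices are chains of length zero. -/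
theorem card_chainLength_pos : (Finset.univ.filter fun j => 0 < chainLength e j).card ≤ w := by
  refine (Finset.card_le_card_of_injOn (t := (Finset.univ : Finset (Fin w))) (fun j => c (e j))
    (by simp) ?_).trans (by simp)
  have : ∀ j, 0 < chainLength e j → top e j = j := by
    intro j hj
    obtain ⟨z, hz⟩ := (lt_chainLength_iff hc j 0).1 hj
    obtain rfl := congrArg Prod.fst hz
    exact (eq_top hc le_rfl (isMax_top e z)).symm
  intro i hi j hj hij
  simp only [Finset.coe_filter, Finset.mem_univ, true_and, Set.mem_ofPred_eq] at hi hj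
  rw [← this i hi, ← this j hj]
  exact (top_eq_iff hc).2 hij

omit hc [PartialOrder X] in
theorem card_le_mul (hh : ∀ k, (Finset.univ.filter fun i => c (e i) = k).card ≤ h) : n ≤ w * h := by
  have := Finset.card_eq_sum_card_fiberwise (f := fun i => c (e i)) (s := Finset.univ)
    (t := Finset.univ) (by simp)
  rw [Finset.card_univ, Fintype.card_fin] at this
  rw [this]
  exact (Finset.sum_le_sum fun k _ => hh k).trans (by simp)

end forest

theorem exists_chainMap {X : Type*} [PartialOrder X] {w h n : ℕ} (e : Fin n ≃ X)
    (hX : ConsistsOfDisjointChains X w h) :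
    ∃ c : X → Fin w, IsChainMap c ∧ ∀ k, (Finset.univ.filter fun i => c (e i) = k).card ≤ h := by
  obtain ⟨K, hK, hh, hdis, hinc, hcov⟩ := hX
  choose c hc using hcov
  have huniq : ∀ x k, x ∈ K k → c x = k := by
    intro x k hx
    by_contra hne
    exact Set.disjoint_left.1 (hdis _ _ hne) (hc x) hx
  refine ⟨c, ⟨fun x y hxy => ?_, fun x y hxy => ?_⟩, fun k => ?_⟩
  · by_contra hne
    exact hinc _ _ hne x (hc x) y (hc y) hxy
  · exact (hK (c x)).total (hc x) (hxy ▸ hc y)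
  · have h1 : ((Finset.univ.filter fun i => c (e i) = k).map e.toEmbedding : Set X) ⊆ K k := by
      intro x hx
      simp only [Finset.coe_map, Finset.coe_filter, Finset.mem_univ, true_and, Set.mem_image,
        Set.mem_ofPred_eq] at hx
      obtain ⟨i, hi, rfl⟩ := hx
      rw [← hi]
      exact hc _
    have h2 := (Set.encard_le_encard h1).trans (hh k)
    rw [Set.encard_coe_eq_coe_finsetCard, Finset.card_map] at h2
    exact_mod_cast h2

end PosetGame

/-! ### The encoding -/

namespace PosetGame

open ChainGame RAM

/-- Addresses in concatenated blocks: the lengths of the earlier blocks plus an offset. The `tail`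
lets it apply both to the order matrix and to the winning sets after it. -/
theorem getD_flatMap {α : Type*} (g : α → List ℕ) (l : List α) (t : ℕ) (ht : t < l.length) (s : ℕ)
    (hs : s < (g l[t]).length) (tail : List ℕ) :
    (l.flatMap g ++ tail).getD (((l.take t).map fun a => (g a).length).sum + s) 0 = (g l[t])[s] := by
  induction l generalizing t with
  | nil => simp at ht
  | cons a l ih =>
    cases t with
    | zero =>
      simp only [List.getElem_cons_zero] at hs
      simp only [List.take_zero, List.map_nil, List.sum_nil, zero_add, List.flatMap_cons,
        List.append_assoc, List.getElem_cons_zero]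
      rw [List.getD_append _ _ _ _ hs, List.getD_eq_getElem _ _ hs]
    | succ t =>
      simp only [List.getElem_cons_succ] at hs
      simp only [List.flatMap_cons, List.append_assoc, List.take_succ_cons, List.map_cons,
        List.sum_cons, List.getElem_cons_succ]
      rw [List.getD_append_right _ _ _ _ (by omega)]
      rw [← ih t (by simpa using ht) hs]
      congr 1
      omega

variable {X : Type*} {n : ℕ} (e : Fin n ≃ X)

/-- The set of elements of a list. -/
def listSet (l : List (Fin n)) : Set X := {x | ∃ i ∈ l, e i = x}

theorem listSet_eq (l : List (Fin n)) : listSet e l = e '' {i | i ∈ l} := rfl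

theorem listSet_nil : listSet e [] = ∅ := by simp [listSet]

theorem length_le_two {l : List (Fin n)} (hl : l.Nodup) (h : (listSet e l).encard ≤ 2) :
    l.length ≤ 2 := by
  classical
  rw [listSet_eq, e.injective.encard_image, show {i | i ∈ l} = (l.toFinset : Set (Fin n)) by ext; simp,
    Set.encard_coe_eq_coe_finsetCard, List.toFinset_card_of_nodup hl] at h
  exact_mod_cast h

theorem listSet_eq_iff {l l' : List (Fin n)} (hl : l.Nodup) (hl' : l'.Nodup) :
    listSet e l = listSet e l' ↔ l.Perm l' := by
  rw [listSet_eq, listSet_eq, e.injective.image_injective.eq_iff, List.perm_ext_iff_of_nodup hl hl']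
  exact Set.ext_iff

/-- A list of length at most two is determined by its first two entries, each possibly absent. -/
theorem length_le_sq {Ls : List (List (Fin n))} (h2 : ∀ l ∈ Ls, l.length ≤ 2) (hnd : Ls.Nodup) :
    Ls.length ≤ (n + 1) * (n + 1) := by
  classical
  rw [← List.toFinset_card_of_nodup hnd]
  refine (Finset.card_le_card_of_injOn (t := (Finset.univ : Finset (Option (Fin n) × Option (Fin n))))
    (fun l => (l[0]?, l[1]?)) (by simp) fun l hl l' hl' hll => ?_).trans (by simp)
  simp only [Finset.mem_coe, List.mem_toFinset] at hl hl'
  simp only [Prod.mk.injEq] at hll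
  refine List.ext_getElem? fun i => ?_
  obtain _ | _ | i := i
  · exact hll.1
  · exact hll.2
  · rw [List.getElem?_eq_none (by have := h2 l hl; omega), List.getElem?_eq_none (by have := h2 l' hl'; omega)]

section

variable [PartialOrder X] {G : PosetGame X} {Ls : List (List (Fin n))}

open Classical in
/-- The encoding. -/
noncomputable def encoding (Ls : List (List (Fin n))) : List ℕ :=
  n :: Ls.length ::
    ((List.finRange n).flatMap fun i =>
      (List.finRange n).map fun j => if e i ≤ e j then 1 else 0) ++
    Ls.flatMap fun l => l.length :: l.map Fin.val

theorem mem_encoding_le {B : ℕ} (h2 : ∀ l ∈ Ls, l.length ≤ 2) (hB : n + Ls.length + 2 ≤ B) :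
    ∀ a ∈ encoding e Ls, a ≤ B := by
  intro a ha
  simp only [encoding, List.cons_append, List.mem_cons, List.mem_append, List.mem_flatMap,
    List.mem_map, List.mem_finRange, true_and] at ha
  rcases ha with rfl | rfl | ⟨i, j, rfl⟩ | ⟨l, hl, rfl | ⟨i, -, rfl⟩⟩
  · omega
  · omega
  · split_ifs <;> omega
  · have := h2 l hl; omega
  · omega

theorem input_encoding {B : ℕ} (h2 : ∀ l ∈ Ls, l.length ≤ 2) (hB : n + Ls.length + 2 ≤ B) :
    Input B (RAM.initial (encoding e Ls)).mem (fun i j => e i ≤ e j)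
      (Ls.map fun l => l.map Fin.val) where
  vertices := by simp [RAM.initial, encoding]
  sets := by simp [RAM.initial, encoding]
  matrix i j := by
    classical
    have := getD_flatMap (fun i : Fin n => (List.finRange n).map fun j => if e i ≤ e j then 1 else 0)
      (List.finRange n) i (by simp) j (by simp)
      (Ls.flatMap fun l => l.length :: l.map Fin.val)
    simp only [List.length_map, List.length_finRange, List.map_const', List.sum_replicate,
      List.length_take, min_eq_left i.2.le, smul_eq_mul, List.getElem_map, List.getElem_finRange,
      Fin.cast_mk, Fin.eta] at this
    rw [show 2 + (i : ℕ) * n + j = (i * n + j) + 1 + 1 by ring]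
    simp only [RAM.initial, encoding, List.cons_append, List.getD_cons_succ]
    refine Eq.trans ?_ (this.trans ?_)
    · congr
    · by_cases h : e i ≤ e j <;> simp [ind, h]
  set t ht s hs := by
    classical
    have ht' : t < Ls.length := by simpa using ht
    simp only [List.getElem_map] at hs
    have := getD_flatMap (fun l : List (Fin n) => l.length :: l.map Fin.val)
      Ls t ht' s (by simpa using hs) []
    simp only [List.append_nil] at this
    have hlen : ((List.finRange n).flatMap fun i =>
      (List.finRange n).map fun j => if e i ≤ e j then 1 else 0).length = n * n := by
      simp [List.length_flatMap]
    have hpos : setPos n (Ls.map fun l => l.map Fin.val) t =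
        (n * n + ((Ls.take t).map fun l => l.length + 1).sum) + 1 + 1 := by
      simp only [setPos, ← List.map_take, List.map_map]
      simp only [Function.comp_def, List.length_map]
      omega
    rw [hpos, show ∀ a b : ℕ, a + 1 + 1 + b = (a + b) + 1 + 1 by intros; omega]
    simp only [RAM.initial, encoding, List.cons_append, List.getD_cons_succ]
    rw [List.getD_append_right _ _ _ _ (by rw [hlen]; omega), hlen,
      show ∀ a b c : ℕ, a + b + c - a = b + c by intros; omega]
    simp only [List.length_cons, List.length_map] at this
    rw [this]
    simp
  bounded x _ := by
    simp only [RAM.initial]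
    rw [List.getD_eq_getElem?_getD]
    by_cases hx : x < (encoding e Ls).length
    · rw [List.getElem?_eq_getElem hx]
      exact mem_encoding_le e h2 hB _ (List.getElem_mem hx)
    · rw [List.getElem?_eq_none (by omega)]
      exact Nat.zero_le _
  size := by
    simp only [List.mem_map]
    rintro _ ⟨l, hl, rfl⟩
    simpa using h2 l hl

/-- `Ls` is an enumeration of the winning sets. -/
structure Enumerates (G : PosetGame X) (Ls : List (List (Fin n))) : Prop where
  nodup : ∀ l ∈ Ls, l.Nodup
  mem_iff : ∀ S : Set X, S ∈ G.winningSets ↔ ∃ l ∈ Ls, S = listSet e l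

variable {e} (hG : Enumerates e G Ls)

include hG

theorem Enumerates.mem_iff_perm {l : List (Fin n)} (hl : l.Nodup) :
    listSet e l ∈ G.winningSets ↔ ∃ l' ∈ Ls, l.Perm l' := by
  rw [hG.mem_iff]
  exact exists_congr fun l' => and_congr_right fun hl' => listSet_eq_iff e hl (hG.nodup l' hl')

theorem Enumerates.empty_iff : ∅ ∈ G.winningSets ↔ [] ∈ Ls.map fun l => l.map Fin.val := by
  rw [← listSet_nil e, hG.mem_iff_perm List.nodup_nil]
  simp only [List.nil_perm, List.mem_map, List.map_eq_nil_iff]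

omit hG [PartialOrder X] in
theorem map_val_eq {l : List (Fin n)} (l' : List (Fin n)) :
    (l.map Fin.val) = l'.map Fin.val ↔ l = l' :=
  (List.map_injective_iff.2 Fin.val_injective).eq_iff

theorem Enumerates.pairs_iff {φ : X → Fin n × ℕ} (hφ : Function.Injective φ) (x z : Fin n) :
    IsPair n (Ls.map fun l => l.map Fin.val) x z ↔ G.pairs φ (φ (e x)) (φ (e z)) := by
  have h1 : G.pairs φ (φ (e x)) (φ (e z)) ↔ x ≠ z ∧ listSet e [x, z] ∈ G.winningSets := by
    have hs : listSet e [x, z] = {e x, e z} := by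
      ext; simp [listSet, eq_comm]
    rw [hs]
    constructor
    · rintro ⟨a, b, ha, hb, hab, h⟩
      rw [hφ ha, hφ hb] at hab h
      exact ⟨fun he => hab (he ▸ rfl), h⟩
    · exact fun ⟨h, h'⟩ => ⟨e x, e z, rfl, rfl, fun he => h (e.injective he), h'⟩
  have h2 : ∀ l : List (Fin n), IsSet n (l.map Fin.val) x z ↔ l = [x, z] ∨ l = [z, x] := by
    intro l
    unfold IsSet
    rw [or_iff_left fun h => x.2.ne h.1]
    exact or_congr (map_val_eq [x, z]) (map_val_eq [z, x])
  rw [h1]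
  simp only [IsPair, List.mem_map, exists_exists_and_eq_and, h2]
  constructor
  · rintro ⟨l, hl, h⟩
    have hn := hG.nodup l hl
    have hxz : x ≠ z := by
      rcases h with rfl | rfl
      · simpa using hn
      · simpa [eq_comm] using hn
    refine ⟨hxz, (hG.mem_iff_perm (by simpa using hxz)).2 ⟨l, hl, ?_⟩⟩
    rcases h with rfl | rfl
    · rfl
    · exact List.Perm.swap _ _ _
  · rintro ⟨hxz, h⟩
    obtain ⟨l, hl, hp⟩ := (hG.mem_iff_perm (by simpa using hxz)).1 h
    refine ⟨l, hl, ?_⟩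
    obtain ⟨a, b, rfl⟩ := List.length_eq_two.1 hp.length_eq.symm
    have ha : a = x ∨ a = z := by simpa using hp.mem_iff.2 (show a ∈ [a, b] by simp)
    have hb : b = x ∨ b = z := by simpa using hp.mem_iff.2 (show b ∈ [a, b] by simp)
    have hn := hG.nodup _ hl
    rcases ha with rfl | rfl <;> rcases hb with rfl | rfl <;> simp_all

theorem Enumerates.singles_iff {φ : X → Fin n × ℕ} (hφ : Function.Injective φ) (z : Fin n) :
    IsPair n (Ls.map fun l => l.map Fin.val) n z ↔ φ (e z) ∈ G.singles φ := by
  have h1 : φ (e z) ∈ G.singles φ ↔ listSet e [z] ∈ G.winningSets := by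
    have hs : listSet e [z] = {e z} := by
      ext; simp [listSet, eq_comm]
    rw [hs]
    constructor
    · rintro ⟨a, ha, h⟩
      rwa [hφ ha] at h
    · exact fun h => ⟨e z, rfl, h⟩
  have h2 : ∀ l : List (Fin n), IsSet n (l.map Fin.val) n z ↔ l = [z] := by
    intro l
    unfold IsSet
    constructor
    · rintro ((h | h) | h)
      · have : n ∈ l.map Fin.val := by simp [h]
        obtain ⟨i, -, hi⟩ := List.mem_map.1 this
        exact absurd hi i.2.ne
      · have : n ∈ l.map Fin.val := by simp [h]
        obtain ⟨i, -, hi⟩ := List.mem_map.1 this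
        exact absurd hi i.2.ne
      · exact (map_val_eq [z]).1 h.2
    · rintro rfl
      exact .inr ⟨rfl, rfl⟩
  rw [h1, hG.mem_iff_perm (by simp)]
  simp only [IsPair, List.mem_map, exists_exists_and_eq_and, h2, List.singleton_perm]
  exact ⟨fun ⟨l, hl, h⟩ => ⟨l, hl, h ▸ rfl⟩, fun ⟨l, hl, h⟩ => ⟨l, hl, h ▸ rfl⟩⟩

end

end PosetGame

/-! ### The running time -/

namespace ChainGame

theorem survivesBelow_codes {n : ℕ} {N : Fin n × ℕ → Fin n × ℕ → Prop} {ε : ℕ} {L : Fin n → ℕ} :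
    SurvivesBelow N ε L (codes L) = Survives N ε L := by
  funext q m
  exact propext ⟨fun h => h.2, fun h => ⟨h.1.code_lt, h⟩⟩

theorem codes_eq_prod {n : ℕ} (L : Fin n → ℕ) : codes L = ∏ j, (L j / 2 + 1) * (L j + 1) := by
  rw [codes, weight, Finset.prod_range_add, Finset.prod_mul_distrib,
    ← Fin.prod_univ_eq_prod_range (fun k => radix L k),
    ← Fin.prod_univ_eq_prod_range (fun k => radix L (n + k))]
  simp [radix]

/-- Indices of length zero contribute the factor one, so only the at most `w` real chains count. -/
theorem codes_le {n w h : ℕ} {L : Fin n → ℕ} (hL : ∀ j, L j ≤ h)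
    (hw : (Finset.univ.filter fun j => 0 < L j).card ≤ w) :
    codes L ≤ ((h / 2 + 1) * (h + 1)) ^ w := by
  have hM : 1 ≤ (h / 2 + 1) * (h + 1) := Nat.mul_pos (by omega) (by omega)
  rw [codes_eq_prod]
  calc ∏ j, (L j / 2 + 1) * (L j + 1)
      ≤ ∏ j, if 0 < L j then (h / 2 + 1) * (h + 1) else 1 := by
        refine Finset.prod_le_prod' fun j _ => ?_
        split_ifs with hj
        · exact Nat.mul_le_mul (by have := hL j; omega) (by have := hL j; omega)
        · rw [show L j = 0 by omega]
    _ = ((h / 2 + 1) * (h + 1)) ^ (Finset.univ.filter fun j => 0 < L j).card := by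
        rw [Finset.prod_ite]; simp
    _ ≤ _ := Nat.pow_le_pow_right hM hw

end ChainGame

namespace PosetGame

open ChainGame RAM

/-- The polynomial factor is beaten by (4/3)^w: from 14 on the ratio of the two sides no longer
grows, and smaller values are checked directly. -/
theorem pow_four_mul_le (w : ℕ) : (w + 1) ^ 4 * 3 ^ w ≤ 1000 * 4 ^ w := by
  rcases Nat.lt_or_ge w 14 with h | h
  · interval_cases w <;> norm_num
  · induction w, h using Nat.le_induction with
    | base => norm_num
    | succ w hw ih =>
      have h1 : 3 * (w + 1 + 1) ^ 4 ≤ 4 * (w + 1) ^ 4 := by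
        obtain ⟨v, rfl⟩ := Nat.exists_eq_add_of_le hw
        ring_nf
        nlinarith [Nat.zero_le v]
      calc (w + 1 + 1) ^ 4 * 3 ^ (w + 1) = 3 * (w + 1 + 1) ^ 4 * 3 ^ w := by ring
        _ ≤ 4 * (w + 1) ^ 4 * 3 ^ w := Nat.mul_le_mul_right _ h1
        _ = 4 * ((w + 1) ^ 4 * 3 ^ w) := by ring
        _ ≤ 4 * (1000 * 4 ^ w) := Nat.mul_le_mul_left _ ih
        _ = 1000 * 4 ^ (w + 1) := by ring

section

variable {n w h T : ℕ} (hh : 7 ≤ h)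

include hh

theorem codes_mul_le (hT : T ≤ ((h / 2 + 1) * (h + 1)) ^ w) :
    T * ((w + 1) ^ 4 * h ^ 2) ≤ 1000 * h ^ (2 * (w + 1)) := by
  -- This is where `h ≥ 7` comes from: `(h + 2) * (2 * (h + 1)) ≤ 3 * h ^ 2` means h² ≥ 6h + 4. The
  -- gain of a factor 3/4 per chain pays for `(w + 1) ^ 4`.
  have hM : 4 * ((h / 2 + 1) * (h + 1)) ≤ 3 * h ^ 2 := by
    have h2 : 2 * (h / 2 + 1) ≤ h + 2 := by omega
    calc 4 * ((h / 2 + 1) * (h + 1)) = 2 * (h / 2 + 1) * (2 * (h + 1)) := by ring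
      _ ≤ (h + 2) * (2 * (h + 1)) := Nat.mul_le_mul_right _ h2
      _ ≤ 3 * h ^ 2 := by nlinarith
  refine Nat.le_of_mul_le_mul_left ?_ (show 0 < 4 ^ w by positivity)
  calc 4 ^ w * (T * ((w + 1) ^ 4 * h ^ 2))
      ≤ 4 ^ w * (((h / 2 + 1) * (h + 1)) ^ w * ((w + 1) ^ 4 * h ^ 2)) := by gcongr
    _ = (4 * ((h / 2 + 1) * (h + 1))) ^ w * ((w + 1) ^ 4 * h ^ 2) := by rw [mul_pow 4, mul_assoc]
    _ ≤ (3 * h ^ 2) ^ w * ((w + 1) ^ 4 * h ^ 2) := by gcongr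
    _ = (w + 1) ^ 4 * 3 ^ w * h ^ (2 * (w + 1)) := by rw [mul_pow, ← pow_mul]; ring
    _ ≤ 1000 * 4 ^ w * h ^ (2 * (w + 1)) := Nat.mul_le_mul_right _ (pow_four_mul_le w)
    _ = 4 ^ w * (1000 * h ^ (2 * (w + 1))) := by ring

theorem succ_sq_le (hn : n ≤ w * h) : (n + 1) ^ 2 ≤ (w + 1) ^ 2 * h ^ 2 := by
  rw [← mul_pow]
  exact Nat.pow_le_pow_left (by nlinarith) 2

/-- With at least one chain the exponent on the right is at least 4 and supplies h⁴, and the excess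
powers of `h` absorb `4 ^ w`. Without chains the board is empty. -/
theorem succ_pow_four_le (hn : n ≤ w * h) : (n + 1) ^ 4 ≤ 4000 * h ^ (2 * (w + 1)) := by
  obtain _ | w := w
  · obtain rfl : n = 0 := by omega
    have : 1 ≤ h ^ (2 * (0 + 1)) := Nat.one_le_pow _ _ (by omega)
    omega
  · have h1 : (w + 1 + 1) ^ 4 ≤ 4000 * 4 ^ w := by
      have := pow_four_mul_le (w + 1)
      have h3 : 1 ≤ 3 ^ (w + 1) := Nat.one_le_pow _ _ (by omega)
      calc (w + 1 + 1) ^ 4 ≤ (w + 1 + 1) ^ 4 * 3 ^ (w + 1) := Nat.le_mul_of_pos_right _ h3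
        _ ≤ 1000 * 4 ^ (w + 1) := this
        _ = 4000 * 4 ^ w := by ring
    calc (n + 1) ^ 4 = ((n + 1) ^ 2) ^ 2 := by ring
      _ ≤ ((w + 1 + 1) ^ 2 * h ^ 2) ^ 2 := Nat.pow_le_pow_left (succ_sq_le hh hn) 2
      _ = (w + 1 + 1) ^ 4 * h ^ 4 := by ring
      _ ≤ 4000 * 4 ^ w * h ^ 4 := Nat.mul_le_mul_right _ h1
      _ ≤ 4000 * (h ^ 2) ^ w * h ^ 4 := by gcongr; nlinarith
      _ = 4000 * h ^ (2 * (w + 1 + 1)) := by rw [← pow_mul]; ring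

omit hh in
theorem stepCost_le : stepCost n w + 14 ≤ 2600 * ((w + 1) ^ 2 * (n + 1) ^ 2) := by
  unfold stepCost
  have h1 : w * (160 * (n + 1) + 100) ≤ w * (260 * (n + 1) ^ 2) := by
    refine Nat.mul_le_mul_left w ?_
    nlinarith
  nlinarith [Nat.zero_le (w * (n + 1) ^ 2), Nat.one_le_pow 2 (n + 1) (by omega)]

/-- The constant collects 4000 · 4000 for the preparation of the arrays and 2600 · 1000 for the
table, with room for the remaining steps. -/
theorem time_le {m : ℕ} (hn : n ≤ w * h) (hT : T ≤ ((h / 2 + 1) * (h + 1)) ^ w)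
    (hm : m ≤ (n + 1) * (n + 1)) :
    2000 * (n + 1) * (n + 1) * (m + 1) + T * (stepCost n w + 14) + 40 ≤
      20000000 * h ^ (2 * (w + 1)) := by
  have h1 := succ_pow_four_le hh hn
  have h2 := codes_mul_le hh hT
  have h3 : T * (stepCost n w + 14) ≤ 2600 * (T * ((w + 1) ^ 4 * h ^ 2)) := by
    calc T * (stepCost n w + 14) ≤ T * (2600 * ((w + 1) ^ 2 * ((w + 1) ^ 2 * h ^ 2))) :=
          Nat.mul_le_mul_left _ (stepCost_le.trans (by gcongr; exact succ_sq_le hh hn))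
      _ = _ := by ring
  have h4 : 2000 * (n + 1) * (n + 1) * (m + 1) ≤ 4000 * (n + 1) ^ 4 := by
    have : m + 1 ≤ 2 * (n + 1) ^ 2 := by nlinarith
    calc 2000 * (n + 1) * (n + 1) * (m + 1) ≤ 2000 * (n + 1) * (n + 1) * (2 * (n + 1) ^ 2) :=
          Nat.mul_le_mul_left _ this
      _ = _ := by ring
  have h5 : 1 ≤ h ^ (2 * (w + 1)) := Nat.one_le_pow _ _ (by omega)
  omega

theorem space_le {m : ℕ} (hn : n ≤ w * h) (hT : T ≤ ((h / 2 + 1) * (h + 1)) ^ w)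
    (hm : m ≤ (n + 1) * (n + 1)) :
    2 + n * n + 3 * m + 8 * (m + 2 * ((n + 1) * (n + 1)) + T) + 8 ≤
      20000000 * h ^ (2 * (w + 1)) := by
  have h1 := succ_pow_four_le hh hn
  have h2 := codes_mul_le hh hT
  have h3 : T ≤ T * ((w + 1) ^ 4 * h ^ 2) := Nat.le_mul_of_pos_right _ (by positivity)
  have h4 : (n + 1) * (n + 1) ≤ (n + 1) ^ 4 :=
    calc (n + 1) * (n + 1) = (n + 1) ^ 2 := by ring
      _ ≤ _ := Nat.pow_le_pow_right (by omega) (by omega)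
  have h5 : n * n ≤ (n + 1) * (n + 1) := by nlinarith
  have h6 : 1 ≤ h ^ (2 * (w + 1)) := Nat.one_le_pow _ _ (by omega)
  omega

end

theorem exists_winner {X : Type*} [PartialOrder X] {n w : ℕ} {G : PosetGame X} {e : Fin n ≃ X}
    {c : X → Fin w} (hc : IsChainMap c) (hcard : ∀ S ∈ G.winningSets, S.encard ≤ 2) :
    ∃ p : Player, G.HasWinningStrategy p ∧ p.code = ind (∅ ∈ G.winningSets ∨ ¬ Safe (Survives
      (G.pairs fun x => (top e (e.symm x), depth e (e.symm x))) (n % 2) (chainLength e)) (n % 2)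
      (chainLength e) 0 (G.singles fun x => (top e (e.symm x), depth e (e.symm x)))) := by
  have : Finite X := Finite.of_equiv _ e
  have hφ := isChainCoord hc (e := e)
  have hmw := mw_iff_not_safe (N := G.pairs fun x => (top e (e.symm x), depth e (e.symm x)))
    (L := chainLength e) (ε := n % 2) (Nat.mod_lt _ (by norm_num))
    (fun u v ⟨x, y, hx, hy, hxy, h⟩ => ⟨y, x, hy, hx, hxy.symm, by rwa [Set.pair_comm]⟩)
    (fun u ⟨x, y, hx, hy, hxy, h⟩ => hxy (hφ.inj (hx.trans hy.symm)))
    (fun q m hq hm => survives_iff ⟨hq, hm⟩) (fun q m h => h.1)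
    (congrArg (· % 2) (sum_chainLength hc))
    (G.singles fun x => (top e (e.symm x), depth e (e.symm x)))
  rw [← hmw]
  have hwin := hasWinningStrategy_iff_mw hφ hcard
  by_cases h : ∅ ∈ G.winningSets ∨ MW (G.pairs fun x => (top e (e.symm x), depth e (e.symm x)))
      (chainLength e) (G.singles fun x => (top e (e.symm x), depth e (e.symm x)))
  · exact ⟨.maker, hwin.1 h, (ind_true h).symm⟩
  · exact ⟨.breaker, hwin.2 h, (ind_false h).symm⟩

theorem solveE_computes {X : Type*} [PartialOrder X] {w h : ℕ} (hh : 7 ≤ h) {G : PosetGame X}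
    (hX : ConsistsOfDisjointChains X w h) (hcard : ∀ S ∈ G.winningSets, S.encard ≤ 2)
    {inp : List ℕ} (hinp : G.Encodes inp) :
    ∃ p : Player, G.HasWinningStrategy p ∧ (solveE 0).Computes (20000000 * h ^ (2 * (w + 1)))
      (20000000 * h ^ (2 * (w + 1))) inp p.code := by
  classical
  obtain ⟨n, e, Ls, hnd, hsets, hmem, hinp⟩ := hinp
  obtain ⟨c, hc, hcol⟩ := exists_chainMap e hX
  have hinp' : inp = encoding e Ls := by
    rw [hinp, encoding]
    simp [List.map_eq_flatMap]
  have hG : Enumerates e G Ls := ⟨hnd, hmem⟩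
  have h2 : ∀ l ∈ Ls, l.length ≤ 2 := fun l hl =>
    length_le_two e (hnd l hl) (hcard _ ((hmem _).2 ⟨l, hl, rfl⟩))
  have hm := length_le_sq h2 hsets.of_map
  have hn := card_le_mul hcol
  have hT := codes_le (chainLength_le hc hcol) (card_chainLength_pos hc)
  have hB := space_le hh hn hT hm
  have htime := time_le hh hn hT hm
  have hφ := isChainCoord hc (e := e)
  -- The world of depth zero reserves no registers, so the code may run from register 0, where the
  -- answer is expected.
  have hout := (input_encoding e h2 (B := 20000000 * h ^ (2 * (w + 1)))
    (by nlinarith)).solve_out (w := ⟨fun _ => 0, 0⟩) (forest hc) (by simpa using hB)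
    (card_chainLength_pos hc)
    (N := G.pairs fun x => (top e (e.symm x), depth e (e.symm x)))
    (S := G.singles fun x => (top e (e.symm x), depth e (e.symm x)))
    (fun x z => by simpa using hG.pairs_iff hφ.inj x z)
    (fun z => by simpa using hG.singles_iff hφ.inj z)
  rw [survivesBelow_codes, ← hG.empty_iff] at hout
  obtain ⟨t, ht, s, hrun, hs⟩ := hout (RAM.initial (encoding e Ls)) rfl 0 le_rfl
    fun r hr => absurd hr (Nat.not_lt_zero r)
  rw [List.length_map] at ht
  obtain ⟨p, hp, hcode⟩ := exists_winner (e := e) hc hcard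
  exact ⟨p, hp, hinp' ▸ mem_encoding_le e h2 (by nlinarith), t, ht.trans htime, s, hinp' ▸ hrun,
    hs.trans hcode.symm⟩

end PosetGame

/-- One program solves the problem of finding the player with a winning strategy when Maker starts,
in at most `C * h ^ (2 * (w + 1))` unit-cost steps, on words of `O(log (C * h ^ (2 * (w + 1))))`
bits, for all `h ≥ h₀` and all `w`. -/
theorem mainTheorem5 :
    ∃ (P : RAM.Program) (C h₀ : ℕ), ∀ (w h : ℕ), h₀ ≤ h →
      ∀ (X : Type*) [PartialOrder X] (G : PosetGame X),
        ConsistsOfDisjointChains X w h →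
        (∀ S ∈ G.winningSets, S.encard ≤ 2) →
        ∀ inp : List ℕ, G.Encodes inp →
          ∃ p : Player, G.HasWinningStrategy p ∧
            P.Computes (C * h ^ (2 * (w + 1))) (C * h ^ (2 * (w + 1))) inp p.code :=
  ⟨RAM.solveE 0, 20000000, 7, fun _ _ hh _ _ _ hX hcard _ hinp =>
    PosetGame.solveE_computes hh hX hcard hinp⟩
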